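/- **Setting.** Let $X,Y$ be Banach spaces and let $A$, $B$ generate $C_0$-semigroups $(e^{tA})_{t\ge0}$ on $X$ and $(e^{tB})_{t\ge0}$ on $Y$. Let $(X_\alpha)_{\alpha\ge-1}$ and $(Y_\alpha)_{\alpha\ge-1}$ be densely injected Banach scales generated by $A$ and by $B-\lambda$ (some $\lambda\in\rho(B)$), with norms fixed up to equivalence: $X_\alpha\hookrightarrow X_\beta$ densely for $\alpha\ge\beta\ge-1$, $X_0=X$, $X_1=D(A)$, and $A:X_{\alpha}\to X_{\alpha-1}$ is a compatible isomorphism for every $\alpha\ge0$; similarly for $Y$ and $B-\lambda$. (For example, these may be the interpolation-extrapolation scales.) Let $\gamma_X,\delta_Y\in(0,1]$, $\delta_X\in[1-\gamma_X,1]$, $\delta_X>0$. Let $f:X_{\delta_X}\times Y_{1-\delta_X}\to X$ be continuous, $g:X_1\times Y_1\to Y_{\delta_Y}$, $f(0,0)=0$, $g(0,0)=0$, and let $L_f,L_g>0$ be such that, for all $x_i\in X_1$, $y_i\in Y_1$, $$\|f(x_1,y_1)-f(x_2,y_2)\|_{X_{\gamma_X}}\le L_f(\|x_1-x_2\|_{X_1}+\|y_1-y_2\|_{Y_1}),\qquad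 \|g(x_1,y_1)-g(x_2,y_2)\|_{Y_{\delta_Y}}\le L_g(\|x_1-x_2\|_{X_1}+\|y_1-y_2\|_{Y_1}),$$ and such that for all $t>0$, $u,u_i\in C^1([0,t];X_{\delta_X})$, $v,v_i\in C^1([0,t];Y)\cap C([0,t];Y_{1-\delta_X})$ one has $f(u,v)\in C^1([0,t];X_{\delta_X-1})$ and $$\|f(u_1,v_1)-f(u_2,v_2)\|_{C^1([0,t];X_{\delta_X-1})}\le L_f(\|u_1-u_2\|_{C^1([0,t];X_{\delta_X})}+\|v_1-v_2\|_{C^1([0,t];Y)}).$$ Let $M_A,M_B,C_A,C_B>0$, $\omega_A<0$, $\omega_B\in\mathbb R$ be such that for all $t>0$ $$\|e^{tA}\|_{\mathcal B(X_1)}\le M_Ae^{\omega_At},\quad \|e^{tA}\|_{\mathcal B(X_{\gamma},X_1)}\le C_At^{\gamma-1}e^{\omega_At}\ (\gamma\in\{\gamma_X,\delta_X\}),\quad \|e^{tB}\|_{\mathcal B(Y_1)}\le M_Be^{\omega_Bt},\quad \|e^{tB}\|_{\mathcal B(Y_{\delta_Y},Y_1)}\le C_Bt^{\delta_Y-1}e^{\omega_Bt}.$$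 Let $\omega_f=\omega_A+(2C_AL_f)^{1/\gamma_X}\gamma_X^{-(1-\gamma_X)/\gamma_X}$ if $\gamma_X<1$, and let $\omega_f>\omega_A+C_AL_f$ be any number if $\gamma_X=1$; assume $\omega_f<0$ and $L_f\max\{\|A^{-1}\|_{\mathcal B(X_{\gamma_X},X_1)},\|A^{-1}\|_{\mathcal B(X_{\delta_X-1},X_{\delta_X})}\}<1$. For $y\in Y_1$ let $h^0(y)\in X_1$ be the solution of $0=Ah^0(y)+f(h^0(y),y)$. For $0<\zeta<\zeta_0$ let $Y=Y_F^\zeta\oplus Y_S^\zeta$ be a splitting into closed subspaces, with bounded projections $\mathrm{pr}_{Y_F^\zeta}$, $\mathrm{pr}_{Y_S^\zeta}$ which commute with $B$ on $Y_1$ and are bounded on $Y_1$ uniformly in $\zeta$, such that for all $x,\tilde x\in X_1$, $y_F,\tilde y_F\in Y_F^\zeta\cap Y_1$, $y_S,\tilde y_S\in Y_S^\zeta\cap Y_1$, with $\Delta:=\|x-\tilde x\|_{X_1}+\|y_F-\tilde y_F\|_{Y_1}+\|y_S-\tilde y_S\|_{Y_1}$, $$\|\mathrm{pr}_{Y_S^\zeta}[g(x,y_F+y_S)-g(\tilde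 x,\tilde y_F+\tilde y_S)]\|_{Y_1}\le L_g\zeta^{\delta_Y-1}\Delta,\qquad \|\mathrm{pr}_{Y_F^\zeta}[g(x,y_F+y_S)-g(\tilde x,\tilde y_F+\tilde y_S)]\|_{Y_{\delta_Y}}\le L_g\Delta.$$ Assume that $(e^{tB})_{t\ge0}$ extends to a $C_0$-group on $Y_S^\zeta$, that $0$ is in the resolvent set of the realization of $B$ in $Y_F^\zeta$, and that there are $C_B',M_B'>0$, independent of $\zeta$, and $0\le N_F^\zeta<N_S^\zeta$ with $$\|e^{tB}y_F\|_{Y_1}\le C_B't^{\delta_Y-1}e^{(N_F^\zeta+\zeta^{-1}\omega_A)t}\|y_F\|_{Y_{\delta_Y}}\ (t>0),\qquad \|e^{-tB}y_S\|_{Y_1}\le M_B'e^{-(N_S^\zeta+\zeta^{-1}\omega_A)t}\|y_S\|_{Y_1}\ (t\ge0)$$ for $y_F\in Y_F^\zeta\cap Y_{\delta_Y}$, $y_S\in Y_S^\zeta\cap Y_1$. For $\varepsilon>0$ and $w\in Y_S^\zeta\cap Y_1$ let $(u,v_F,v_S)$ denote the fixed point, among the continuous functions $(-\infty,0]\to X_1\times(Y_F^\zeta\cap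 Y_1)\times(Y_S^\zeta\cap Y_1)$ that are $O(e^{\eta t})$ with $\eta=\zeta^{-1}\omega_A+\frac{N_S^\zeta+N_F^\zeta}2$, of the Lyapunov-Perron operator $$\begin{pmatrix}u\\v_F\\v_S\end{pmatrix}\mapsto\left[t\mapsto\begin{pmatrix}\varepsilon^{-1}\int_{-\infty}^te^{\varepsilon^{-1}(t-s)A}f(u(s),v_F(s)+v_S(s))\,ds\\ \int_{-\infty}^te^{(t-s)B}\mathrm{pr}_{Y_F^\zeta}g(u(s),v_F(s)+v_S(s))\,ds\\ e^{tB}w+\int_0^te^{(t-s)B}\mathrm{pr}_{Y_S^\zeta}g(u(s),v_F(s)+v_S(s))\,ds\end{pmatrix}\right].$$ The slow manifold $S_{\varepsilon,\zeta}\subset X_1\times Y_1$ is the set of all points $(u(0),v_F(0)+w)$ obtained in this way. Given $(u_0,v_0)\in X_1\times Y_1$ and $T>0$, let $(u^\varepsilon,v^\varepsilon)\in C^1([0,T];X\times Y)\cap C([0,T];X_1\times Y_1)$ be a strict solution of $$\varepsilon\partial_tu^\varepsilon=Au^\varepsilon+f(u^\varepsilon,v^\varepsilon),\quad \partial_tv^\varepsilon=Bv^\varepsilon+g(u^\varepsilon,v^\varepsilon),\quad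 (u^\varepsilon,v^\varepsilon)(0)=(u_0,v_0),$$ and let $(u^0_\zeta,v^0_\zeta)$, with $u^0_\zeta\in C([0,T];X_1)$ and $v^0_\zeta\in C^1([0,T];Y)\cap C([0,T];Y_1)$, be a strict solution of the reduced slow subsystem $$0=Au^0_\zeta+f(u^0_\zeta,v^0_\zeta),\quad 0=\mathrm{pr}_{Y_F^\zeta}v^0_\zeta,\quad \partial_tv^0_\zeta=Bv^0_\zeta+\mathrm{pr}_{Y_S^\zeta}g(u^0_\zeta,v^0_\zeta),\quad v^0_\zeta(0)=\mathrm{pr}_{Y_S^\zeta}v_0 .$$ **Statement.** (1) For every $T>0$ there is $C>0$ such that for all $\varepsilon\in(0,1]$, all $\zeta\in(0,\zeta_0)$ with $\omega_B-\zeta^{-1}\omega_A-N_F^\zeta>0$, all $(u_0,v_0)\in X_1\times Y_1$, all such solutions and all $t\in[0,T]$, $$\|u^\varepsilon(t)-h^0(v^0_\zeta(t))\|_{X_1}+\|v^\varepsilon(t)-v^0_\zeta(t)\|_{Y_1}\le C\Big(\|\mathrm{pr}_{Y_F^\zeta}v_0\|_{Y_1}+\big(\varepsilon+(\omega_B-\zeta^{-1}\omega_A-N_F^\zeta)^{-\delta_Y}\big)\|v_0\|_{Y_1}+\big(\varepsilon^{\delta_Y}+e^{\varepsilon^{-1}\omega_ft}\big)\|u_0-h^0(v_0)\|_{X_1}\Big).$$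 (2) For every $T>0$ and $c\in(0,1)$ there is $C>0$ such that for all $\varepsilon\in(0,1]$ and $\zeta\in(0,\zeta_0)$ with $\omega_B-\zeta^{-1}\omega_A-N_F^\zeta>0$, $\varepsilon<c\,\zeta\,\frac{(L_fC_A\Gamma(\gamma_X))^{1/\gamma_X}+\omega_A}{\omega_A}$ and $$\frac{2^{\gamma_X}L_fC_A\Gamma(\gamma_X)}{\big(2(\varepsilon\zeta^{-1}-1)\omega_A+\varepsilon(N_S^\zeta+N_F^\zeta)\big)^{\gamma_X}}+\frac{2^{\delta_Y}L_gC_B'\Gamma(\delta_Y)}{(N_S^\zeta-N_F^\zeta)^{\delta_Y}}+\frac{2\zeta^{\delta_Y-1}L_gM_B'\Gamma(\delta_Y)}{N_S^\zeta-N_F^\zeta}<1,$$ all initial values $(u_0,v_0)\in S_{\varepsilon,\zeta}$, all such solutions and all $t\in[0,T]$, $$\|u^\varepsilon(t)-h^0(v^0_\zeta(t))\|_{X_1}+\|v^\varepsilon(t)-v^0_\zeta(t)\|_{Y_1}\le C\Big(\varepsilon+(\omega_B-\zeta^{-1}\omega_A-N_F^\zeta)^{-\delta_Y}+(N_S^\zeta-N_F^\zeta)^{-\delta_Y}\Big)\|v_0\|_{Y_1}.$$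 -/

import Mathlib

open Set Filter Topology MeasureTheory

universe u

namespace FastSlow

noncomputable section

/-- A `C₀`-semigroup of bounded linear operators; only the times `t ≥ 0` matter. -/
structure C0Semigroup (X : Type u) [NormedAddCommGroup X] [NormedSpace ℝ X] where
  toFun : ℝ → X →L[ℝ] X
  map_zero : toFun 0 = ContinuousLinearMap.id ℝ X
  map_add : ∀ s t : ℝ, 0 ≤ s → 0 ≤ t → toFun (s + t) = (toFun s).comp (toFun t)
  continuousOn : ∀ x : X, ContinuousOn (fun t => toFun t x) (Ici 0)

/-- `A` (with its domain) is the infinitesimal generator of the semigroup. -/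
def C0Semigroup.IsGeneratedBy {X : Type u} [NormedAddCommGroup X] [NormedSpace ℝ X]
    (S : C0Semigroup X) (A : X →ₗ.[ℝ] X) : Prop :=
  ∀ x y : X, (x, y) ∈ A.graph ↔
    Tendsto (fun h : ℝ => h⁻¹ • (S.toFun h x - x)) (𝓝[>] 0) (𝓝 y)

/-- A densely injected Banach scale `(X_α)`, `α ≥ -1`, generated by the operator `A - lam` on `X`
(in particular `lam ∈ ρ(A)`), with `X_0 = X` and `X_1 = D(A)`, all norms being fixed only up to
equivalence.  Every interpolation-extrapolation scale generated by `A - lam`, for whatever choice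
of admissible interpolation functors, is of this form.  Nothing is asked of indices below `-1`. -/
structure BanachScale (X : Type u) [NormedAddCommGroup X] [NormedSpace ℝ X]
    (A : X →ₗ.[ℝ] X) (lam : ℝ) where
  /-- the Banach space `X_α` -/
  space : ℝ → Type u
  [normedAddCommGroup : ∀ α, NormedAddCommGroup (space α)]
  [normedSpace : ∀ α, NormedSpace ℝ (space α)]
  [completeSpace : ∀ α, CompleteSpace (space α)]
  /-- `X_0 = X` up to an equivalent norm -/
  zeroEquiv : space 0 ≃L[ℝ] X
  /-- the dense injection `X_α ↪ X_β`, for `α ≥ β ≥ -1` -/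
  incl : ∀ α β : ℝ, space α →L[ℝ] space β
  incl_self : ∀ α, -1 ≤ α → incl α α = ContinuousLinearMap.id ℝ (space α)
  incl_comp : ∀ α β γ, -1 ≤ γ → γ ≤ β → β ≤ α → (incl β γ).comp (incl α β) = incl α γ
  incl_injective : ∀ α β, -1 ≤ β → β ≤ α → Function.Injective (incl α β)
  incl_denseRange : ∀ α β, -1 ≤ β → β ≤ α → DenseRange (incl α β)
  /-- the isomorphism `(A - lam) : X_α → X_{α-1}`, for `α ≥ 0` -/
  op : ∀ α : ℝ, space α →L[ℝ] space (α - 1)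
  op_bijective : ∀ α, 0 ≤ α → Function.Bijective (op α)
  op_incl : ∀ α β, 0 ≤ β → β ≤ α → ∀ x : space α,
    op β (incl α β x) = incl (α - 1) (β - 1) (op α x)
  /-- `X_1` is the domain of `A` -/
  mem_domain_iff : ∀ x : X, x ∈ A.domain ↔ ∃ w : space 1, zeroEquiv (incl 1 0 w) = x
  /-- on `X_1` the isomorphism of the scale is `A - lam` -/
  op_one : ∀ w : space 1, (zeroEquiv (incl 1 0 w),
    zeroEquiv (incl (1 - 1) 0 (op 1 w)) + lam • zeroEquiv (incl 1 0 w)) ∈ A.graph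

attribute [instance] BanachScale.normedAddCommGroup BanachScale.normedSpace
  BanachScale.completeSpace

namespace BanachScale

variable {X : Type u} [NormedAddCommGroup X] [NormedSpace ℝ X] {A : X →ₗ.[ℝ] X} {lam : ℝ}

/-- the embedding `X_α ↪ X`, for `α ≥ 0` -/
def emb (S : BanachScale X A lam) (α : ℝ) : S.space α →L[ℝ] X :=
  (S.zeroEquiv : S.space 0 →L[ℝ] X).comp (S.incl α 0)

/-- the embedding `X ↪ X_α`, for `-1 ≤ α ≤ 0` -/
def extra (S : BanachScale X A lam) (α : ℝ) : X →L[ℝ] S.space α :=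
  (S.incl 0 α).comp (S.zeroEquiv.symm : X →L[ℝ] S.space 0)

/-- the operator `A`, as a bounded map `X_1 → X` -/
def gen (S : BanachScale X A lam) : S.space 1 →L[ℝ] X :=
  ((S.zeroEquiv : S.space 0 →L[ℝ] X).comp (S.incl (1 - 1) 0)).comp (S.op 1) + lam • S.emb 1

/-- `x ∈ X_α` and `‖x‖_{X_α} ≤ r`, for `α ≥ 0` -/
def NormLE (S : BanachScale X A lam) (α : ℝ) (x : X) (r : ℝ) : Prop :=
  ∃ w : S.space α, S.emb α w = x ∧ ‖w‖ ≤ r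

end BanachScale

/-- the norm of `C¹([0,t];E)` -/
def c1Norm {E : Type u} [NormedAddCommGroup E] [NormedSpace ℝ E] (t : ℝ) (w : ℝ → E) : ℝ :=
  (⨆ s : Icc (0 : ℝ) t, ‖w s‖) + ⨆ s : Icc (0 : ℝ) t, ‖derivWithin w (Icc 0 t) s‖

/-- The data of the fast-slow system `ε u' = A u + f(u,v)`, `v' = B v + g(u,v)`. -/
structure System (X Y : Type u) [NormedAddCommGroup X] [NormedSpace ℝ X]
    [NormedAddCommGroup Y] [NormedSpace ℝ Y] where
  A : X →ₗ.[ℝ] X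
  B : Y →ₗ.[ℝ] Y
  /-- `e^{tA}` -/
  expA : C0Semigroup X
  /-- `e^{tB}` -/
  expB : C0Semigroup Y
  lam : ℝ
  XS : BanachScale X A 0
  YS : BanachScale Y B lam
  (γX δX δY : ℝ)
  f : XS.space δX → YS.space (1 - δX) → X
  g : XS.space 1 → YS.space 1 → YS.space δY
  (Lf Lg MA MB CA CB ωA ωB ωf : ℝ)

namespace System

variable {X Y : Type u} [NormedAddCommGroup X] [NormedSpace ℝ X]
  [NormedAddCommGroup Y] [NormedSpace ℝ Y]

/-- the space `X_1 = D(A)` -/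
abbrev X₁ (F : System X Y) : Type u := F.XS.space 1

/-- the space `Y_1 = D(B)` -/
abbrev Y₁ (F : System X Y) : Type u := F.YS.space 1

/-- `f` on `X_1 × Y_1` -/
def f₁ (F : System X Y) (x : F.X₁) (y : F.Y₁) : X :=
  F.f (F.XS.incl 1 F.δX x) (F.YS.incl 1 (1 - F.δX) y)

/-- `g` as a map into `Y` -/
def g₁ (F : System X Y) (x : F.X₁) (y : F.Y₁) : Y := F.YS.emb F.δY (F.g x y)

/-- The standing assumptions on the fast-slow system. -/
structure Admissible (F : System X Y) : Prop where
  generator_A : F.expA.IsGeneratedBy F.A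
  generator_B : F.expB.IsGeneratedBy F.B
  γX_mem : F.γX ∈ Ioc (0 : ℝ) 1
  δX_mem : F.δX ∈ Icc (1 - F.γX) 1
  δX_pos : 0 < F.δX
  δY_mem : F.δY ∈ Ioc (0 : ℝ) 1
  Lf_pos : 0 < F.Lf
  Lg_pos : 0 < F.Lg
  MA_pos : 0 < F.MA
  MB_pos : 0 < F.MB
  CA_pos : 0 < F.CA
  CB_pos : 0 < F.CB
  ωA_neg : F.ωA < 0
  f_continuous : Continuous (fun p : F.XS.space F.δX × F.YS.space (1 - F.δX) => F.f p.1 p.2)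
  f_zero : F.f 0 0 = 0
  g_zero : F.g 0 0 = 0
  f_lipschitz : ∀ (x₁ x₂ : F.X₁) (y₁ y₂ : F.Y₁),
    F.XS.NormLE F.γX (F.f₁ x₁ y₁ - F.f₁ x₂ y₂) (F.Lf * (‖x₁ - x₂‖ + ‖y₁ - y₂‖))
  g_lipschitz : ∀ (x₁ x₂ : F.X₁) (y₁ y₂ : F.Y₁),
    ‖F.g x₁ y₁ - F.g x₂ y₂‖ ≤ F.Lg * (‖x₁ - x₂‖ + ‖y₁ - y₂‖)
  /-- `f(u,v) ∈ C¹([0,t];X_{δ_X-1})` for `u ∈ C¹([0,t];X_{δ_X})` and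
  `v ∈ C¹([0,t];Y) ∩ C([0,t];Y_{1-δ_X})` -/
  f_contDiff : ∀ t : ℝ, 0 < t →
    ∀ (w : ℝ → F.XS.space F.δX) (z : ℝ → F.YS.space (1 - F.δX)),
    ContDiffOn ℝ 1 w (Icc 0 t) → ContinuousOn z (Icc 0 t) →
    ContDiffOn ℝ 1 (fun s => F.YS.emb (1 - F.δX) (z s)) (Icc 0 t) →
    ContDiffOn ℝ 1 (fun s => F.XS.extra (F.δX - 1) (F.f (w s) (z s))) (Icc 0 t)
  f_c1_lipschitz : ∀ t : ℝ, 0 < t →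
    ∀ (w₁ w₂ : ℝ → F.XS.space F.δX) (z₁ z₂ : ℝ → F.YS.space (1 - F.δX)),
    ContDiffOn ℝ 1 w₁ (Icc 0 t) → ContDiffOn ℝ 1 w₂ (Icc 0 t) →
    ContinuousOn z₁ (Icc 0 t) → ContinuousOn z₂ (Icc 0 t) →
    ContDiffOn ℝ 1 (fun s => F.YS.emb (1 - F.δX) (z₁ s)) (Icc 0 t) →
    ContDiffOn ℝ 1 (fun s => F.YS.emb (1 - F.δX) (z₂ s)) (Icc 0 t) →
    c1Norm t (fun s => F.XS.extra (F.δX - 1) (F.f (w₁ s) (z₁ s) - F.f (w₂ s) (z₂ s))) ≤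
      F.Lf * (c1Norm t (fun s => w₁ s - w₂ s) +
        c1Norm t (fun s => F.YS.emb (1 - F.δX) (z₁ s - z₂ s)))
  expA_bound : ∀ t : ℝ, 0 < t → ∀ x : F.X₁,
    F.XS.NormLE 1 (F.expA.toFun t (F.XS.emb 1 x)) (F.MA * Real.exp (F.ωA * t) * ‖x‖)
  expA_smoothing_γ : ∀ t : ℝ, 0 < t → ∀ x : F.XS.space F.γX,
    F.XS.NormLE 1 (F.expA.toFun t (F.XS.emb F.γX x))
      (F.CA * t ^ (F.γX - 1) * Real.exp (F.ωA * t) * ‖x‖)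
  expA_smoothing_δ : ∀ t : ℝ, 0 < t → ∀ x : F.XS.space F.δX,
    F.XS.NormLE 1 (F.expA.toFun t (F.XS.emb F.δX x))
      (F.CA * t ^ (F.δX - 1) * Real.exp (F.ωA * t) * ‖x‖)
  expB_bound : ∀ t : ℝ, 0 < t → ∀ y : F.Y₁,
    F.YS.NormLE 1 (F.expB.toFun t (F.YS.emb 1 y)) (F.MB * Real.exp (F.ωB * t) * ‖y‖)
  expB_smoothing : ∀ t : ℝ, 0 < t → ∀ y : F.YS.space F.δY,
    F.YS.NormLE 1 (F.expB.toFun t (F.YS.emb F.δY y))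
      (F.CB * t ^ (F.δY - 1) * Real.exp (F.ωB * t) * ‖y‖)
  ωf_eq : F.γX < 1 →
    F.ωf = F.ωA + (2 * F.CA * F.Lf) ^ (1 / F.γX) * (1 / F.γX) ^ ((1 - F.γX) / F.γX)
  ωf_gt : F.γX = 1 → F.ωA + F.CA * F.Lf < F.ωf
  ωf_neg : F.ωf < 0
  /-- `L_f ‖A⁻¹‖ < 1` for the norms of `B(X_{γ_X}, X_1)` and `B(X_{δ_X-1}, X_{δ_X})` -/
  Lf_inv_lt_one : ∃ κ : ℝ, 0 ≤ κ ∧ F.Lf * κ < 1 ∧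
    (∀ (x : F.X₁) (w : F.XS.space F.γX), F.XS.gen x = F.XS.emb F.γX w → ‖x‖ ≤ κ * ‖w‖) ∧
    (∀ x : F.XS.space F.δX, ‖x‖ ≤ κ * ‖F.XS.op F.δX x‖)

/-- the map `h⁰ : Y_1 → X_1` whose graph is the critical manifold:
`h⁰(y)` is the solution `x` of `0 = A x + f(x,y)` -/
def h₀ (F : System X Y) (y : F.Y₁) : F.X₁ :=
  Classical.epsilon (fun x : F.X₁ => F.XS.gen x + F.f₁ x y = 0)

/-- `(u,v) ∈ C¹([0,T];X×Y) ∩ C([0,T];X_1×Y_1)` is a strict solution of the fast-slow system -/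
structure IsStrictSolution (F : System X Y) (ε T : ℝ) (u₀ : F.X₁) (v₀ : F.Y₁)
    (u : ℝ → F.X₁) (v : ℝ → F.Y₁) : Prop where
  u_continuousOn : ContinuousOn u (Icc 0 T)
  v_continuousOn : ContinuousOn v (Icc 0 T)
  u_contDiffOn : ContDiffOn ℝ 1 (fun s => F.XS.emb 1 (u s)) (Icc 0 T)
  v_contDiffOn : ContDiffOn ℝ 1 (fun s => F.YS.emb 1 (v s)) (Icc 0 T)
  u_eq : ∀ t ∈ Icc 0 T, ε • derivWithin (fun s => F.XS.emb 1 (u s)) (Icc 0 T) t =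
    F.XS.gen (u t) + F.f₁ (u t) (v t)
  v_eq : ∀ t ∈ Icc 0 T, derivWithin (fun s => F.YS.emb 1 (v s)) (Icc 0 T) t =
    F.YS.gen (v t) + F.g₁ (u t) (v t)
  u_zero : u 0 = u₀
  v_zero : v 0 = v₀

end System

/-- The data of a family of splittings `Y = Y_F^ζ ⊕ Y_S^ζ`, `0 < ζ < ζ₀`. -/
structure Splitting (Y : Type u) [NormedAddCommGroup Y] [NormedSpace ℝ Y] where
  ζ₀ : ℝ
  /-- the projection onto `Y_F^ζ` -/
  prF : ℝ → Y →L[ℝ] Y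
  /-- the projection onto `Y_S^ζ` -/
  prS : ℝ → Y →L[ℝ] Y
  /-- `group ζ t` is `e^{tB}` on `Y_S^ζ`, for `t ∈ ℝ`, extended by `0` to `Y_F^ζ` -/
  group : ℝ → ℝ → Y →L[ℝ] Y
  NF : ℝ → ℝ
  NS : ℝ → ℝ
  (CB MB K : ℝ)

namespace Splitting

variable {X Y : Type u} [NormedAddCommGroup X] [NormedSpace ℝ X]
  [NormedAddCommGroup Y] [NormedSpace ℝ Y]

/-- The assumptions on the splittings (apart from the gap condition). -/
structure Admissible (P : Splitting Y) (F : System X Y) : Prop where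
  ζ₀_pos : 0 < P.ζ₀
  CB_pos : 0 < P.CB
  MB_pos : 0 < P.MB
  prF_add_prS : ∀ ζ ∈ Ioo 0 P.ζ₀, P.prF ζ + P.prS ζ = ContinuousLinearMap.id ℝ Y
  prF_idem : ∀ ζ ∈ Ioo 0 P.ζ₀, (P.prF ζ).comp (P.prF ζ) = P.prF ζ
  /-- the projections commute with `B` on `Y_1` -/
  commute : ∀ ζ ∈ Ioo 0 P.ζ₀, ∀ y : F.Y₁, ∃ y' : F.Y₁,
    F.YS.emb 1 y' = P.prF ζ (F.YS.emb 1 y) ∧ F.YS.gen y' = P.prF ζ (F.YS.gen y)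
  /-- the projections are bounded on `Y_1`, uniformly in `ζ` -/
  prS_bound : ∀ ζ ∈ Ioo 0 P.ζ₀, ∀ y : F.Y₁,
    F.YS.NormLE 1 (P.prS ζ (F.YS.emb 1 y)) (P.K * ‖y‖)
  /-- `pr_S g` is Lipschitz with values in `Y_1` -/
  prS_g : ∀ ζ ∈ Ioo 0 P.ζ₀, ∀ (x x' : F.X₁) (yF yF' yS yS' : F.Y₁),
    P.prS ζ (F.YS.emb 1 yF) = 0 → P.prS ζ (F.YS.emb 1 yF') = 0 →
    P.prF ζ (F.YS.emb 1 yS) = 0 → P.prF ζ (F.YS.emb 1 yS') = 0 →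
    F.YS.NormLE 1 (P.prS ζ (F.g₁ x (yF + yS) - F.g₁ x' (yF' + yS')))
      (F.Lg * ζ ^ (F.δY - 1) * (‖x - x'‖ + ‖yF - yF'‖ + ‖yS - yS'‖))
  /-- `pr_F g` is Lipschitz with values in `Y_{δ_Y}`, with the constant `L_g` -/
  prF_g : ∀ ζ ∈ Ioo 0 P.ζ₀, ∀ (x x' : F.X₁) (yF yF' yS yS' : F.Y₁),
    P.prS ζ (F.YS.emb 1 yF) = 0 → P.prS ζ (F.YS.emb 1 yF') = 0 →
    P.prF ζ (F.YS.emb 1 yS) = 0 → P.prF ζ (F.YS.emb 1 yS') = 0 →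
    F.YS.NormLE F.δY (P.prF ζ (F.g₁ x (yF + yS) - F.g₁ x' (yF' + yS')))
      (F.Lg * (‖x - x'‖ + ‖yF - yF'‖ + ‖yS - yS'‖))
  /-- `e^{tB}` extends to a `C₀`-group on `Y_S^ζ` -/
  group_of_nonneg : ∀ ζ ∈ Ioo 0 P.ζ₀, ∀ t : ℝ, 0 ≤ t →
    P.group ζ t = (F.expB.toFun t).comp (P.prS ζ)
  group_add : ∀ ζ ∈ Ioo 0 P.ζ₀, ∀ s t : ℝ,
    P.group ζ (s + t) = (P.group ζ s).comp (P.group ζ t)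
  group_continuous : ∀ ζ ∈ Ioo 0 P.ζ₀, ∀ y : Y, Continuous (fun t => P.group ζ t y)
  /-- `0` is in the resolvent set of the realization of `B` in `Y_F^ζ` -/
  resolvent : ∀ ζ ∈ Ioo 0 P.ζ₀, ∀ w : Y, P.prS ζ w = 0 →
    ∃! y : F.Y₁, P.prS ζ (F.YS.emb 1 y) = 0 ∧ F.YS.gen y = w
  NF_nonneg : ∀ ζ ∈ Ioo 0 P.ζ₀, 0 ≤ P.NF ζ
  NF_lt_NS : ∀ ζ ∈ Ioo 0 P.ζ₀, P.NF ζ < P.NS ζ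
  decay_F : ∀ ζ ∈ Ioo 0 P.ζ₀, ∀ t : ℝ, 0 < t → ∀ y : F.YS.space F.δY,
    P.prS ζ (F.YS.emb F.δY y) = 0 →
    F.YS.NormLE 1 (F.expB.toFun t (F.YS.emb F.δY y))
      (P.CB * t ^ (F.δY - 1) * Real.exp ((P.NF ζ + ζ⁻¹ * F.ωA) * t) * ‖y‖)
  growth_S : ∀ ζ ∈ Ioo 0 P.ζ₀, ∀ t : ℝ, 0 ≤ t → ∀ y : F.Y₁,
    P.prF ζ (F.YS.emb 1 y) = 0 →
    F.YS.NormLE 1 (P.group ζ (-t) (F.YS.emb 1 y))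
      (P.MB * Real.exp (-(P.NS ζ + ζ⁻¹ * F.ωA) * t) * ‖y‖)

/-- the gap condition -/
def GapCondition (P : Splitting Y) (F : System X Y) (ε ζ : ℝ) : Prop :=
  2 ^ F.γX * F.Lf * F.CA * Real.Gamma F.γX /
      (2 * (ε * ζ⁻¹ - 1) * F.ωA + ε * (P.NS ζ + P.NF ζ)) ^ F.γX +
    2 ^ F.δY * F.Lg * P.CB * Real.Gamma F.δY / (P.NS ζ - P.NF ζ) ^ F.δY +
    2 * ζ ^ (F.δY - 1) * F.Lg * P.MB * Real.Gamma F.δY / (P.NS ζ - P.NF ζ) < 1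

/-- `(u_ζ,v_ζ)` is a strict solution on `[0,T]` of the reduced slow subsystem, with
`v_ζ(0) = pr_S v₀` -/
structure IsReducedSolution (P : Splitting Y) (F : System X Y) (ζ T : ℝ) (v₀ : F.Y₁)
    (u : ℝ → F.X₁) (v : ℝ → F.Y₁) : Prop where
  u_continuousOn : ContinuousOn u (Icc 0 T)
  v_continuousOn : ContinuousOn v (Icc 0 T)
  v_contDiffOn : ContDiffOn ℝ 1 (fun s => F.YS.emb 1 (v s)) (Icc 0 T)
  u_eq : ∀ t ∈ Icc 0 T, 0 = F.XS.gen (u t) + F.f₁ (u t) (v t)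
  prF_eq : ∀ t ∈ Icc 0 T, 0 = P.prF ζ (F.YS.emb 1 (v t))
  v_eq : ∀ t ∈ Icc 0 T, derivWithin (fun s => F.YS.emb 1 (v s)) (Icc 0 T) t =
    F.YS.gen (v t) + P.prS ζ (F.g₁ (u t) (v t))
  v_zero : F.YS.emb 1 (v 0) = P.prS ζ (F.YS.emb 1 v₀)

/-- `(u,v_F,v_S)` is a fixed point, in the weighted space `C_η` on `(-∞,0]` with
`η = ζ⁻¹ ω_A + (N_S + N_F) / 2`, of the Lyapunov-Perron operator for the point
`w ∈ Y_S^ζ ∩ Y_1` -/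
structure IsLyapunovPerron (P : Splitting Y) (F : System X Y) (ε ζ : ℝ) (w : F.Y₁)
    (u : ℝ → F.X₁) (vF vS : ℝ → F.Y₁) : Prop where
  u_continuousOn : ContinuousOn u (Iic 0)
  vF_continuousOn : ContinuousOn vF (Iic 0)
  vS_continuousOn : ContinuousOn vS (Iic 0)
  vF_mem : ∀ t ≤ 0, P.prS ζ (F.YS.emb 1 (vF t)) = 0
  vS_mem : ∀ t ≤ 0, P.prF ζ (F.YS.emb 1 (vS t)) = 0
  bounded : ∃ M : ℝ, ∀ t ≤ 0, ‖u t‖ + ‖vF t‖ + ‖vS t‖ ≤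
    M * Real.exp ((ζ⁻¹ * F.ωA + (P.NS ζ + P.NF ζ) / 2) * t)
  u_integrable : ∀ t ≤ 0, IntegrableOn
    (fun s => F.expA.toFun (ε⁻¹ * (t - s)) (F.f₁ (u s) (vF s + vS s))) (Iic t)
  u_eq : ∀ t ≤ 0, F.XS.emb 1 (u t) =
    ε⁻¹ • ∫ s in Iic t, F.expA.toFun (ε⁻¹ * (t - s)) (F.f₁ (u s) (vF s + vS s))
  vF_integrable : ∀ t ≤ 0, IntegrableOn
    (fun s => F.expB.toFun (t - s) (P.prF ζ (F.g₁ (u s) (vF s + vS s)))) (Iic t)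
  vF_eq : ∀ t ≤ 0, F.YS.emb 1 (vF t) =
    ∫ s in Iic t, F.expB.toFun (t - s) (P.prF ζ (F.g₁ (u s) (vF s + vS s)))
  vS_eq : ∀ t ≤ 0, F.YS.emb 1 (vS t) = P.group ζ t (F.YS.emb 1 w) +
    ∫ s in (0 : ℝ)..t, P.group ζ (t - s) (P.prS ζ (F.g₁ (u s) (vF s + vS s)))

/-- The slow manifold `S_{ε,ζ} = {(h(w), w) : w ∈ Y_S^ζ ∩ Y_1}`, as a subset of `X_1 × Y_1`:
`h(w)` is the value at time `0` of the components `(u,v_F)` of the fixed point of the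
Lyapunov-Perron operator. -/
def slowManifold (P : Splitting Y) (F : System X Y) (ε ζ : ℝ) : Set (F.X₁ × F.Y₁) :=
  {p | ∃ (w : F.Y₁) (u : ℝ → F.X₁) (vF vS : ℝ → F.Y₁),
    P.prF ζ (F.YS.emb 1 w) = 0 ∧ P.IsLyapunovPerron F ε ζ w u vF vS ∧
    p = (u 0, vF 0 + w)}

end Splitting

end

end FastSlow

/-! Everything rests on variation of constants and on convolutions with singular kernels `t^(α-1)
e^(ωt)`. Against `e^(μs)` such a kernel has mass at most `Γ(α)/p^α`, where `p` is the net decay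
rate. A bound that reproduces itself with a factor below 1 then closes.

Arbitrary initial values. The point `h⁰(y)` is the fixed point of the contraction `x ↦ -A⁻¹ f(x,y)`.
Running the same contraction in `C¹` with values in `X_{δ_X}` shows that `h⁰` along a reduced
solution has a derivative `d` bounded by a multiple of `‖v₀‖`. Hence `x = u - h⁰(v⁰)` solves `ε x' =
A x + [f(u,v) - f(h⁰(v⁰),v⁰)] - ε d`. The exponent `ωf` is chosen so that the Lipschitz term
contributes a factor `q < 1`. What remains is the layer `e^(ωf t/ε)`, a term `ε‖v₀‖` and the slow
error (`exists_fast_error`). The slow error is driven by the Lipschitz difference of `g` and by the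
neglected force `pr_F g`. The layer is smoothed to order `ε^δ_Y`, the decay on `Y_F` turns the
neglected force into `(ω_B - ζ⁻¹ω_A - N_F)^(-δ_Y)`, and a large exponential weight absorbs the
feedback (`exists_slow_error`).

Slow manifold. The first estimate is applied to `pr_F v₀ = v_F(0)` and to `u(0) - h⁰(v₀)`, so both
must be shown small. In the weighted space `v_F` is of relative size `(N_S - N_F)^(-δ_Y)`
(`norm_vF_le`), and the fast estimate repeated on `(-∞,0]` bounds `u - h⁰(v_S)`
(`exists_distance_bound`). The delicate point is that the weighted norm must be a uniform multiple
of `‖w‖`, although the gap condition leaves no uniform margin below 1. `exists_trajectory_bound`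
obtains this from the convex-combination structure of the estimate for `v_S`. -/

namespace FastSlow

/-! ### Strong continuity of semigroups -/

namespace C0Semigroup

variable {X : Type u} [NormedAddCommGroup X] [NormedSpace ℝ X] [CompleteSpace X]

omit [CompleteSpace X] in
theorem apply_add (S : C0Semigroup X) {s t : ℝ} (hs : 0 ≤ s) (ht : 0 ≤ t) (x : X) :
    S.toFun (s + t) x = S.toFun s (S.toFun t x) := by
  rw [S.map_add s t hs ht]; rfl

/-- Orbits over a compact time interval are bounded, and the uniform boundedness principle turns
this into a bound in operator norm. -/
theorem exists_bound (S : C0Semigroup X) (R : ℝ) :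
    ∃ M, 0 ≤ M ∧ ∀ r ∈ Icc 0 R, ‖S.toFun r‖ ≤ M := by
  obtain ⟨M, hM⟩ := banach_steinhaus (g := fun r : Icc (0 : ℝ) R => S.toFun r) (by
    intro x
    obtain ⟨C, hC⟩ := (isCompact_Icc.image_of_continuousOn
      ((S.continuousOn x).mono (fun r (hr : r ∈ Icc 0 R) => hr.1))).isBounded.exists_norm_le
    exact ⟨C, fun r => hC _ ⟨r, r.2, rfl⟩⟩)
  exact ⟨max M 0, le_max_right _ _, fun r hr => (hM ⟨r, hr⟩).trans (le_max_left _ _)⟩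

/-- Joint strong continuity of a `C₀`-semigroup. -/
theorem tendsto_apply (S : C0Semigroup X) {α : Type*} {l : Filter α} {r : α → ℝ} {y : α → X}
    {r₀ : ℝ} {y₀ : X} (hr : Tendsto r l (𝓝 r₀)) (hr0 : ∀ᶠ a in l, 0 ≤ r a) (hr₀ : 0 ≤ r₀)
    (hy : Tendsto y l (𝓝 y₀)) :
    Tendsto (fun a => S.toFun (r a) (y a)) l (𝓝 (S.toFun r₀ y₀)) := by
  obtain ⟨M, hM0, hM⟩ := S.exists_bound (r₀ + 1)
  have h1 : Tendsto (fun a => S.toFun (r a) y₀) l (𝓝 (S.toFun r₀ y₀)) :=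
    ((S.continuousOn y₀) r₀ hr₀).tendsto.comp
      (tendsto_nhdsWithin_iff.2 ⟨hr, hr0⟩)
  have h2 : Tendsto (fun a => S.toFun (r a) (y a - y₀)) l (𝓝 0) := by
    have h3 : Tendsto (fun a => M * ‖y a - y₀‖) l (𝓝 0) := by
      have := ((hy.sub_const y₀).norm).const_mul M
      simpa using this
    refine squeeze_zero_norm' ?_ h3
    filter_upwards [hr0, hr.eventually (gt_mem_nhds (lt_add_one r₀))] with a ha ha'
    exact (S.toFun (r a)).le_of_opNorm_le (hM _ ⟨ha, ha'.le⟩) _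
  have := h2.add h1
  simpa using this

theorem continuousOn_apply (S : C0Semigroup X) {α : Type*} [TopologicalSpace α] {s : Set α}
    {r : α → ℝ} {y : α → X} (hr : ContinuousOn r s) (hr0 : ∀ a ∈ s, 0 ≤ r a)
    (hy : ContinuousOn y s) : ContinuousOn (fun a => S.toFun (r a) (y a)) s :=
  fun a ha => S.tendsto_apply (hr a ha) (eventually_nhdsWithin_of_forall hr0) (hr0 a ha) (hy a ha)

end C0Semigroup

/-! ### Generators and semigroups on the domain `X_1` -/

namespace BanachScale

variable {X : Type u} [NormedAddCommGroup X] [NormedSpace ℝ X] {A : X →ₗ.[ℝ] X} {lam : ℝ}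
variable (Sc : BanachScale X A lam)

theorem emb_injective {α : ℝ} (hα : 0 ≤ α) : Function.Injective (Sc.emb α) := by
  intro x y h
  exact Sc.incl_injective α 0 (by norm_num) hα (Sc.zeroEquiv.injective h)

theorem emb_incl {α β : ℝ} (hβ : 0 ≤ β) (h : β ≤ α) (x : Sc.space α) :
    Sc.emb β (Sc.incl α β x) = Sc.emb α x := by
  have := Sc.incl_comp α β 0 (by norm_num) hβ h
  simp only [emb, ContinuousLinearMap.comp_apply]
  rw [← this]; rfl

theorem gen_eq (w : Sc.space 1) :
    Sc.gen w = Sc.zeroEquiv (Sc.incl (1 - 1) 0 (Sc.op 1 w)) + lam • Sc.emb 1 w := rfl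

theorem mem_graph (w : Sc.space 1) : (Sc.emb 1 w, Sc.gen w) ∈ A.graph := Sc.op_one w

theorem normLE_emb_iff {α : ℝ} (hα : 0 ≤ α) (w : Sc.space α) (r : ℝ) :
    Sc.NormLE α (Sc.emb α w) r ↔ ‖w‖ ≤ r := by
  constructor
  · rintro ⟨w', h, h'⟩
    rwa [← Sc.emb_injective hα h]
  · intro h; exact ⟨w, rfl, h⟩

/-- The indices `1 - 1` and `0` are only propositionally equal, so `op 1` does not literally land in
`X_0`. The inclusions in the two directions compose to `incl 0 0`, the identity. -/
theorem incl_zero_bijective : Function.Bijective (Sc.incl (1 - 1) 0) := by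
  refine ⟨Sc.incl_injective _ _ (by norm_num) (by norm_num), fun x => ⟨Sc.incl 0 (1 - 1) x, ?_⟩⟩
  have h := Sc.incl_comp 0 (1 - 1) 0 (by norm_num) (by norm_num) (by norm_num)
  rw [Sc.incl_self 0 (by norm_num)] at h
  exact congrArg (fun L => L x) h

/-- `A - lam` as an isomorphism `X_1 → X`. -/
noncomputable def shiftEquiv [CompleteSpace X] : Sc.space 1 ≃L[ℝ] X :=
  ContinuousLinearEquiv.ofBijective (Sc.gen - lam • Sc.emb 1)
    (by
      rw [LinearMap.ker_eq_bot]
      intro x y h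
      simp only [ContinuousLinearMap.coe_coe, sub_apply, gen_eq, smul_apply, add_sub_cancel_right] at h
      exact (Sc.op_bijective 1 zero_le_one).1 (Sc.incl_zero_bijective.1 (Sc.zeroEquiv.injective h)))
    (by
      rw [LinearMap.range_eq_top]
      intro y
      obtain ⟨a, ha⟩ := Sc.incl_zero_bijective.2 (Sc.zeroEquiv.symm y)
      obtain ⟨b, hb⟩ := (Sc.op_bijective 1 zero_le_one).2 a
      refine ⟨b, ?_⟩
      simp [gen_eq, hb, ha])

theorem shiftEquiv_apply [CompleteSpace X] (x : Sc.space 1) :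
    Sc.shiftEquiv x = Sc.gen x - lam • Sc.emb 1 x := rfl

/-- `A - lam` is an isomorphism from `X_1` onto `X`, so the norm of `X_1` is equivalent to the graph
norm. Continuity in `X_1` can thus be checked in `X`, for an element and for its image under the
generator, where strong continuity of the semigroup is enough. -/
theorem tendsto_of_emb_gen [CompleteSpace X] {ι : Type*} {l : Filter ι} {φ : ι → Sc.space 1}
    {x : Sc.space 1} (h0 : Tendsto (fun i => Sc.emb 1 (φ i)) l (𝓝 (Sc.emb 1 x)))
    (h1 : Tendsto (fun i => Sc.gen (φ i)) l (𝓝 (Sc.gen x))) : Tendsto φ l (𝓝 x) := by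
  have h : Tendsto (fun i => Sc.shiftEquiv (φ i)) l (𝓝 (Sc.shiftEquiv x)) :=
    h1.sub (h0.const_smul lam)
  have := (Sc.shiftEquiv.symm.continuous.tendsto _).comp h
  simpa [Function.comp_def] using this

/-- If `emb α ∘ w` moves by at most a multiple of a continuous quantity, then `w` is continuous. -/
theorem continuousOn_of_normLE {ι : Type*} [TopologicalSpace ι] {s : Set ι} {α : ℝ} (hα : 0 ≤ α)
    {w : ι → Sc.space α} {ρ : ι → ι → ℝ}
    (hρ : ∀ i ∈ s, Tendsto (fun j => ρ j i) (𝓝[s] i) (𝓝 0))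
    (h : ∀ i ∈ s, ∀ j ∈ s, Sc.NormLE α (Sc.emb α (w j) - Sc.emb α (w i)) (ρ j i)) :
    ContinuousOn w s := by
  intro i hi
  rw [ContinuousWithinAt, tendsto_iff_norm_sub_tendsto_zero]
  refine squeeze_zero' (Eventually.of_forall fun _ => norm_nonneg _) ?_ (hρ i hi)
  filter_upwards [self_mem_nhdsWithin] with j hj
  have := h i hi j hj
  rwa [← map_sub, Sc.normLE_emb_iff hα] at this

variable {Sc} {S : C0Semigroup X} (hS : S.IsGeneratedBy A)

include hS

theorem tendsto_gen (w : Sc.space 1) :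
    Tendsto (fun h : ℝ => h⁻¹ • (S.toFun h (Sc.emb 1 w) - Sc.emb 1 w)) (𝓝[>] 0)
      (𝓝 (Sc.gen w)) :=
  (hS _ _).1 (Sc.mem_graph w)

theorem gen_unique {w : Sc.space 1} {y : X}
    (h : Tendsto (fun h : ℝ => h⁻¹ • (S.toFun h (Sc.emb 1 w) - Sc.emb 1 w)) (𝓝[>] 0) (𝓝 y)) :
    Sc.gen w = y := tendsto_nhds_unique (tendsto_gen hS w) h

theorem exists_of_tendsto {x y : X}
    (h : Tendsto (fun h : ℝ => h⁻¹ • (S.toFun h x - x)) (𝓝[>] 0) (𝓝 y)) :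
    ∃ w : Sc.space 1, Sc.emb 1 w = x ∧ Sc.gen w = y := by
  have hg := (hS x y).2 h
  obtain ⟨w, hw⟩ := (Sc.mem_domain_iff x).1 (LinearPMap.mem_domain_of_mem_graph hg)
  have hw' : Sc.emb 1 w = x := hw
  exact ⟨w, hw', gen_unique hS (by rw [hw']; exact h)⟩

/-- The semigroup leaves `X_1` invariant and commutes with its generator there. -/
theorem exists_semigroup_emb (w : Sc.space 1) {r : ℝ} (hr : 0 ≤ r) :
    ∃ w' : Sc.space 1, Sc.emb 1 w' = S.toFun r (Sc.emb 1 w) ∧ Sc.gen w' = S.toFun r (Sc.gen w) := by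
  apply exists_of_tendsto hS
  have h1 := ((S.toFun r).continuous.tendsto _).comp (tendsto_gen hS w)
  refine h1.congr' ?_
  filter_upwards [self_mem_nhdsWithin] with h hh
  have hh : (0 : ℝ) < h := hh
  simp only [Function.comp_apply, map_smul, map_sub]
  rw [← S.apply_add hr hh.le, ← S.apply_add hh.le hr, add_comm]

/-- The right difference quotient at time `r` is the one at time `0` for `S(r)w`, which again lies
in `X_1`. -/
theorem hasDerivWithinAt_semigroup (w : Sc.space 1) {r : ℝ} (hr : 0 ≤ r) :
    HasDerivWithinAt (fun r => S.toFun r (Sc.emb 1 w)) (S.toFun r (Sc.gen w)) (Ioi r) r := by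
  rw [hasDerivWithinAt_iff_tendsto_slope' (by simp)]
  obtain ⟨w', h1, h2⟩ := exists_semigroup_emb (Sc := Sc) hS w hr
  have h3 := tendsto_gen hS w'
  rw [h2] at h3
  have h4 : Tendsto (fun s : ℝ => s - r) (𝓝[>] r) (𝓝[>] 0) := by
    refine tendsto_nhdsWithin_iff.2 ⟨?_, ?_⟩
    · have : Tendsto (fun s : ℝ => s - r) (𝓝 r) (𝓝 (r - r)) := (continuous_sub_right r).tendsto r
      rw [sub_self] at this
      exact this.mono_left nhdsWithin_le_nhds
    · filter_upwards [self_mem_nhdsWithin] with s hs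
      exact sub_pos.2 (show r < s from hs)
  refine (h3.comp h4).congr' ?_
  filter_upwards [self_mem_nhdsWithin] with s hs
  have hs : r < s := hs
  simp only [Function.comp_apply, slope, vsub_eq_sub]
  rw [h1, ← S.apply_add (sub_pos.2 hs).le hr,
    sub_add_cancel]

/-- The right derivative is continuous, so the orbit is its integral, and differentiating that
integral yields the two-sided derivative. -/
theorem hasDerivAt_semigroup [CompleteSpace X] (w : Sc.space 1) {r : ℝ} (hr : 0 < r) :
    HasDerivAt (fun r => S.toFun r (Sc.emb 1 w)) (S.toFun r (Sc.gen w)) r := by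
  have hc := S.continuousOn (Sc.gen w)
  have key : ∀ t, 0 ≤ t → S.toFun t (Sc.emb 1 w) =
      S.toFun 0 (Sc.emb 1 w) + ∫ s in (0 : ℝ)..t, S.toFun s (Sc.gen w) := by
    intro t ht
    rw [intervalIntegral.integral_eq_sub_of_hasDeriv_right_of_le ht
      ((S.continuousOn (Sc.emb 1 w)).mono fun s hs => hs.1)
      (fun s hs => hasDerivWithinAt_semigroup hS w hs.1.le)
      ((hc.mono (by rw [uIcc_of_le ht]; exact fun s hs => hs.1)).intervalIntegrable)]
    abel
  have h1 : HasDerivAt (fun t => ∫ s in (0 : ℝ)..t, S.toFun s (Sc.gen w))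
      (S.toFun r (Sc.gen w)) r := by
    apply intervalIntegral.integral_hasDerivAt_right
    · exact (hc.mono (by rw [uIcc_of_le hr.le]; exact fun s hs => hs.1)).intervalIntegrable
    · exact (hc.mono (fun s hs => le_of_lt hs)).stronglyMeasurableAtFilter
        (s := Ioi 0) isOpen_Ioi r hr
    · exact (hc r hr.le).continuousAt (Ici_mem_nhds hr)
  refine (h1.const_add (S.toFun 0 (Sc.emb 1 w))).congr_of_eventuallyEq ?_
  filter_upwards [Ioi_mem_nhds hr] with t ht
  exact key t (le_of_lt ht)

end BanachScale

end FastSlow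

/-! ### Singular kernels, variation of constants and convolutions in `X_1` -/

namespace FastSlow

/-- The kernel `c (c (t - s))^{α - 1} e^{ω c (t - s)}` of a rescaled smoothing estimate. -/
noncomputable def kern (c α ω t s : ℝ) : ℝ :=
  c * ((c * (t - s)) ^ (α - 1) * Real.exp (ω * (c * (t - s))))

theorem intervalIntegrable_kern {c α : ℝ} (hα : 0 < α) (ω t a : ℝ) {E : ℝ → ℝ}
    (hE : ContinuousOn E (uIcc a t)) :
    IntervalIntegrable (fun s => kern c α ω t s * E s) volume a t := by
  have h1 : IntervalIntegrable (fun s => (c * (t - s)) ^ (α - 1)) volume a t := by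
    rcases eq_or_ne c 0 with rfl | hc
    · simp
    have h0 : IntervalIntegrable (fun r : ℝ => r ^ (α - 1)) volume (c * (t - a)) (c * (t - t)) :=
      intervalIntegral.intervalIntegrable_rpow' (by linarith)
    have h2 := h0.comp_mul_left (c := c)
    have h3 := h2.comp_sub_left t
    convert h3 using 1 <;> field_simp <;> ring
  have h2 : ContinuousOn (fun s => c * (Real.exp (ω * (c * (t - s))) * E s)) (uIcc a t) := by
    fun_prop
  refine (h1.mul_continuousOn h2).congr ?_
  intro s _
  simp only [kern]; ring

/-- The substitution `r = c (t - s)` leaves `e^(μt)` times the integral of `r^(α-1) e^(-pr)` over a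
bounded interval, which is at most the full Gamma integral. The bound does not depend on `a`, so it
is still available when `a → -∞`. -/
theorem integral_kern_mul_exp_le {c α ω μ t a : ℝ} (hc : 0 < c) (hα : 0 < α)
    (hp : 0 < -ω + μ / c) (hat : a ≤ t) :
    ∫ s in a..t, kern c α ω t s * Real.exp (μ * s) ≤
      Real.exp (μ * t) * (Real.Gamma α / (-ω + μ / c) ^ α) := by
  set p := -ω + μ / c with hpdef
  let g : ℝ → ℝ := fun r => r ^ (α - 1) * Real.exp (-(p * r))
  have h1 : ∀ s, kern c α ω t s * Real.exp (μ * s) =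
      Real.exp (μ * t) * (c * g (c * t - c * s)) := by
    intro s
    have : Real.exp (ω * (c * (t - s))) * Real.exp (μ * s) =
        Real.exp (μ * t) * Real.exp (-(p * (c * t - c * s))) := by
      rw [← Real.exp_add, ← Real.exp_add]
      congr 1
      rw [hpdef]; field_simp; ring
    simp only [kern, g]
    rw [← mul_sub]
    rw [← mul_sub] at this
    linear_combination (c * (c * (t - s)) ^ (α - 1)) * this
  simp only [h1]
  rw [intervalIntegral.integral_const_mul, intervalIntegral.integral_const_mul,
    intervalIntegral.integral_comp_sub_mul _ hc.ne', sub_self, smul_eq_mul, ← mul_assoc c,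
    mul_inv_cancel₀ hc.ne', one_mul]
  refine mul_le_mul_of_nonneg_left ?_ (Real.exp_pos _).le
  have hca : 0 ≤ c * t - c * a := by nlinarith
  have hG := Real.integral_rpow_mul_exp_neg_mul_Ioi hα hp
  have hint : IntegrableOn g (Ioi 0) := by
    have := integrableOn_rpow_mul_exp_neg_mul_rpow (p := 1) (s := α - 1) (b := p)
      (by linarith) zero_lt_one hp
    simpa [g] using this
  rw [intervalIntegral.integral_of_le hca]
  calc ∫ r in Ioc 0 (c * t - c * a), g r ≤ ∫ r in Ioi 0, g r := by
        refine setIntegral_mono_set hint ?_ (Ioc_subset_Ioi_self.eventuallyLE)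
        filter_upwards [ae_restrict_mem measurableSet_Ioi] with r hr
        have : (0 : ℝ) < r := hr
        positivity
    _ = Real.Gamma α / p ^ α := by
        rw [hG, Real.div_rpow zero_le_one hp.le, Real.one_rpow]; ring

namespace BanachScale

variable {X : Type u} [NormedAddCommGroup X] [NormedSpace ℝ X] {A : X →ₗ.[ℝ] X} {lam : ℝ}
variable {Sc : BanachScale X A lam}

theorem NormLE.mono {α r r' : ℝ} {x : X} (h : Sc.NormLE α x r) (hr : r ≤ r') :
    Sc.NormLE α x r' := by
  obtain ⟨w, h1, h2⟩ := h
  exact ⟨w, h1, h2.trans hr⟩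

theorem NormLE.add {α r r' : ℝ} {x x' : X} (h : Sc.NormLE α x r) (h' : Sc.NormLE α x' r') :
    Sc.NormLE α (x + x') (r + r') := by
  obtain ⟨w, h1, h2⟩ := h
  obtain ⟨w', h1', h2'⟩ := h'
  exact ⟨w + w', by rw [map_add, h1, h1'], (norm_add_le _ _).trans (add_le_add h2 h2')⟩

theorem NormLE.neg {α r : ℝ} {x : X} (h : Sc.NormLE α x r) : Sc.NormLE α (-x) r := by
  obtain ⟨w, h1, h2⟩ := h
  exact ⟨-w, by rw [map_neg, h1], by rwa [norm_neg]⟩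

/-- A function with values in `X_1` that is bounded by an integrable function has its integral in
`X_1`. -/
theorem normLE_intervalIntegral [CompleteSpace X] {a b : ℝ} (hab : a ≤ b) {φ : ℝ → Sc.space 1}
    {F : ℝ → X} {B : ℝ → ℝ} (hφ : ContinuousOn φ (Ioo a b))
    (hF : ∀ s ∈ Ioo a b, Sc.emb 1 (φ s) = F s) (hB : IntervalIntegrable B volume a b)
    (hle : ∀ s ∈ Ioo a b, ‖φ s‖ ≤ B s) :
    Sc.NormLE 1 (∫ s in a..b, F s) (∫ s in a..b, B s) := by
  have hB' : IntegrableOn B (Ioo a b) :=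
    ((intervalIntegrable_iff_integrableOn_Ioc_of_le hab).1 hB).mono_set Ioo_subset_Ioc_self
  have hφi : IntegrableOn φ (Ioo a b) := by
    refine hB'.mono' (hφ.aestronglyMeasurable measurableSet_Ioo) ?_
    filter_upwards [ae_restrict_mem measurableSet_Ioo] with s hs using hle s hs
  refine ⟨∫ s in Ioo a b, φ s, ?_, ?_⟩
  · rw [← ContinuousLinearMap.integral_comp_comm _ hφi, intervalIntegral.integral_of_le hab,
      integral_Ioc_eq_integral_Ioo]
    exact setIntegral_congr_fun measurableSet_Ioo hF
  · rw [intervalIntegral.integral_of_le hab, integral_Ioc_eq_integral_Ioo]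
    refine norm_integral_le_of_norm_le hB' ?_
    filter_upwards [ae_restrict_mem measurableSet_Ioo] with s hs using hle s hs

variable {S : C0Semigroup X} (hS : S.IsGeneratedBy A)

include hS

/-- The variation of constants formula for `x' = c A x + h`. -/
theorem mild_formula [CompleteSpace X] {a b c : ℝ} (hab : a ≤ b) (hc : 0 < c)
    {x : ℝ → Sc.space 1} {h : ℝ → X} (hx : ContinuousOn x (Icc a b))
    (hx' : ∀ s ∈ Ioo a b, HasDerivAt (fun s => Sc.emb 1 (x s)) (c • Sc.gen (x s) + h s) s)
    (hh : ContinuousOn h (Icc a b)) :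
    Sc.emb 1 (x b) = S.toFun (c * (b - a)) (Sc.emb 1 (x a)) +
      ∫ s in a..b, S.toFun (c * (b - s)) (h s) := by
  have hr : ContinuousOn (fun s => c * (b - s)) (Icc a b) := by fun_prop
  have hr0 : ∀ s ∈ Icc a b, 0 ≤ c * (b - s) := fun s hs =>
    mul_nonneg hc.le (sub_nonneg.2 hs.2)
  have hG : ContinuousOn (fun s => S.toFun (c * (b - s)) (Sc.emb 1 (x s))) (Icc a b) :=
    S.continuousOn_apply hr hr0 ((Sc.emb 1).continuous.comp_continuousOn hx)
  have hI : ContinuousOn (fun s => S.toFun (c * (b - s)) (h s)) (Icc a b) :=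
    S.continuousOn_apply hr hr0 hh
  have hd : ∀ s ∈ Ioo a b, HasDerivAt (fun s => S.toFun (c * (b - s)) (Sc.emb 1 (x s)))
      (S.toFun (c * (b - s)) (h s)) s := by
    intro s hs
    have hpos : 0 < c * (b - s) := mul_pos hc (sub_pos.2 hs.2)
    have h1 : HasDerivAt (fun s' => S.toFun (c * (b - s')) (Sc.emb 1 (x s)))
        ((-c) • S.toFun (c * (b - s)) (Sc.gen (x s))) s := by
      have h2 : HasDerivAt (fun s' => c * (b - s')) (-c) s := by
        have := ((hasDerivAt_id s).const_sub b).const_mul c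
        simpa using this
      exact (hasDerivAt_semigroup hS (x s) hpos).scomp s h2
    have h2 := (hasDerivAt_iff_tendsto_slope.1 h1)
    have h3 := (hasDerivAt_iff_tendsto_slope.1 (hx' s hs))
    have hr1 : Tendsto (fun s' => c * (b - s')) (𝓝[≠] s) (𝓝 (c * (b - s))) := by
      have : Continuous (fun s' => c * (b - s')) := by fun_prop
      exact (this.tendsto s).mono_left nhdsWithin_le_nhds
    -- The semigroup is only strongly continuous, so the product rule is carried out on difference
    -- quotients: the quotient of the product is `S(c(b-s'))` applied to the quotient of `x`, plus
    -- the quotient of the orbit of the fixed vector `x(s)`. In the limit the two generator terms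
    -- cancel.
    have h4 := S.tendsto_apply hr1 ((hr1.eventually (lt_mem_nhds hpos)).mono fun _ h => le_of_lt h)
      hpos.le h3
    rw [hasDerivAt_iff_tendsto_slope]
    have h5 := h4.add h2
    refine (h5.congr fun s' => ?_).trans (by simp)
    simp only [slope, vsub_eq_sub, map_smul, map_sub]
    rw [← smul_add]
    congr 1
    abel
  rw [intervalIntegral.integral_eq_sub_of_hasDerivAt_of_le hab hG hd
    (by rw [← uIcc_of_le hab] at hI; exact hI.intervalIntegrable)]
  simp [S.map_zero]

/-- Convolution of the semigroup with a continuous function with values in a space `X_α` on which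
the semigroup is smoothing: a pointwise bound in `X_1` can be integrated. -/
theorem normLE_convolution [CompleteSpace X] {a b c α : ℝ} (hab : a ≤ b) (hc : 0 < c)
    (hsm : ∃ C : ℝ → ℝ, ∀ t, 0 < t → ∀ x : Sc.space α,
      Sc.NormLE 1 (S.toFun t (Sc.emb α x)) (C t * ‖x‖))
    {w : ℝ → Sc.space α} {B : ℝ → ℝ} (hw : ContinuousOn w (Ioo a b))
    (hB : IntervalIntegrable B volume a b)
    (hle : ∀ s ∈ Ioo a b, Sc.NormLE 1 (S.toFun (c * (b - s)) (Sc.emb α (w s))) (B s)) :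
    Sc.NormLE 1 (∫ s in a..b, S.toFun (c * (b - s)) (Sc.emb α (w s))) (∫ s in a..b, B s) := by
  obtain ⟨C, hC⟩ := hsm
  choose! φ hφ hφB using hle
  refine normLE_intervalIntegral hab ?_ hφ hB hφB
  intro s₀ hs₀
  -- Near `s₀` the semigroup is factored through the fixed time `r₀`. `S(r₀)` maps `w` continuously
  -- into `X_1`, and the remaining time stays positive, so strong continuity in the graph norm gives
  -- continuity of `φ`. The smoothing constant `C t` need not be continuous in `t`.
  set r₀ := c * (b - s₀) / 2 with hr₀
  have hr₀pos : 0 < r₀ := by have := sub_pos.2 hs₀.2; positivity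
  choose ψ hψ _ using fun s => hC r₀ hr₀pos (w s)
  have hψc : ContinuousOn ψ (Ioo a b) := by
    refine Sc.continuousOn_of_normLE zero_le_one
      (ρ := fun j i => C r₀ * ‖w j - w i‖) (fun i hi => ?_) (fun i _ j _ => ?_)
    · have := ((hw i hi).sub_const (w i)).norm.const_mul (C r₀)
      simpa using this
    · rw [hψ, hψ, ← map_sub, ← map_sub]
      exact hC r₀ hr₀pos _
  have hr1 : Tendsto (fun s => c * (b - s)) (𝓝[Ioo a b] s₀) (𝓝 (c * (b - s₀))) := by
    have : Continuous (fun s' => c * (b - s')) := by fun_prop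
    exact (this.tendsto s₀).mono_left nhdsWithin_le_nhds
  have hcs : 0 < c * (b - s₀) := by linarith
  have hgt : ∀ᶠ s in 𝓝[Ioo a b] s₀, r₀ < c * (b - s) :=
    hr1.eventually (lt_mem_nhds (by linarith))
  have key : ∀ s ∈ Ioo a b, r₀ < c * (b - s) →
      Sc.gen (φ s) = S.toFun (c * (b - s) - r₀) (Sc.gen (ψ s)) := by
    intro s hs hlt
    obtain ⟨w', h1, h2⟩ := exists_semigroup_emb (Sc := Sc) hS (ψ s) (sub_pos.2 hlt).le
    have : w' = φ s := by
      apply Sc.emb_injective zero_le_one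
      rw [h1, hφ s hs, hψ, ← S.apply_add (sub_pos.2 hlt).le hr₀pos.le, sub_add_cancel]
    rw [← this, h2]
  apply Sc.tendsto_of_emb_gen
  · have h1 := S.tendsto_apply hr1 (hgt.mono fun s h => (hr₀pos.trans h).le) hcs.le
      (((Sc.emb α).continuous.comp_continuousOn hw) s₀ hs₀)
    rw [hφ s₀ hs₀]
    refine h1.congr' ?_
    filter_upwards [self_mem_nhdsWithin] with s hs
    exact (hφ s hs).symm
  · have h1 := S.tendsto_apply (hr1.sub_const r₀)
      (hgt.mono fun s h => (sub_pos.2 h).le) (by linarith)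
      ((Sc.gen.continuous.comp_continuousOn hψc) s₀ hs₀)
    rw [key s₀ hs₀ (by linarith)]
    refine h1.congr' ?_
    filter_upwards [self_mem_nhdsWithin, hgt] with s hs hlt
    exact (key s hs hlt).symm

end BanachScale

end FastSlow

/-! ### Norms of `C¹` curves -/

namespace FastSlow

section C1Norm

variable {E E' : Type u} [NormedAddCommGroup E] [NormedSpace ℝ E]
  [NormedAddCommGroup E'] [NormedSpace ℝ E']

theorem c1Norm_le {t m₁ m₂ : ℝ} (ht : 0 ≤ t) {w : ℝ → E} (h₁ : ∀ s ∈ Icc 0 t, ‖w s‖ ≤ m₁)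
    (h₂ : ∀ s ∈ Icc 0 t, ‖derivWithin w (Icc 0 t) s‖ ≤ m₂) : c1Norm t w ≤ m₁ + m₂ := by
  have : Nonempty (Icc (0 : ℝ) t) := ⟨⟨0, le_rfl, ht⟩⟩
  exact add_le_add (ciSup_le fun s => h₁ s s.2) (ciSup_le fun s => h₂ s s.2)

theorem c1Norm_const {t : ℝ} (ht : 0 ≤ t) (x : E) : c1Norm t (fun _ : ℝ => x) = ‖x‖ := by
  have : Nonempty (Icc (0 : ℝ) t) := ⟨⟨0, le_rfl, ht⟩⟩
  simp [c1Norm]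

omit [NormedSpace ℝ E] in
theorem bddAbove_norm {t : ℝ} {w : ℝ → E} (hw : ContinuousOn w (Icc 0 t)) :
    BddAbove (range fun s : Icc (0 : ℝ) t => ‖w s‖) := by
  obtain ⟨C, hC⟩ := (isCompact_Icc.image_of_continuousOn hw).isBounded.exists_norm_le
  exact ⟨C, by rintro _ ⟨s, rfl⟩; exact hC _ ⟨s, s.2, rfl⟩⟩

theorem continuousOn_derivWithin {t : ℝ} (ht : 0 < t) {w : ℝ → E}
    (hw : ContDiffOn ℝ 1 w (Icc 0 t)) : ContinuousOn (derivWithin w (Icc 0 t)) (Icc 0 t) :=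
  hw.continuousOn_derivWithin (uniqueDiffOn_Icc ht) le_rfl

theorem norm_add_norm_derivWithin_le {t : ℝ} (ht : 0 < t) {w : ℝ → E}
    (hw : ContDiffOn ℝ 1 w (Icc 0 t)) {s s' : ℝ} (hs : s ∈ Icc 0 t) (hs' : s' ∈ Icc 0 t) :
    ‖w s‖ + ‖derivWithin w (Icc 0 t) s'‖ ≤ c1Norm t w :=
  add_le_add (le_ciSup (bddAbove_norm hw.continuousOn) ⟨s, hs⟩)
    (le_ciSup (bddAbove_norm (continuousOn_derivWithin ht hw)) ⟨s', hs'⟩)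

theorem c1Norm_nonneg {t : ℝ} (w : ℝ → E) : 0 ≤ c1Norm t w :=
  add_nonneg (Real.iSup_nonneg fun _ => norm_nonneg _) (Real.iSup_nonneg fun _ => norm_nonneg _)

theorem c1Norm_comp_le {t κ : ℝ} (ht : 0 < t) {w : ℝ → E} (hw : ContDiffOn ℝ 1 w (Icc 0 t))
    (hκ : 0 ≤ κ) (J : E →L[ℝ] E') (hJ : ∀ x, ‖J x‖ ≤ κ * ‖x‖) :
    c1Norm t (fun s => J (w s)) ≤ κ * c1Norm t w := by
  rw [c1Norm, c1Norm, mul_add]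
  have : Nonempty (Icc (0 : ℝ) t) := ⟨⟨0, le_rfl, ht.le⟩⟩
  refine add_le_add (ciSup_le fun s => ?_) (ciSup_le fun s => ?_)
  · exact (hJ _).trans (mul_le_mul_of_nonneg_left
      (le_ciSup (bddAbove_norm hw.continuousOn) s) hκ)
  · have h1 : HasDerivWithinAt (fun s => J (w s)) (J (derivWithin w (Icc 0 t) s)) (Icc 0 t) s :=
      J.hasFDerivAt.comp_hasDerivWithinAt (s : ℝ)
        ((hw.differentiableOn one_ne_zero s s.2).hasDerivWithinAt)
    rw [h1.derivWithin (uniqueDiffOn_Icc ht s s.2)]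
    exact (hJ _).trans (mul_le_mul_of_nonneg_left
      (le_ciSup (bddAbove_norm (continuousOn_derivWithin ht hw)) s) hκ)

theorem contDiffOn_one_of_hasDerivWithinAt {a b : ℝ} (hab : a < b) {w w' : ℝ → E}
    (h : ∀ s ∈ Icc a b, HasDerivWithinAt w (w' s) (Icc a b) s)
    (hc : ContinuousOn w' (Icc a b)) : ContDiffOn ℝ 1 w (Icc a b) := by
  have hu := uniqueDiffOn_Icc hab
  have := (contDiffOn_succ_iff_derivWithin (n := 0) (f := w) hu).2
  rw [zero_add] at this
  refine this ⟨fun s hs => (h s hs).differentiableWithinAt, by simp, ?_⟩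
  rw [contDiffOn_zero]
  exact hc.congr fun s hs => (h s hs).derivWithin (hu s hs)

end C1Norm

/-! ### The critical manifold and its regularity along curves -/

namespace System

variable {X Y : Type u} [NormedAddCommGroup X] [NormedSpace ℝ X]
  [NormedAddCommGroup Y] [NormedSpace ℝ Y] {F : System X Y}

namespace Admissible

variable (hF : F.Admissible)

include hF

theorem one_sub_δX_nonneg : 0 ≤ 1 - F.δX := sub_nonneg.2 hF.δX_mem.2

theorem f₁_zero : F.f₁ 0 0 = 0 := by simp [f₁, hF.f_zero]

/-- `f` lifted to a Lipschitz map into `X_{γ_X}`. -/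
theorem exists_fγ : ∃ φ : F.X₁ → F.Y₁ → F.XS.space F.γX,
    (∀ x y, F.XS.emb F.γX (φ x y) = F.f₁ x y) ∧ φ 0 0 = 0 ∧
    ∀ x y x' y', ‖φ x y - φ x' y'‖ ≤ F.Lf * (‖x - x'‖ + ‖y - y'‖) := by
  have h := fun x y => hF.f_lipschitz x 0 y 0
  simp only [hF.f₁_zero, sub_zero] at h
  choose φ hφ _ using h
  refine ⟨φ, hφ, ?_, fun x y x' y' => ?_⟩
  · apply F.XS.emb_injective hF.γX_mem.1.le
    rw [hφ, hF.f₁_zero, map_zero]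
  · have := hF.f_lipschitz x x' y y'
    rwa [← hφ, ← hφ, ← map_sub, F.XS.normLE_emb_iff hF.γX_mem.1.le] at this

/-- Solutions `x` of `A x + f(x,y) = 0` exist and depend on `y` in a Lipschitz way. -/
theorem exists_critical [CompleteSpace X] : ∃ Lh : ℝ, 0 ≤ Lh ∧
    (∀ (x x' : F.X₁) (y y' : F.Y₁), F.XS.gen x + F.f₁ x y = 0 → F.XS.gen x' + F.f₁ x' y' = 0 →
      ‖x - x'‖ ≤ Lh * ‖y - y'‖) ∧
    ∀ y : F.Y₁, ∃ x : F.X₁, F.XS.gen x + F.f₁ x y = 0 := by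
  obtain ⟨κ, hκ0, hκ1, hκ, -⟩ := hF.Lf_inv_lt_one
  obtain ⟨φ, hφ, -, hφL⟩ := hF.exists_fγ
  have hL := hF.Lf_pos
  -- From `‖x - x'‖ ≤ L_f κ (‖x - x'‖ + ‖y - y'‖)`, with the first term absorbed on the left.
  refine ⟨F.Lf * κ / (1 - F.Lf * κ), div_nonneg (by positivity) (by linarith), ?_, fun y => ?_⟩
  · intro x x' y y' h h'
    have h1 : F.XS.gen (x - x') = F.XS.emb F.γX (φ x' y' - φ x y) := by
      rw [map_sub, map_sub, hφ, hφ, eq_neg_of_add_eq_zero_left h, eq_neg_of_add_eq_zero_left h']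
      abel
    have h2 := hκ _ _ h1
    have h3 := hφL x' y' x y
    rw [norm_sub_rev x' x, norm_sub_rev y' y] at h3
    have h4 := h2.trans (mul_le_mul_of_nonneg_left h3 hκ0)
    rw [div_mul_eq_mul_div, le_div_iff₀ (by linarith)]
    nlinarith
  · let Φ : F.X₁ → F.X₁ := fun x => F.XS.shiftEquiv.symm (-F.f₁ x y)
    have hgen : ∀ x, F.XS.gen (Φ x) = -F.f₁ x y := by
      intro x
      have := F.XS.shiftEquiv.apply_symm_apply (-F.f₁ x y)
      rwa [F.XS.shiftEquiv_apply, zero_smul, sub_zero] at this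
    have hΦ : ContractingWith ⟨F.Lf * κ, by positivity⟩ Φ := by
      refine ⟨by exact_mod_cast hκ1, LipschitzWith.of_dist_le_mul fun x x' => ?_⟩
      rw [dist_eq_norm, dist_eq_norm]
      have h1 : F.XS.gen (Φ x - Φ x') = F.XS.emb F.γX (φ x' y - φ x y) := by
        rw [map_sub, map_sub, hφ, hφ, hgen, hgen]; abel
      have h3 := hφL x' y x y
      rw [norm_sub_rev x' x, sub_self, norm_zero, add_zero] at h3
      calc ‖Φ x - Φ x'‖ ≤ κ * (F.Lf * ‖x - x'‖) :=
            (hκ _ _ h1).trans (mul_le_mul_of_nonneg_left h3 hκ0)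
        _ = F.Lf * κ * ‖x - x'‖ := by ring
    refine ⟨hΦ.fixedPoint, ?_⟩
    have h1 := hgen hΦ.fixedPoint
    rw [hΦ.fixedPoint_isFixedPt] at h1
    rw [h1, neg_add_cancel]

theorem h₀_spec [CompleteSpace X] (y : F.Y₁) : F.XS.gen (F.h₀ y) + F.f₁ (F.h₀ y) y = 0 := by
  obtain ⟨-, -, -, h⟩ := hF.exists_critical
  exact Classical.epsilon_spec (p := fun x : F.X₁ => F.XS.gen x + F.f₁ x y = 0) (h y)

theorem exists_h₀_lipschitz [CompleteSpace X] : ∃ Lh : ℝ, 0 ≤ Lh ∧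
    ∀ y y' : F.Y₁, ‖F.h₀ y - F.h₀ y'‖ ≤ Lh * ‖y - y'‖ := by
  obtain ⟨Lh, h0, h1, -⟩ := hF.exists_critical
  exact ⟨Lh, h0, fun y y' => h1 _ _ _ _ (hF.h₀_spec y) (hF.h₀_spec y')⟩

theorem eq_h₀ [CompleteSpace X] {x : F.X₁} {y : F.Y₁} (h : F.XS.gen x + F.f₁ x y = 0) :
    x = F.h₀ y := by
  obtain ⟨Lh, h0, h1, -⟩ := hF.exists_critical
  have := h1 _ _ _ _ h (hF.h₀_spec y)
  rw [sub_self, norm_zero, mul_zero] at this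
  exact sub_eq_zero.1 (norm_le_zero_iff.1 this)

theorem h₀_zero [CompleteSpace X] : F.h₀ 0 = 0 :=
  (hF.eq_h₀ (by rw [hF.f₁_zero, map_zero, add_zero])).symm

/-- The equation of the critical manifold is moved down the scale to `X_{δ_X-1}`, because that is
where `f` is known to be `C¹` along curves. Compatibility of `op` with the inclusions makes the two
forms agree. -/
theorem op_incl_h₀ [CompleteSpace X] (y : F.Y₁) :
    F.XS.op F.δX (F.XS.incl 1 F.δX (F.h₀ y)) =
      -F.XS.extra (F.δX - 1) (F.f (F.XS.incl 1 F.δX (F.h₀ y)) (F.YS.incl 1 (1 - F.δX) y)) := by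
  have h1 := eq_neg_of_add_eq_zero_left (hF.h₀_spec y)
  rw [F.XS.op_incl 1 F.δX hF.δX_pos.le hF.δX_mem.2]
  have h2 := F.XS.gen_eq (F.h₀ y)
  rw [zero_smul, add_zero, h1] at h2
  have h3 := congrArg (F.XS.extra (F.δX - 1)) h2
  rw [map_neg] at h3
  rw [f₁] at h3
  rw [h3, BanachScale.extra, ContinuousLinearMap.comp_apply]
  simp only [ContinuousLinearEquiv.coe_coe, ContinuousLinearEquiv.symm_apply_apply]
  rw [← F.XS.incl_comp (1 - 1) 0 (F.δX - 1) (by linarith [hF.δX_pos])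
    (by linarith [hF.δX_mem.2]) (by norm_num)]
  rfl

/-- A constant curve has the `C¹` norm of its value, so the Lipschitz condition on curves contains
the pointwise one. -/
theorem extra_f_lipschitz (x₁ x₂ : F.XS.space F.δX) (y : F.YS.space (1 - F.δX)) :
    ‖F.XS.extra (F.δX - 1) (F.f x₁ y - F.f x₂ y)‖ ≤ F.Lf * ‖x₁ - x₂‖ := by
  have h := hF.f_c1_lipschitz 1 one_pos (fun _ => x₁) (fun _ => x₂) (fun _ => y) (fun _ => y)
    contDiffOn_const contDiffOn_const continuousOn_const continuousOn_const
    contDiffOn_const contDiffOn_const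
  simpa only [c1Norm_const zero_le_one, sub_self, map_zero, norm_zero, add_zero] using h

/-- Regularity of `t ↦ h⁰(z(t))` on an interval starting at `0`. -/
theorem exists_deriv_h₀_aux [CompleteSpace X] : ∃ C : ℝ, 0 ≤ C ∧ ∀ T : ℝ, 0 < T →
    ∀ z : ℝ → F.Y₁, ContinuousOn z (Icc 0 T) →
    ContDiffOn ℝ 1 (fun s => F.YS.emb 1 (z s)) (Icc 0 T) →
    ∃ d : ℝ → F.XS.space F.δX, ContinuousOn d (Icc 0 T) ∧
      (∀ s ∈ Ioo 0 T, HasDerivAt (fun s => F.XS.incl 1 F.δX (F.h₀ (z s))) (d s) s) ∧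
      ∀ s ∈ Icc 0 T, ‖d s‖ ≤ C * c1Norm T (fun s => F.YS.emb 1 (z s)) := by
  obtain ⟨κ, hκ0, hκ1, -, hκ⟩ := hF.Lf_inv_lt_one
  have hL := hF.Lf_pos
  set q := F.Lf * κ with hq
  have hq0 : 0 ≤ q := by positivity
  refine ⟨q / (1 - q), div_nonneg hq0 (by linarith), fun T hT z hz hz1 => ?_⟩
  let J : F.XS.space (F.δX - 1) →L[ℝ] F.XS.space F.δX :=
    (ContinuousLinearEquiv.ofBijective (F.XS.op F.δX)
      (LinearMap.ker_eq_bot.2 (F.XS.op_bijective _ hF.δX_pos.le).1)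
      (LinearMap.range_eq_top.2 (F.XS.op_bijective _ hF.δX_pos.le).2)).symm
  have hJop : ∀ x, J (F.XS.op F.δX x) = x := fun x =>
    ContinuousLinearEquiv.symm_apply_apply _ x
  have hJ : ∀ y, ‖J y‖ ≤ κ * ‖y‖ := by
    intro y
    obtain ⟨x, rfl⟩ := (F.XS.op_bijective _ hF.δX_pos.le).2 y
    rw [hJop]
    exact hκ x
  set ze : ℝ → F.YS.space (1 - F.δX) := fun s => F.YS.incl 1 (1 - F.δX) (z s) with hze
  have hzec : ContinuousOn ze (Icc 0 T) :=
    (F.YS.incl 1 (1 - F.δX)).continuous.comp_continuousOn hz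
  have hemb : ∀ s, F.YS.emb (1 - F.δX) (ze s) = F.YS.emb 1 (z s) := fun s =>
    F.YS.emb_incl hF.one_sub_δX_nonneg (by linarith [hF.δX_pos]) _
  have hze1 : ContDiffOn ℝ 1 (fun s => F.YS.emb (1 - F.δX) (ze s)) (Icc 0 T) := by
    simpa only [hemb] using hz1
  -- Picard iterates of `v ↦ -A⁻¹ f(v,z)` started at `0`. Each is `C¹`, and the map contracts the
  -- `C¹` norm with factor `q`.
  let w : ℕ → ℝ → F.XS.space F.δX := fun n => Nat.rec (fun _ => 0)
    (fun _ v s => -J (F.XS.extra (F.δX - 1) (F.f (v s) (ze s)))) n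
  have hwS : ∀ n s, w (n + 1) s = -J (F.XS.extra (F.δX - 1) (F.f (w n s) (ze s))) :=
    fun _ _ => rfl
  have hwC : ∀ n, ContDiffOn ℝ 1 (w n) (Icc 0 T) := by
    intro n
    induction n with
    | zero => exact contDiffOn_const
    | succ n ih =>
      exact ((hF.f_contDiff T hT (w n) ze ih hzec hze1).continuousLinearMap_comp J).neg
  have hstep : ∀ (v₁ v₂ : ℝ → F.XS.space F.δX) (z₁ z₂ : ℝ → F.YS.space (1 - F.δX)),
      ContDiffOn ℝ 1 v₁ (Icc 0 T) → ContDiffOn ℝ 1 v₂ (Icc 0 T) →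
      ContinuousOn z₁ (Icc 0 T) → ContinuousOn z₂ (Icc 0 T) →
      ContDiffOn ℝ 1 (fun s => F.YS.emb (1 - F.δX) (z₁ s)) (Icc 0 T) →
      ContDiffOn ℝ 1 (fun s => F.YS.emb (1 - F.δX) (z₂ s)) (Icc 0 T) →
      c1Norm T (fun s => (-J) (F.XS.extra (F.δX - 1) (F.f (v₁ s) (z₁ s) - F.f (v₂ s) (z₂ s)))) ≤
        q * (c1Norm T (fun s => v₁ s - v₂ s) +
          c1Norm T (fun s => F.YS.emb (1 - F.δX) (z₁ s - z₂ s))) := by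
    intro v₁ v₂ z₁ z₂ h1 h2 h3 h4 h5 h6
    have hcd : ContDiffOn ℝ 1
        (fun s => F.XS.extra (F.δX - 1) (F.f (v₁ s) (z₁ s) - F.f (v₂ s) (z₂ s))) (Icc 0 T) := by
      simp only [map_sub]
      exact (hF.f_contDiff T hT v₁ z₁ h1 h3 h5).sub (hF.f_contDiff T hT v₂ z₂ h2 h4 h6)
    have hb := c1Norm_comp_le hT hcd hκ0 (-J) (fun x => by simpa using hJ x)
    refine hb.trans ?_
    have := hF.f_c1_lipschitz T hT v₁ v₂ z₁ z₂ h1 h2 h3 h4 h5 h6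
    calc _ ≤ κ * (F.Lf * (c1Norm T (fun s => v₁ s - v₂ s) +
          c1Norm T (fun s => F.YS.emb (1 - F.δX) (z₁ s - z₂ s)))) :=
          mul_le_mul_of_nonneg_left this hκ0
      _ = _ := by rw [hq]; ring
  set C₀ := c1Norm T (fun s => w 1 s - w 0 s) with hC₀
  have hgeo : ∀ n, c1Norm T (fun s => w (n + 1) s - w n s) ≤ C₀ * q ^ n := by
    intro n
    induction n with
    | zero => simp [hC₀]
    | succ n ih =>
      have h := hstep (w (n + 1)) (w n) ze ze (hwC (n + 1)) (hwC n) hzec hzec hze1 hze1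
      have hz0 : c1Norm T (fun s => F.YS.emb (1 - F.δX) (ze s - ze s)) = 0 := by
        simp only [sub_self, map_zero, c1Norm_const hT.le, norm_zero]
      have heq : (fun s => w (n + 1 + 1) s - w (n + 1) s) = fun s =>
          (-J) (F.XS.extra (F.δX - 1) (F.f (w (n + 1) s) (ze s) - F.f (w n s) (ze s))) := by
        funext s
        rw [hwS (n + 1), hwS n]
        simp only [neg_apply, map_sub]
      rw [heq]
      refine h.trans ?_
      rw [hz0, add_zero, pow_succ]
      calc _ ≤ q * (C₀ * q ^ n) := mul_le_mul_of_nonneg_left ih hq0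
        _ = _ := by ring
  set N := c1Norm T (fun s => F.YS.emb 1 (z s)) with hN
  have hN0 : 0 ≤ N := c1Norm_nonneg _
  -- `q / (1 - q) * N` is the fixed point of `r ↦ q (r + N)`, the recursion obtained by comparing
  -- with the trivial curve, where `f(0,0) = 0`.
  have hbd : ∀ n, c1Norm T (w n) ≤ q / (1 - q) * N := by
    intro n
    induction n with
    | zero =>
      have : c1Norm T (w 0) = 0 := by
        have h : w 0 = fun _ => 0 := rfl
        rw [h, c1Norm_const hT.le, norm_zero]
      rw [this]
      exact mul_nonneg (div_nonneg hq0 (by linarith)) hN0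
    | succ n ih =>
      have h := hstep (w n) (fun _ => 0) ze (fun _ => 0) (hwC _) contDiffOn_const hzec
        continuousOn_const hze1 contDiffOn_const
      simp only [hF.f_zero, sub_zero, hemb] at h
      have h' : c1Norm T (w (n + 1)) ≤ q * (c1Norm T (w n) + N) := h
      refine h'.trans ?_
      have h1 : q * (c1Norm T (w n) + N) ≤ q * (q / (1 - q) * N + N) := by gcongr
      refine h1.trans (le_of_eq ?_)
      have : 1 - q ≠ 0 := by linarith
      field_simp; ring
  set D : ℕ → ℝ → F.XS.space F.δX := fun n => derivWithin (w n) (Icc 0 T) with hD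
  have hDstep : ∀ s ∈ Icc 0 T, ∀ n, dist (D n s) (D (n + 1) s) ≤ C₀ * q ^ n := by
    intro s hs n
    have h1 := norm_add_norm_derivWithin_le hT ((hwC (n + 1)).sub (hwC n)) hs hs
    have h2 : derivWithin (fun x => w (n + 1) x - w n x) (Icc 0 T) s = D (n + 1) s - D n s :=
      derivWithin_fun_sub ((hwC (n + 1)).differentiableOn one_ne_zero s hs)
        ((hwC n).differentiableOn one_ne_zero s hs)
    rw [h2] at h1
    rw [dist_comm, dist_eq_norm]
    linarith [norm_nonneg (w (n + 1) s - w n s), hgeo n]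
  have hlim : ∀ s, ∃ d, s ∈ Icc 0 T → Tendsto (fun n => D n s) atTop (𝓝 d) := by
    intro s
    by_cases hs : s ∈ Icc 0 T
    · obtain ⟨d, hd⟩ := cauchySeq_tendsto_of_complete
        (cauchySeq_of_le_geometric q C₀ hκ1 (hDstep s hs))
      exact ⟨d, fun _ => hd⟩
    · exact ⟨0, fun h => absurd h hs⟩
  choose d hd using hlim
  -- Uniform convergence of the derivatives, together with pointwise convergence of the iterates to
  -- `h⁰(z(s))`, makes the limit differentiable with derivative `d`.
  have hunif : TendstoUniformlyOn D d atTop (Icc 0 T) := by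
    rw [Metric.tendstoUniformlyOn_iff]
    intro e he
    have h1 : Tendsto (fun n => C₀ * q ^ n / (1 - q)) atTop (𝓝 0) := by
      have := ((tendsto_pow_atTop_nhds_zero_of_lt_one hq0 hκ1).const_mul C₀).div_const (1 - q)
      simpa using this
    filter_upwards [h1.eventually (gt_mem_nhds he)] with n hn s hs
    rw [dist_comm]
    exact (dist_le_of_le_geometric_of_tendsto q C₀ hκ1 (hDstep s hs) (hd s hs) n).trans_lt hn
  have hval : ∀ s, Tendsto (fun n => w n s) atTop (𝓝 (F.XS.incl 1 F.δX (F.h₀ (z s)))) := by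
    intro s
    set xs := F.XS.incl 1 F.δX (F.h₀ (z s)) with hxs
    have hfix : xs = -J (F.XS.extra (F.δX - 1) (F.f xs (ze s))) := by
      have := congrArg J (hF.op_incl_h₀ (z s))
      rwa [hJop, map_neg] at this
    have hle : ∀ n, ‖w n s - xs‖ ≤ ‖w 0 s - xs‖ * q ^ n := by
      intro n
      induction n with
      | zero => simp
      | succ n ih =>
        have h1 : w (n + 1) s - xs =
            -J (F.XS.extra (F.δX - 1) (F.f (w n s) (ze s) - F.f xs (ze s))) := by
          rw [hwS]
          nth_rewrite 1 [hfix]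
          simp only [map_sub]; abel
        rw [h1, norm_neg]
        calc _ ≤ κ * (F.Lf * ‖w n s - xs‖) := (hJ _).trans
              (mul_le_mul_of_nonneg_left (hF.extra_f_lipschitz _ _ _) hκ0)
          _ = q * ‖w n s - xs‖ := by rw [hq]; ring
          _ ≤ q * (‖w 0 s - xs‖ * q ^ n) := mul_le_mul_of_nonneg_left ih hq0
          _ = _ := by rw [pow_succ]; ring
    rw [tendsto_iff_norm_sub_tendsto_zero]
    refine squeeze_zero (fun _ => norm_nonneg _) hle ?_
    have := (tendsto_pow_atTop_nhds_zero_of_lt_one hq0 hκ1).const_mul ‖w 0 s - xs‖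
    simpa using this
  refine ⟨d, hunif.continuousOn (Frequently.of_forall fun n =>
    continuousOn_derivWithin hT (hwC n)), fun s hs => ?_, fun s hs => ?_⟩
  · refine hasDerivAt_of_tendstoUniformlyOn isOpen_Ioo (hunif.mono Ioo_subset_Icc_self)
      (Eventually.of_forall fun n x hx => ?_) (fun x _ => hval x) hs
    exact ((hwC n).differentiableOn one_ne_zero x (Ioo_subset_Icc_self hx)).hasDerivWithinAt.hasDerivAt
      (Icc_mem_nhds hx.1 hx.2)
  · refine le_of_tendsto (hd s hs).norm (Eventually.of_forall fun n => ?_)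
    have := norm_add_norm_derivWithin_le hT (hwC n) hs hs
    linarith [norm_nonneg (w n s), hbd n]

/-- If `z` is continuous in `Y_1` and continuously differentiable in `Y`, then `h⁰ ∘ z` is
continuously differentiable in `X_{δ_X}`. -/
theorem exists_deriv_h₀ [CompleteSpace X] : ∃ C : ℝ, 0 ≤ C ∧ ∀ a b : ℝ, a < b →
    ∀ (z : ℝ → F.Y₁) (z' : ℝ → Y), ContinuousOn z (Icc a b) →
    (∀ s ∈ Icc a b, HasDerivWithinAt (fun s => F.YS.emb 1 (z s)) (z' s) (Icc a b) s) →
    ContinuousOn z' (Icc a b) →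
    ∃ d : ℝ → F.XS.space F.δX, ContinuousOn d (Icc a b) ∧
      (∀ s ∈ Ioo a b, HasDerivAt (fun s => F.XS.incl 1 F.δX (F.h₀ (z s))) (d s) s) ∧
      ∀ m₁ m₂ : ℝ, (∀ s ∈ Icc a b, ‖F.YS.emb 1 (z s)‖ ≤ m₁) → (∀ s ∈ Icc a b, ‖z' s‖ ≤ m₂) →
        ∀ s ∈ Icc a b, ‖d s‖ ≤ C * (m₁ + m₂) := by
  obtain ⟨C, hC0, hC⟩ := hF.exists_deriv_h₀_aux
  refine ⟨C, hC0, fun a b hab z z' hz hz' hzc => ?_⟩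
  have hT : 0 < b - a := sub_pos.2 hab
  -- The `C¹` assumptions on `f` concern intervals starting at `0`; a translation carries them to
  -- `[a,b]`.
  have hmaps : MapsTo (fun s => s + a) (Icc 0 (b - a)) (Icc a b) := fun s hs =>
    ⟨by linarith [hs.1], by linarith [hs.2]⟩
  have hadd : ContinuousOn (fun s : ℝ => s + a) (Icc 0 (b - a)) := by fun_prop
  have hsub : ContinuousOn (fun s : ℝ => s - a) (Icc a b) := by fun_prop
  have hmaps' : MapsTo (fun s => s - a) (Icc a b) (Icc 0 (b - a)) := fun s hs =>
    ⟨by linarith [hs.1], by linarith [hs.2]⟩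
  have hder : ∀ s ∈ Icc 0 (b - a), HasDerivWithinAt (fun s => F.YS.emb 1 (z (s + a)))
      (z' (s + a)) (Icc 0 (b - a)) s := by
    intro s hs
    have h1 := hz' (s + a) (hmaps hs)
    have h2 : HasDerivWithinAt (fun s : ℝ => s + a) 1 (Icc 0 (b - a)) s :=
      ((hasDerivAt_id s).add_const a).hasDerivWithinAt
    have := h1.scomp s h2 hmaps
    simpa [Function.comp_def] using this
  have hcd := contDiffOn_one_of_hasDerivWithinAt hT hder (hzc.comp hadd hmaps)
  obtain ⟨d, hd, hd1, hd2⟩ := hC (b - a) hT (fun s => z (s + a)) (hz.comp hadd hmaps) hcd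
  refine ⟨fun s => d (s - a), hd.comp hsub hmaps', fun s hs => ?_, fun m₁ m₂ h1 h2 s hs => ?_⟩
  · have h1 := hd1 (s - a) ⟨by linarith [hs.1], by linarith [hs.2]⟩
    have h2 : HasDerivAt (fun s : ℝ => s - a) 1 s := (hasDerivAt_id s).sub_const a
    have := h1.scomp s h2
    simpa [Function.comp_def] using this
  · refine (hd2 _ (hmaps' hs)).trans (mul_le_mul_of_nonneg_left ?_ hC0)
    refine c1Norm_le hT.le (fun r hr => h1 _ (hmaps hr)) fun r hr => ?_
    rw [(hder r hr).derivWithin (uniqueDiffOn_Icc hT r hr)]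
    exact h2 _ (hmaps hr)

end Admissible

end System

end FastSlow

/-! ### Comparison principle, exponential weights and Gamma inequalities -/

namespace FastSlow

/-- A comparison principle for a bound that reproduces itself up to a factor `q < 1`. -/
theorem le_of_self_improving {T : ℝ} (hT : 0 ≤ T) {φ D : ℝ → ℝ} (hφ : ContinuousOn φ (Icc 0 T))
    (hD : ContinuousOn D (Icc 0 T)) (hD0 : ∀ s ∈ Icc 0 T, 0 < D s) {c q : ℝ} (hc : 0 ≤ c)
    (hq : q < 1)
    (h : ∀ N, 0 ≤ N → (∀ s ∈ Icc 0 T, φ s ≤ N * D s) → ∀ t ∈ Icc 0 T, φ t ≤ (c + q * N) * D t) :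
    ∀ t ∈ Icc 0 T, φ t ≤ c / (1 - q) * D t := by
  -- The best constant `N` is attained by compactness. Evaluating the improved bound at the maximum
  -- point gives `N ≤ c + q N`.
  obtain ⟨t₀, ht₀, hmax⟩ := isCompact_Icc.exists_isMaxOn ⟨0, left_mem_Icc.2 hT⟩
    (hφ.div hD fun s hs => (hD0 s hs).ne')
  set N := φ t₀ / D t₀ with hN
  have hle : ∀ s ∈ Icc 0 T, φ s ≤ N * D s := fun s hs => by
    have := hmax hs
    exact (div_le_iff₀ (hD0 s hs)).1 this
  have hNc : N ≤ c / (1 - q) := by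
    rcases le_or_gt N 0 with h0 | h0
    · exact h0.trans (div_nonneg hc (by linarith))
    · have h1 := h N h0.le hle t₀ ht₀
      have h2 : N ≤ c + q * N := (div_le_iff₀ (hD0 t₀ ht₀)).2 h1
      rw [le_div_iff₀ (by linarith)]
      linarith
  exact fun t ht => (hle t ht).trans (mul_le_mul_of_nonneg_right hNc (hD0 t ht).le)

/-- With respect to the weight `e^(lam t)` the kernel of rate `ω` has mass at most `Γ(δ)/(lam -
ω)^δ`, which vanishes as `lam → ∞`. This closes the slow equation, where no Lipschitz constant is
small. -/
theorem exists_weight {δ : ℝ} (hδ : 0 < δ) (ω M : ℝ) :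
    ∃ lam, 0 < lam ∧ ω < lam ∧ M * (Real.Gamma δ / (lam - ω) ^ δ) ≤ 1 / 2 := by
  have h1 : Tendsto (fun l : ℝ => M * (Real.Gamma δ / (l - ω) ^ δ)) atTop (𝓝 (M * 0)) :=
    (tendsto_const_nhds.div_atTop ((tendsto_rpow_atTop hδ).comp
      (tendsto_atTop_add_const_right _ (-ω) tendsto_id))).const_mul M
  rw [mul_zero] at h1
  obtain ⟨l, ⟨h2, h3⟩, h4⟩ := (((eventually_gt_atTop 0).and (eventually_gt_atTop ω)).and
    (h1.eventually (gt_mem_nhds (show (0 : ℝ) < 1 / 2 by norm_num)))).exists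
  exact ⟨l, h2, h3, h4.le⟩

theorem integral_kern_mul_add {c α ω a t : ℝ} (hα : 0 < α) (hat : a ≤ t)
    {E E' : ℝ → ℝ} (hE : ContinuousOn E (Icc a t)) (hE' : ContinuousOn E' (Icc a t)) :
    ∫ s in a..t, kern c α ω t s * (E s + E' s) =
      (∫ s in a..t, kern c α ω t s * E s) + ∫ s in a..t, kern c α ω t s * E' s := by
  rw [← uIcc_of_le hat] at hE hE'
  simp only [mul_add]
  exact intervalIntegral.integral_add (intervalIntegrable_kern hα ω t a hE)
    (intervalIntegrable_kern hα ω t a hE')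

theorem integral_kern_mul_const_mul {c α ω a t : ℝ} (k : ℝ) (E : ℝ → ℝ) :
    ∫ s in a..t, kern c α ω t s * (k * E s) = k * ∫ s in a..t, kern c α ω t s * E s := by
  rw [← intervalIntegral.integral_const_mul]
  congr 1; funext s; ring

/-- A variant of `integral_kern_mul_exp_le` with a prescribed lower bound for the rate. -/
theorem integral_kern_mul_exp_le' {c α ω μ t a p : ℝ} (hc : 0 < c) (hα : 0 < α) (hp : 0 < p)
    (hpμ : p ≤ -ω + μ / c) (hat : a ≤ t) :
    ∫ s in a..t, kern c α ω t s * Real.exp (μ * s) ≤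
      Real.Gamma α / p ^ α * Real.exp (μ * t) := by
  refine (integral_kern_mul_exp_le hc hα (hp.trans_le hpμ) hat).trans ?_
  rw [mul_comm]
  have := Real.Gamma_pos_of_pos hα
  gcongr

/-- An initial layer `e^{ω s/ε}` is smoothed by the kernel to the order `ε^δ`. -/
theorem integral_kern_layer_le {δ ω ωf lam ε t T : ℝ} (hδ : δ ∈ Ioc (0 : ℝ) 1) (hω : ω ≤ lam)
    (hlam : 0 ≤ lam) (hωf : ωf < 0) (hε : 0 < ε) (ht : 0 ≤ t) (htT : t ≤ T) :
    ∫ s in (0 : ℝ)..t, kern 1 δ ω t s * Real.exp (ε⁻¹ * ωf * s) ≤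
      Real.exp (lam * T) * (Real.exp 1 * Real.Gamma δ + 1 / (-ωf)) * ε ^ δ := by
  have hcont : ∀ μ : ℝ, ContinuousOn (fun s => Real.exp (μ * s)) (uIcc 0 t) := by
    intro μ; fun_prop
  -- The split is at `t - s = ε`. Below it, `e^(1-(t-s)/ε) ≥ 1` localizes the singularity at scale
  -- `ε`. Above it, the kernel is at most `ε^(δ-1)` and the layer integrates to order `ε`. Both
  -- parts are of order `ε^δ`.
  have hpt : ∀ s ∈ Ioo 0 t, kern 1 δ ω t s * Real.exp (ε⁻¹ * ωf * s) ≤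
      Real.exp (lam * T) * (Real.exp 1 * (kern 1 δ (-ε⁻¹) t s * Real.exp (0 * s)) +
        ε ^ (δ - 1) * Real.exp (ε⁻¹ * ωf * s)) := by
    intro s hs
    have hr : 0 < t - s := sub_pos.2 hs.2
    simp only [kern, one_mul, zero_mul, Real.exp_zero, mul_one]
    have h1 : Real.exp (ω * (t - s)) ≤ Real.exp (lam * T) := by
      apply Real.exp_le_exp.2
      have : t - s ≤ T := by linarith [hs.1]
      nlinarith
    have h2 : Real.exp (ε⁻¹ * ωf * s) ≤ 1 := by
      apply Real.exp_le_one_iff.2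
      have := inv_pos.2 hε
      have := mul_nonneg this.le hs.1.le
      nlinarith
    have h3 : (t - s) ^ (δ - 1) * Real.exp (ε⁻¹ * ωf * s) ≤
        Real.exp 1 * ((t - s) ^ (δ - 1) * Real.exp (-ε⁻¹ * (t - s))) +
          ε ^ (δ - 1) * Real.exp (ε⁻¹ * ωf * s) := by
      rcases le_total (t - s) ε with hle | hle
      · have h4 : 1 ≤ Real.exp 1 * Real.exp (-ε⁻¹ * (t - s)) := by
          rw [← Real.exp_add]
          apply Real.one_le_exp
          have : ε⁻¹ * (t - s) ≤ 1 := by rw [inv_mul_le_iff₀ hε]; linarith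
          linarith
        have h5 : 0 < (t - s) ^ (δ - 1) := Real.rpow_pos_of_pos hr _
        have h6 : 0 ≤ ε ^ (δ - 1) * Real.exp (ε⁻¹ * ωf * s) := by positivity
        nlinarith [mul_le_mul_of_nonneg_left h4 h5.le, mul_le_mul_of_nonneg_left h2 h5.le]
      · have h4 : (t - s) ^ (δ - 1) ≤ ε ^ (δ - 1) :=
          Real.rpow_le_rpow_of_nonpos hε hle (by linarith [hδ.2])
        have h5 : 0 ≤ Real.exp 1 * ((t - s) ^ (δ - 1) * Real.exp (-ε⁻¹ * (t - s))) := by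
          positivity
        nlinarith [mul_le_mul_of_nonneg_right h4 (Real.exp_pos (ε⁻¹ * ωf * s)).le]
    calc (t - s) ^ (δ - 1) * Real.exp (ω * (t - s)) * Real.exp (ε⁻¹ * ωf * s)
        = Real.exp (ω * (t - s)) * ((t - s) ^ (δ - 1) * Real.exp (ε⁻¹ * ωf * s)) := by ring
      _ ≤ Real.exp (lam * T) * ((t - s) ^ (δ - 1) * Real.exp (ε⁻¹ * ωf * s)) := by gcongr
      _ ≤ _ := by gcongr
  have hi1 := intervalIntegrable_kern (c := 1) hδ.1 (-ε⁻¹) t 0 (hcont 0)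
  have hi2 : IntervalIntegrable (fun s => ε ^ (δ - 1) * Real.exp (ε⁻¹ * ωf * s)) volume 0 t :=
    ((hcont (ε⁻¹ * ωf)).intervalIntegrable).const_mul _
  have hexp : ∫ s in (0 : ℝ)..t, Real.exp (ε⁻¹ * ωf * s) ≤ ε / (-ωf) := by
    have hne : ε⁻¹ * ωf ≠ 0 := mul_ne_zero (inv_ne_zero hε.ne') hωf.ne
    rw [intervalIntegral.integral_comp_mul_left _ hne, integral_exp, smul_eq_mul, mul_zero,
      Real.exp_zero]
    have h1 : (ε⁻¹ * ωf)⁻¹ * (Real.exp (ε⁻¹ * ωf * t) - 1) =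
        ε / (-ωf) * (1 - Real.exp (ε⁻¹ * ωf * t)) := by
      have := hωf.ne
      field_simp; ring
    rw [h1]
    have h2 : 0 ≤ ε / (-ωf) := div_nonneg hε.le (by linarith)
    have h3 := Real.exp_pos (ε⁻¹ * ωf * t)
    nlinarith
  have hk := integral_kern_mul_exp_le (c := 1) (α := δ) (ω := -ε⁻¹) (μ := 0) one_pos hδ.1
    (by simpa using hε) ht
  have hεδ : ε ^ (δ - 1) * ε = ε ^ δ := by
    rw [Real.rpow_sub_one hε.ne']; field_simp
  have hinv : (ε⁻¹) ^ δ = (ε ^ δ)⁻¹ := Real.inv_rpow hε.le δ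
  simp only [zero_mul, Real.exp_zero, neg_neg, zero_div, add_zero, one_mul, hinv,
    div_inv_eq_mul] at hk
  calc _ ≤ ∫ s in (0 : ℝ)..t, Real.exp (lam * T) *
        (Real.exp 1 * (kern 1 δ (-ε⁻¹) t s * Real.exp (0 * s)) +
          ε ^ (δ - 1) * Real.exp (ε⁻¹ * ωf * s)) :=
        intervalIntegral.integral_mono_on_of_le_Ioo ht
          (intervalIntegrable_kern hδ.1 ω t 0 (hcont _))
          (((hi1.const_mul _).add hi2).const_mul _) hpt
    _ = Real.exp (lam * T) * (Real.exp 1 * (∫ s in (0 : ℝ)..t, kern 1 δ (-ε⁻¹) t s * 1) +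
          ε ^ (δ - 1) * ∫ s in (0 : ℝ)..t, Real.exp (ε⁻¹ * ωf * s)) := by
        rw [intervalIntegral.integral_const_mul, intervalIntegral.integral_add
          (hi1.const_mul _) hi2, intervalIntegral.integral_const_mul,
          intervalIntegral.integral_const_mul]
        simp only [zero_mul, Real.exp_zero]
    _ ≤ Real.exp (lam * T) * (Real.exp 1 * (Real.Gamma δ * ε ^ δ) +
          ε ^ (δ - 1) * (ε / (-ωf))) := by gcongr
    _ = _ := by rw [mul_div_assoc', hεδ]; ring

/-- By convexity and `Γ(1) = Γ(2) = 1`, a value below 1 at some `x < 1` would force `Γ(1) < 1`. This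
allows the Gamma factor in the last term of the gap condition to be dropped. -/
theorem one_le_Gamma {x : ℝ} (hx : x ∈ Ioc (0 : ℝ) 1) : 1 ≤ Real.Gamma x := by
  have := Real.convexOn_Gamma
  by_contra! hlt
  have hx1 : x < 1 := lt_of_le_of_ne hx.2 (by rintro rfl; simp at hlt)
  have h := this.2 (show x ∈ Ioi (0 : ℝ) from hx.1) (show (2 : ℝ) ∈ Ioi (0 : ℝ) by simp)
    (show 0 ≤ 1 / (2 - x) by apply div_nonneg <;> linarith)
    (show 0 ≤ (1 - x) / (2 - x) by apply div_nonneg <;> linarith)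
    (by have : 2 - x ≠ 0 := by linarith
        field_simp; ring)
  have h2 : (1 / (2 - x)) • x + ((1 - x) / (2 - x)) • (2 : ℝ) = 1 := by
    have : 2 - x ≠ 0 := by linarith
    simp only [smul_eq_mul]; field_simp; ring
  rw [h2, Real.Gamma_one, Real.Gamma_two] at h
  simp only [smul_eq_mul] at h
  have h3 : 1 / (2 - x) * Real.Gamma x < 1 / (2 - x) * 1 :=
    mul_lt_mul_of_pos_left hlt (by apply div_pos <;> linarith)
  have h4 : 1 / (2 - x) * 1 + (1 - x) / (2 - x) * 1 = 1 := by
    have : 2 - x ≠ 0 := by linarith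
    field_simp; ring
  linarith

/-- The product equals `Γ(x+1) x^(-x)`. The first factor is at most 1 by convexity, and `-x log x ≤
1/e < log 2` bounds the second. This is why the factor 2 in the definition of `ωf` suffices. -/
theorem Gamma_mul_rpow_lt_two {x : ℝ} (hx : x ∈ Ioc (0 : ℝ) 1) :
    Real.Gamma x * x ^ (1 - x) < 2 := by
  have h1 : Real.Gamma (x + 1) ≤ 1 := by
    have := Real.convexOn_Gamma.2 (show (1 : ℝ) ∈ Ioi (0 : ℝ) by simp)
      (show (2 : ℝ) ∈ Ioi (0 : ℝ) by simp) (show 0 ≤ 1 - x by linarith [hx.2]) hx.1.le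
      (by ring)
    simp only [smul_eq_mul, Real.Gamma_one, Real.Gamma_two] at this
    have h : (1 - x) * 1 + x * 2 = x + 1 := by ring
    rw [h] at this
    linarith
  have h2 : x ^ (-x) < 2 := by
    rw [Real.rpow_def_of_pos hx.1, ← Real.lt_log_iff_exp_lt two_pos]
    have h3 := Real.log_le_sub_one_of_pos (show 0 < (x * Real.exp 1)⁻¹ by
      have := hx.1; positivity)
    rw [Real.log_inv, Real.log_mul hx.1.ne' (Real.exp_pos 1).ne', Real.log_exp] at h3
    have h4 : x * (x * Real.exp 1)⁻¹ = (Real.exp 1)⁻¹ := by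
      have := hx.1.ne'
      field_simp
    have h5 := mul_le_mul_of_nonneg_left h3 hx.1.le
    have h6 : (Real.exp 1)⁻¹ < 1 / 2 := by
      rw [inv_lt_comm₀ (Real.exp_pos 1) (by norm_num)]
      have := Real.exp_one_gt_d9
      norm_num; linarith
    have := Real.log_two_gt_d9
    nlinarith
  have h3 : Real.Gamma x * x ^ (1 - x) = Real.Gamma (x + 1) * x ^ (-x) := by
    rw [Real.Gamma_add_one hx.1.ne', sub_eq_add_neg, Real.rpow_add hx.1, Real.rpow_one]; ring
  rw [h3]
  have h4 := Real.rpow_pos_of_pos hx.1 (-x)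
  have h5 := Real.Gamma_pos_of_pos (show 0 < x + 1 by linarith [hx.1])
  nlinarith

namespace BanachScale

variable {X : Type u} [NormedAddCommGroup X] [NormedSpace ℝ X] {A : X →ₗ.[ℝ] X} {lam : ℝ}
variable {Sc : BanachScale X A lam} {S : C0Semigroup X}

/-- The maximum with 1 covers `t = 0`, which the hypothesis leaves out. -/
theorem normLE_semigroup {M ω : ℝ}
    (h : ∀ t : ℝ, 0 < t → ∀ x : Sc.space 1,
      Sc.NormLE 1 (S.toFun t (Sc.emb 1 x)) (M * Real.exp (ω * t) * ‖x‖))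
    {t : ℝ} (ht : 0 ≤ t) (x : Sc.space 1) :
    Sc.NormLE 1 (S.toFun t (Sc.emb 1 x)) (max M 1 * Real.exp (ω * t) * ‖x‖) := by
  rcases ht.eq_or_lt with rfl | ht
  · refine ⟨x, by simp [S.map_zero], ?_⟩
    simp only [mul_zero, Real.exp_zero, mul_one]
    exact le_mul_of_one_le_left (norm_nonneg _) (le_max_right _ _)
  · refine (h t ht x).mono ?_
    gcongr
    exact le_max_left _ _

/-- Convolution with a semigroup that is smoothing on a subset `V` of `X_α`. -/
theorem normLE_convolution_kern [CompleteSpace X] (hS : S.IsGeneratedBy A)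
    {a b c α C C' ω ω' : ℝ} (hab : a ≤ b)
    (hc : 0 < c) (hα : 0 < α) (hC : 0 ≤ C)
    (hsm : ∀ t, 0 < t → ∀ x : Sc.space α,
      Sc.NormLE 1 (S.toFun t (Sc.emb α x)) (C' * t ^ (α - 1) * Real.exp (ω' * t) * ‖x‖))
    {V : Set (Sc.space α)}
    (hV : ∀ t, 0 < t → ∀ x ∈ V,
      Sc.NormLE 1 (S.toFun t (Sc.emb α x)) (C * t ^ (α - 1) * Real.exp (ω * t) * ‖x‖))
    {w : ℝ → Sc.space α} {B : ℝ → ℝ} (hw : ContinuousOn w (Icc a b))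
    (hB : ContinuousOn B (Icc a b)) (hwV : ∀ s ∈ Ioo a b, w s ∈ V)
    (hle : ∀ s ∈ Ioo a b, ‖w s‖ ≤ c * B s) :
    Sc.NormLE 1 (∫ s in a..b, S.toFun (c * (b - s)) (Sc.emb α (w s)))
      (C * ∫ s in a..b, kern c α ω b s * B s) := by
  rw [← uIcc_of_le hab] at hB
  rw [← intervalIntegral.integral_const_mul]
  refine normLE_convolution hS hab hc ⟨_, hsm⟩ (hw.mono Ioo_subset_Icc_self)
    ((intervalIntegrable_kern hα ω b a hB).const_mul C) fun s hs => ?_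
  have hpos : 0 < c * (b - s) := mul_pos hc (sub_pos.2 hs.2)
  refine (hV _ hpos _ (hwV s hs)).mono ?_
  calc C * (c * (b - s)) ^ (α - 1) * Real.exp (ω * (c * (b - s))) * ‖w s‖
      ≤ C * (c * (b - s)) ^ (α - 1) * Real.exp (ω * (c * (b - s))) * (c * B s) := by
        gcongr; exact hle s hs
    _ = _ := by simp only [kern]; ring

end BanachScale

/-! ### Basic estimates for the fast and the slow equation -/

namespace System.Admissible

variable {X Y : Type u} [NormedAddCommGroup X] [NormedSpace ℝ X]
  [NormedAddCommGroup Y] [NormedSpace ℝ Y] {F : System X Y} (hF : F.Admissible)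

include hF

/-- This is what `ωf` is made for. If `γ_X < 1`, then `(ωf - ωA)^γ_X = 2 C_A L_f γ_X^(-(1-γ_X))`,
and the quantity becomes `Γ(γ_X) γ_X^(1-γ_X) / 2`. If `γ_X = 1`, it is `C_A L_f / (ωf - ωA)`. It is
the contraction factor of the fast equation. -/
theorem exists_rate : F.ωA < F.ωf ∧
    F.CA * F.Lf * (Real.Gamma F.γX / (F.ωf - F.ωA) ^ F.γX) < 1 := by
  have hC := hF.CA_pos
  have hL := hF.Lf_pos
  have hγ := hF.γX_mem
  rcases hγ.2.lt_or_eq with h | h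
  · have h1 := hF.ωf_eq h
    have hpos : 0 < (2 * F.CA * F.Lf) ^ (1 / F.γX) * (1 / F.γX) ^ ((1 - F.γX) / F.γX) := by
      have := hγ.1; positivity
    refine ⟨by linarith, ?_⟩
    have h2 : (F.ωf - F.ωA) ^ F.γX = 2 * F.CA * F.Lf * (F.γX ^ (1 - F.γX))⁻¹ := by
      rw [h1, add_sub_cancel_left, Real.mul_rpow (by positivity) (by have := hγ.1; positivity),
        ← Real.rpow_mul (by positivity), ← Real.rpow_mul (by have := hγ.1; positivity),
        one_div_mul_cancel hγ.1.ne', div_mul_cancel₀ _ hγ.1.ne', Real.rpow_one, one_div,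
        Real.inv_rpow hγ.1.le]
    have h3 := Gamma_mul_rpow_lt_two hγ
    have h4 : 0 < F.γX ^ (1 - F.γX) := Real.rpow_pos_of_pos hγ.1 _
    have h5 : F.CA * F.Lf * (Real.Gamma F.γX / (F.ωf - F.ωA) ^ F.γX) =
        Real.Gamma F.γX * F.γX ^ (1 - F.γX) / 2 := by
      rw [h2]; field_simp
    rw [h5]; linarith
  · have h1 := hF.ωf_gt h
    have h2 : 0 < F.CA * F.Lf := mul_pos hC hL
    refine ⟨by linarith, ?_⟩
    rw [h, Real.Gamma_one, Real.rpow_one, mul_one_div, div_lt_one (by linarith)]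
    linarith

/-- The basic estimate for the variation of constants formula of the fast equation. -/
theorem fast_estimate [CompleteSpace X] {a b c : ℝ} (hab : a ≤ b) (hc : 0 < c) {d : ℝ → F.X₁}
    {w : ℝ → F.XS.space F.γX} {e : ℝ → F.XS.space F.δX} {Bw Be : ℝ → ℝ}
    (hw : ContinuousOn w (Icc a b)) (he : ContinuousOn e (Icc a b))
    (hBw : ContinuousOn Bw (Icc a b)) (hBe : ContinuousOn Be (Icc a b))
    (hwB : ∀ s ∈ Ioo a b, ‖w s‖ ≤ Bw s) (heB : ∀ s ∈ Ioo a b, ‖e s‖ ≤ Be s)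
    (hrep : F.XS.emb 1 (d b) = F.expA.toFun (c * (b - a)) (F.XS.emb 1 (d a)) +
      ∫ s in a..b, F.expA.toFun (c * (b - s))
        (c • F.XS.emb F.γX (w s) - F.XS.emb F.δX (e s))) :
    ‖d b‖ ≤ max F.MA 1 * Real.exp (F.ωA * (c * (b - a))) * ‖d a‖ +
      F.CA * (∫ s in a..b, kern c F.γX F.ωA b s * Bw s) +
      c⁻¹ * (F.CA * ∫ s in a..b, kern c F.δX F.ωA b s * Be s) := by
  have h1 := BanachScale.normLE_semigroup hF.expA_bound
    (mul_nonneg hc.le (sub_nonneg.2 hab)) (d a)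
  have h2 := BanachScale.normLE_convolution_kern hF.generator_A hab hc hF.γX_mem.1 hF.CA_pos.le
    hF.expA_smoothing_γ (V := univ) (fun t ht x _ => hF.expA_smoothing_γ t ht x)
    (w := fun s => c • w s) (hw.const_smul c) hBw (fun _ _ => mem_univ _)
    (fun s hs => by
      rw [norm_smul, Real.norm_eq_abs, abs_of_pos hc]
      exact mul_le_mul_of_nonneg_left (hwB s hs) hc.le)
  -- The term `e` is not multiplied by `c`, whereas `kern` contains a factor `c`. Writing `Be = c
  -- (c⁻¹ Be)` produces the gain `c⁻¹`, which is `ε` in the applications.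
  have h3 := BanachScale.normLE_convolution_kern hF.generator_A hab hc hF.δX_pos hF.CA_pos.le
    hF.expA_smoothing_δ (V := univ) (fun t ht x _ => hF.expA_smoothing_δ t ht x)
    (w := fun s => - e s) (B := fun s => c⁻¹ * Be s) he.neg (hBe.const_mul _)
    (fun _ _ => mem_univ _)
    (fun s hs => by
      rw [norm_neg, mul_inv_cancel_left₀ hc.ne']
      exact heB s hs)
  have hr : ContinuousOn (fun s => c * (b - s)) (Icc a b) := by fun_prop
  have hr0 : ∀ s ∈ Icc a b, 0 ≤ c * (b - s) := fun s hs =>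
    mul_nonneg hc.le (sub_nonneg.2 hs.2)
  have hi1 : IntervalIntegrable
      (fun s => F.expA.toFun (c * (b - s)) (F.XS.emb F.γX (c • w s))) volume a b := by
    apply ContinuousOn.intervalIntegrable
    rw [uIcc_of_le hab]
    exact F.expA.continuousOn_apply hr hr0
      ((F.XS.emb F.γX).continuous.comp_continuousOn (hw.const_smul c))
  have hi2 : IntervalIntegrable
      (fun s => F.expA.toFun (c * (b - s)) (F.XS.emb F.δX (- e s))) volume a b := by
    apply ContinuousOn.intervalIntegrable
    rw [uIcc_of_le hab]
    exact F.expA.continuousOn_apply hr hr0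
      ((F.XS.emb F.δX).continuous.comp_continuousOn he.neg)
  have h4 := (h1.add h2).add h3
  rw [add_assoc, ← intervalIntegral.integral_add hi1 hi2] at h4
  simp only [map_smul, map_neg, ← sub_eq_add_neg] at h4
  simp only [map_sub, map_smul] at h4 hrep
  rw [← hrep, F.XS.normLE_emb_iff zero_le_one, integral_kern_mul_const_mul] at h4
  linarith

/-- The basic estimate for the variation of constants formula of the slow equation. -/
theorem slow_estimate [CompleteSpace Y] {a b : ℝ} (hab : a ≤ b) {d : ℝ → F.Y₁}
    {w : ℝ → F.YS.space F.δY} {Bw : ℝ → ℝ} (hw : ContinuousOn w (Icc a b))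
    (hBw : ContinuousOn Bw (Icc a b)) (hwB : ∀ s ∈ Ioo a b, ‖w s‖ ≤ Bw s) {y : Y} {r : ℝ}
    (hy : F.YS.NormLE 1 y r)
    (hrep : F.YS.emb 1 (d b) = F.expB.toFun (b - a) (F.YS.emb 1 (d a)) +
      (∫ s in a..b, F.expB.toFun (b - s) (F.YS.emb F.δY (w s))) + y) :
    ‖d b‖ ≤ max F.MB 1 * Real.exp (F.ωB * (b - a)) * ‖d a‖ +
      F.CB * (∫ s in a..b, kern 1 F.δY F.ωB b s * Bw s) + r := by
  have h1 := BanachScale.normLE_semigroup hF.expB_bound (sub_nonneg.2 hab) (d a)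
  have h2 := BanachScale.normLE_convolution_kern hF.generator_B hab one_pos hF.δY_mem.1
    hF.CB_pos.le hF.expB_smoothing (V := univ) (fun t ht x _ => hF.expB_smoothing t ht x)
    hw hBw (fun _ _ => mem_univ _) (fun s hs => by rw [one_mul]; exact hwB s hs)
  simp only [one_mul] at h2
  have h4 := (h1.add h2).add hy
  rwa [← hrep, F.YS.normLE_emb_iff zero_le_one] at h4

end System.Admissible

end FastSlow

/-! ### Lifts of the split nonlinearity and bounds for the reduced subsystem -/

namespace FastSlow

theorem hasDerivAt_of_contDiffOn_Icc {E : Type u} [NormedAddCommGroup E] [NormedSpace ℝ E]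
    {a b s : ℝ} {w : ℝ → E} (hw : ContDiffOn ℝ 1 w (Icc a b)) (hs : s ∈ Ioo a b) :
    HasDerivAt w (derivWithin w (Icc a b) s) s :=
  ((hw.differentiableOn one_ne_zero) s (Ioo_subset_Icc_self hs)).hasDerivWithinAt.hasDerivAt
    (Icc_mem_nhds hs.1 hs.2)

variable {X Y : Type u} [NormedAddCommGroup X] [NormedSpace ℝ X]
  [NormedAddCommGroup Y] [NormedSpace ℝ Y] {F : System X Y} {P : Splitting Y}

/-- The predicate `p` is present because the lifts of `pr_F g` and `pr_S g` are controlled only on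
`Y_F × Y_S`. -/
theorem System.Admissible.continuousOn_of_lipschitz {E : Type u} [NormedAddCommGroup E]
    {G : F.X₁ → F.Y₁ → F.Y₁ → E} {p : F.X₁ → F.Y₁ → F.Y₁ → Prop} {L : ℝ}
    (hG : ∀ x y z x' y' z', p x y z → p x' y' z' →
      ‖G x y z - G x' y' z'‖ ≤ L * (‖x - x'‖ + ‖y - y'‖ + ‖z - z'‖))
    {s : Set ℝ} {x : ℝ → F.X₁} {y z : ℝ → F.Y₁} (hp : ∀ r ∈ s, p (x r) (y r) (z r))
    (hx : ContinuousOn x s) (hy : ContinuousOn y s) (hz : ContinuousOn z s) :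
    ContinuousOn (fun r => G (x r) (y r) (z r)) s := by
  intro r hr
  rw [ContinuousWithinAt, tendsto_iff_norm_sub_tendsto_zero]
  have h1 := ((((hx r hr).sub_const (x r)).norm.add ((hy r hr).sub_const (y r)).norm).add
    ((hz r hr).sub_const (z r)).norm).const_mul L
  simp only [sub_self, norm_zero, add_zero, mul_zero] at h1
  refine squeeze_zero' (Eventually.of_forall fun _ => norm_nonneg _) ?_ h1
  filter_upwards [self_mem_nhdsWithin] with r' hr'
  exact hG _ _ _ _ _ _ (hp r' hr') (hp r hr)

theorem System.Admissible.continuousOn_g (hF : F.Admissible) {s : Set ℝ} {x : ℝ → F.X₁}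
    {y : ℝ → F.Y₁} (hx : ContinuousOn x s) (hy : ContinuousOn y s) :
    ContinuousOn (fun r => F.g (x r) (y r)) s :=
  continuousOn_of_lipschitz (G := fun x _ y => F.g x y) (p := fun _ _ _ => True) (L := F.Lg)
    (fun x z y x' z' y' _ _ => (hF.g_lipschitz x x' y y').trans (mul_le_mul_of_nonneg_left
      (by linarith [norm_nonneg (z - z')]) hF.Lg_pos.le))
    (fun _ _ => trivial) hx hy hy

theorem System.Admissible.g₁_zero (hF : F.Admissible) : F.g₁ 0 0 = 0 := by
  simp [System.g₁, hF.g_zero]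

namespace Splitting.Admissible

variable (hP : P.Admissible F) {ζ : ℝ} (hζ : ζ ∈ Ioo 0 P.ζ₀)

include hP hζ

theorem prF_add_prS_apply (y : Y) : P.prF ζ y + P.prS ζ y = y :=
  congrArg (fun L => L y) (hP.prF_add_prS ζ hζ)

theorem prS_prF (y : Y) : P.prS ζ (P.prF ζ y) = 0 := by
  have h1 := hP.prF_add_prS_apply hζ (P.prF ζ y)
  have h2 : P.prF ζ (P.prF ζ y) = P.prF ζ y := congrArg (fun L => L y) (hP.prF_idem ζ hζ)
  rw [h2] at h1
  simpa using h1

theorem prF_prS (y : Y) : P.prF ζ (P.prS ζ y) = 0 := by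
  have h2 : P.prF ζ (P.prF ζ y) = P.prF ζ y := congrArg (fun L => L y) (hP.prF_idem ζ hζ)
  rw [eq_sub_of_add_eq' (hP.prF_add_prS_apply hζ y), map_sub, h2, sub_self]

/-- `pr_F g` lifted to a Lipschitz map into `Y_{δ_Y}`. -/
theorem exists_prF_g_lift (hF : F.Admissible) :
    ∃ ψ : F.X₁ → F.Y₁ → F.Y₁ → F.YS.space F.δY,
    (∀ x yF yS, P.prS ζ (F.YS.emb 1 yF) = 0 → P.prF ζ (F.YS.emb 1 yS) = 0 →
      F.YS.emb F.δY (ψ x yF yS) = P.prF ζ (F.g₁ x (yF + yS)) ∧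
      ‖ψ x yF yS‖ ≤ F.Lg * (‖x‖ + ‖yF‖ + ‖yS‖)) ∧
    ∀ x yF yS x' yF' yS', (P.prS ζ (F.YS.emb 1 yF) = 0 ∧ P.prF ζ (F.YS.emb 1 yS) = 0) →
      (P.prS ζ (F.YS.emb 1 yF') = 0 ∧ P.prF ζ (F.YS.emb 1 yS') = 0) →
      ‖ψ x yF yS - ψ x' yF' yS'‖ ≤ F.Lg * (‖x - x'‖ + ‖yF - yF'‖ + ‖yS - yS'‖) := by
  have h : ∀ x yF yS, ∃ w : F.YS.space F.δY, P.prS ζ (F.YS.emb 1 yF) = 0 →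
      P.prF ζ (F.YS.emb 1 yS) = 0 → F.YS.emb F.δY w = P.prF ζ (F.g₁ x (yF + yS)) ∧
      ‖w‖ ≤ F.Lg * (‖x‖ + ‖yF‖ + ‖yS‖) := by
    intro x yF yS
    -- Off `Y_F × Y_S` the lift takes the default value `0`, about which nothing is claimed.
    by_cases h1 : P.prS ζ (F.YS.emb 1 yF) = 0
    · by_cases h2 : P.prF ζ (F.YS.emb 1 yS) = 0
      · obtain ⟨w, hw, hw'⟩ := hP.prF_g ζ hζ x 0 yF 0 yS 0 h1 (by simp) h2 (by simp)
        simp only [add_zero, hF.g₁_zero, sub_zero] at hw hw'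
        exact ⟨w, fun _ _ => ⟨hw, hw'⟩⟩
      · exact ⟨0, fun _ h => absurd h h2⟩
    · exact ⟨0, fun h => absurd h h1⟩
  choose ψ hψ using h
  refine ⟨ψ, hψ, fun x yF yS x' yF' yS' h1 h2 => ?_⟩
  have := hP.prF_g ζ hζ x x' yF yF' yS yS' h1.1 h2.1 h1.2 h2.2
  rwa [map_sub, ← (hψ x yF yS h1.1 h1.2).1, ← (hψ x' yF' yS' h2.1 h2.2).1, ← map_sub,
    F.YS.normLE_emb_iff hF.δY_mem.1.le] at this

/-- `pr_S g` lifted to a map into `Y_{δ_Y}` that is Lipschitz uniformly in `ζ`. -/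
theorem exists_prS_g_lift (hF : F.Admissible) :
    ∃ θ : F.X₁ → F.Y₁ → F.Y₁ → F.YS.space F.δY,
    (∀ x yF yS, P.prS ζ (F.YS.emb 1 yF) = 0 → P.prF ζ (F.YS.emb 1 yS) = 0 →
      F.YS.emb F.δY (θ x yF yS) = P.prS ζ (F.g₁ x (yF + yS)) ∧
      ‖θ x yF yS‖ ≤ 2 * F.Lg * (‖x‖ + ‖yF‖ + ‖yS‖)) ∧
    ∀ x yF yS x' yF' yS', (P.prS ζ (F.YS.emb 1 yF) = 0 ∧ P.prF ζ (F.YS.emb 1 yS) = 0) →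
      (P.prS ζ (F.YS.emb 1 yF') = 0 ∧ P.prF ζ (F.YS.emb 1 yS') = 0) →
      ‖θ x yF yS - θ x' yF' yS'‖ ≤ 2 * F.Lg * (‖x - x'‖ + ‖yF - yF'‖ + ‖yS - yS'‖) := by
  obtain ⟨ψ, hψ, hψL⟩ := hP.exists_prF_g_lift hζ hF
  have hL := hF.Lg_pos.le
  -- Since `pr_S g = g - pr_F g`, the constant `2 L_g` is independent of `ζ`. The bound of `pr_S g`
  -- in `Y_1` carries `ζ^(δ_Y-1)`, which is unbounded as `ζ → 0` when `δ_Y < 1`.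
  refine ⟨fun x yF yS => F.g x (yF + yS) - ψ x yF yS, fun x yF yS h1 h2 => ⟨?_, ?_⟩,
    fun x yF yS x' yF' yS' h1 h2 => ?_⟩
  · rw [map_sub, (hψ x yF yS h1 h2).1, sub_eq_iff_eq_add', hP.prF_add_prS_apply hζ]
    rfl
  · have h3 := hF.g_lipschitz x 0 (yF + yS) 0
    simp only [hF.g_zero, sub_zero] at h3
    have h4 := mul_le_mul_of_nonneg_left (norm_add_le yF yS) hL
    have h5 := (hψ x yF yS h1 h2).2
    have h6 := norm_sub_le (F.g x (yF + yS)) (ψ x yF yS)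
    linarith
  · have h3 := hF.g_lipschitz x x' (yF + yS) (yF' + yS')
    have h4 := mul_le_mul_of_nonneg_left (norm_add_le (yF - yF') (yS - yS')) hL
    rw [show yF - yF' + (yS - yS') = yF + yS - (yF' + yS') by abel] at h4
    have h5 := hψL x yF yS x' yF' yS' h1 h2
    have h6 := norm_sub_le (F.g x (yF + yS) - F.g x' (yF' + yS')) (ψ x yF yS - ψ x' yF' yS')
    rw [show F.g x (yF + yS) - ψ x yF yS - (F.g x' (yF' + yS') - ψ x' yF' yS') =
      F.g x (yF + yS) - F.g x' (yF' + yS') - (ψ x yF yS - ψ x' yF' yS') by abel]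
    linarith

end Splitting.Admissible

namespace Splitting.Admissible

variable (hP : P.Admissible F) (hF : F.Admissible)

include hP hF

/-- Solutions of the reduced slow subsystem are bounded in `Y_1`, uniformly in `ζ`. -/
theorem exists_reduced_bound [CompleteSpace X] [CompleteSpace Y] {T : ℝ} (hT : 0 < T) :
    ∃ C : ℝ, 0 ≤ C ∧ ∀ ζ ∈ Ioo 0 P.ζ₀, ∀ (v₀ : F.Y₁) (uζ : ℝ → F.X₁) (vζ : ℝ → F.Y₁),
    P.IsReducedSolution F ζ T v₀ uζ vζ → ∀ t ∈ Icc 0 T, ‖vζ t‖ ≤ C * ‖v₀‖ := by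
  obtain ⟨Lh, hLh0, hLh⟩ := hF.exists_h₀_lipschitz
  have hLg := hF.Lg_pos
  have hCB := hF.CB_pos
  have hδ := hF.δY_mem
  have hΓ := Real.Gamma_pos_of_pos hδ.1
  -- Since `‖u_ζ‖ ≤ Lh ‖v_ζ‖`, the slow equation is closed with Lipschitz constant `2 L_g (Lh + 1)`.
  -- The weight `l` brings its feedback down to `1/2`.
  set M := F.CB * (2 * F.Lg * (Lh + 1)) with hM
  obtain ⟨l, hl0, hlω, hl⟩ := exists_weight hδ.1 F.ωB M
  set c := max F.MB 1 * |P.K| with hc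
  have hMB : 0 ≤ max F.MB 1 := zero_le_one.trans (le_max_right _ _)
  have hc0 : 0 ≤ c := mul_nonneg hMB (abs_nonneg _)
  refine ⟨c / (1 - 1 / 2) * Real.exp (l * T), by positivity, fun ζ hζ v₀ uζ vζ hs => ?_⟩
  obtain ⟨θ, hθ, hθL⟩ := hP.exists_prS_g_lift hζ hF
  have huh : ∀ s ∈ Icc 0 T, uζ s = F.h₀ (vζ s) := fun s hs' => hF.eq_h₀ (hs.u_eq s hs').symm
  have hu_le : ∀ s ∈ Icc 0 T, ‖uζ s‖ ≤ Lh * ‖vζ s‖ := fun s hs' => by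
    have := hLh (vζ s) 0
    rwa [hF.h₀_zero, sub_zero, sub_zero, ← huh s hs'] at this
  have hmem : ∀ s ∈ Icc 0 T, P.prS ζ (F.YS.emb 1 0) = 0 ∧ P.prF ζ (F.YS.emb 1 (vζ s)) = 0 :=
    fun s hs' => ⟨by simp, (hs.prF_eq s hs').symm⟩
  have hθc : ContinuousOn (fun s => θ (uζ s) 0 (vζ s)) (Icc 0 T) :=
    System.Admissible.continuousOn_of_lipschitz hθL hmem hs.u_continuousOn continuousOn_const
      hs.v_continuousOn
  have hθe : ∀ s ∈ Icc 0 T, F.YS.emb F.δY (θ (uζ s) 0 (vζ s)) = P.prS ζ (F.g₁ (uζ s) (vζ s)) ∧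
      ‖θ (uζ s) 0 (vζ s)‖ ≤ 2 * F.Lg * (Lh + 1) * ‖vζ s‖ := by
    intro s hs'
    obtain ⟨h1, h2⟩ := hθ (uζ s) 0 (vζ s) (hmem s hs').1 (hmem s hs').2
    rw [zero_add] at h1
    rw [norm_zero, add_zero] at h2
    refine ⟨h1, h2.trans ?_⟩
    rw [mul_assoc (2 * F.Lg)]
    refine mul_le_mul_of_nonneg_left ?_ (by positivity)
    linarith [hu_le s hs']
  have hv0 : ‖vζ 0‖ ≤ |P.K| * ‖v₀‖ := by
    have := hP.prS_bound ζ hζ v₀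
    rw [← hs.v_zero, F.YS.normLE_emb_iff zero_le_one] at this
    exact this.trans (mul_le_mul_of_nonneg_right (le_abs_self _) (norm_nonneg _))
  -- The parameter `η` keeps the comparison function positive even if `v₀ = 0`; it tends to `0` at
  -- the end.
  have key : ∀ η > 0, ∀ t ∈ Icc 0 T, ‖vζ t‖ ≤
      c / (1 - 1 / 2) * ((‖v₀‖ + η) * Real.exp (l * t)) := by
    intro η hη
    refine le_of_self_improving (T := T) hT.le (D := fun t => (‖v₀‖ + η) * Real.exp (l * t))
      hs.v_continuousOn.norm (by fun_prop) (fun s _ => by positivity) hc0 (by norm_num) ?_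
    intro N hN hle t ht
    have hsub : Icc 0 t ⊆ Icc 0 T := Icc_subset_Icc_right ht.2
    have hmild := BanachScale.mild_formula (Sc := F.YS) hF.generator_B (a := 0) (b := t) (c := 1)
      ht.1 one_pos (x := vζ) (h := fun s => F.YS.emb F.δY (θ (uζ s) 0 (vζ s)))
      (hs.v_continuousOn.mono hsub) (fun s hs' => by
        have hs'' : s ∈ Ioo 0 T := ⟨hs'.1, hs'.2.trans_le ht.2⟩
        have := hasDerivAt_of_contDiffOn_Icc hs.v_contDiffOn hs''
        rw [hs.v_eq s (Ioo_subset_Icc_self hs'')] at this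
        rwa [one_smul, (hθe s (Ioo_subset_Icc_self hs'')).1])
      ((F.YS.emb F.δY).continuous.comp_continuousOn (hθc.mono hsub))
    simp only [one_mul] at hmild
    have hest := hF.slow_estimate (a := 0) (b := t) ht.1 (d := vζ)
      (w := fun s => θ (uζ s) 0 (vζ s)) (Bw := fun s => 2 * F.Lg * (Lh + 1) *
        (N * (‖v₀‖ + η)) * Real.exp (l * s)) (hθc.mono hsub) (by fun_prop)
      (fun s hs' => by
        have hs'' := hsub (Ioo_subset_Icc_self hs')
        refine (hθe s hs'').2.trans ?_
        rw [mul_assoc _ (N * _)]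
        refine mul_le_mul_of_nonneg_left ?_ (by positivity)
        linarith [hle s hs''])
      (y := 0) (r := 0) ⟨0, by simp, by simp⟩ (by rw [hmild, add_zero])
    rw [integral_kern_mul_const_mul] at hest
    have hk := integral_kern_mul_exp_le' (c := 1) (ω := F.ωB) (μ := l) (p := l - F.ωB) one_pos
      hδ.1 (by linarith) (by simp [sub_eq_neg_add]) ht.1
    have he : Real.exp (F.ωB * (t - 0)) ≤ Real.exp (l * t) := by
      apply Real.exp_le_exp.2
      rw [sub_zero]
      exact mul_le_mul_of_nonneg_right hlω.le ht.1
    refine hest.trans ?_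
    have h1 : max F.MB 1 * Real.exp (F.ωB * (t - 0)) * ‖vζ 0‖ ≤
        c * ((‖v₀‖ + η) * Real.exp (l * t)) := by
      calc _ ≤ max F.MB 1 * Real.exp (l * t) * (|P.K| * ‖v₀‖) := by gcongr
        _ ≤ max F.MB 1 * Real.exp (l * t) * (|P.K| * (‖v₀‖ + η)) := by gcongr; linarith
        _ = _ := by rw [hc]; ring
    have h2 : F.CB * (2 * F.Lg * (Lh + 1) * (N * (‖v₀‖ + η)) *
        ∫ s in (0 : ℝ)..t, kern 1 F.δY F.ωB t s * Real.exp (l * s)) ≤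
        1 / 2 * N * ((‖v₀‖ + η) * Real.exp (l * t)) := by
      calc _ ≤ F.CB * (2 * F.Lg * (Lh + 1) * (N * (‖v₀‖ + η)) *
            (Real.Gamma F.δY / (l - F.ωB) ^ F.δY * Real.exp (l * t))) := by gcongr
        _ = (M * (Real.Gamma F.δY / (l - F.ωB) ^ F.δY)) *
            (N * ((‖v₀‖ + η) * Real.exp (l * t))) := by rw [hM]; ring
        _ ≤ 1 / 2 * (N * ((‖v₀‖ + η) * Real.exp (l * t))) := by gcongr
        _ = _ := by ring
    linarith
  intro t ht
  have hlim : Tendsto (fun η : ℝ => c / (1 - 1 / 2) * ((‖v₀‖ + η) * Real.exp (l * t)))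
      (𝓝[>] 0) (𝓝 (c / (1 - 1 / 2) * ((‖v₀‖ + 0) * Real.exp (l * t)))) := by
    have : Continuous fun η : ℝ => c / (1 - 1 / 2) * ((‖v₀‖ + η) * Real.exp (l * t)) := by
      fun_prop
    exact (this.tendsto 0).mono_left nhdsWithin_le_nhds
  have h1 := ge_of_tendsto hlim (by
    filter_upwards [self_mem_nhdsWithin] with η hη using key η hη t ht)
  refine h1.trans ?_
  rw [add_zero, mul_assoc, mul_comm ‖v₀‖]
  have : l * t ≤ l * T := mul_le_mul_of_nonneg_left ht.2 hl0.le
  gcongr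

/-- The derivative of the fast component of a reduced solution is bounded in `X_{δ_X}`, uniformly
in `ζ`. -/
theorem exists_reduced_deriv_bound [CompleteSpace X] [CompleteSpace Y] {T : ℝ} (hT : 0 < T) :
    ∃ C : ℝ, 0 ≤ C ∧ ∀ ζ ∈ Ioo 0 P.ζ₀, ∀ (v₀ : F.Y₁) (uζ : ℝ → F.X₁) (vζ : ℝ → F.Y₁),
    P.IsReducedSolution F ζ T v₀ uζ vζ → ∃ d : ℝ → F.XS.space F.δX, ContinuousOn d (Icc 0 T) ∧
      (∀ s ∈ Ioo 0 T, HasDerivAt (fun s => F.XS.incl 1 F.δX (F.h₀ (vζ s))) (d s) s) ∧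
      ∀ s ∈ Icc 0 T, ‖d s‖ ≤ C * ‖v₀‖ := by
  obtain ⟨Lh, hLh0, hLh⟩ := hF.exists_h₀_lipschitz
  obtain ⟨Cv, hCv0, hCv⟩ := hP.exists_reduced_bound hF hT
  obtain ⟨Ch, hCh0, hCh⟩ := hF.exists_deriv_h₀
  have hLg := hF.Lg_pos
  -- `m₂ ‖v₀‖` bounds the time derivative `B v_ζ + pr_S g(u_ζ,v_ζ)` in `Y`.
  set m₂ := ‖F.YS.gen‖ * Cv + ‖F.YS.emb F.δY‖ * (2 * F.Lg * (Lh * Cv + Cv)) with hm₂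
  refine ⟨Ch * (‖F.YS.emb 1‖ * Cv + m₂), by positivity, fun ζ hζ v₀ uζ vζ hs => ?_⟩
  obtain ⟨θ, hθ, hθL⟩ := hP.exists_prS_g_lift hζ hF
  have huh : ∀ s ∈ Icc 0 T, uζ s = F.h₀ (vζ s) := fun s hs' => hF.eq_h₀ (hs.u_eq s hs').symm
  have hu_le : ∀ s ∈ Icc 0 T, ‖uζ s‖ ≤ Lh * ‖vζ s‖ := fun s hs' => by
    have := hLh (vζ s) 0
    rwa [hF.h₀_zero, sub_zero, sub_zero, ← huh s hs'] at this
  have hmem : ∀ s ∈ Icc 0 T, P.prS ζ (F.YS.emb 1 0) = 0 ∧ P.prF ζ (F.YS.emb 1 (vζ s)) = 0 :=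
    fun s hs' => ⟨by simp, (hs.prF_eq s hs').symm⟩
  have hθc : ContinuousOn (fun s => θ (uζ s) 0 (vζ s)) (Icc 0 T) :=
    System.Admissible.continuousOn_of_lipschitz hθL hmem hs.u_continuousOn continuousOn_const
      hs.v_continuousOn
  obtain ⟨d, hd, hd1, hd2⟩ := hCh 0 T hT vζ
    (fun s => F.YS.gen (vζ s) + F.YS.emb F.δY (θ (uζ s) 0 (vζ s))) hs.v_continuousOn
    (fun s hs' => by
      have h1 := (hs.v_contDiffOn.differentiableOn one_ne_zero s hs').hasDerivWithinAt
      rw [hs.v_eq s hs'] at h1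
      rw [(hθ (uζ s) 0 (vζ s) (hmem s hs').1 (hmem s hs').2).1, zero_add]
      exact h1)
    ((F.YS.gen.continuous.comp_continuousOn hs.v_continuousOn).add
      ((F.YS.emb F.δY).continuous.comp_continuousOn hθc))
  refine ⟨d, hd, hd1, fun s hs' => ?_⟩
  have h := hd2 (‖F.YS.emb 1‖ * (Cv * ‖v₀‖)) (m₂ * ‖v₀‖) (fun r hr =>
    ((F.YS.emb 1).le_opNorm _).trans (mul_le_mul_of_nonneg_left (hCv ζ hζ v₀ uζ vζ hs r hr)
      (norm_nonneg _))) (fun r hr => ?_) s hs'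
  · refine h.trans (le_of_eq ?_)
    ring
  · have hv := hCv ζ hζ v₀ uζ vζ hs r hr
    have hu := (hu_le r hr).trans (mul_le_mul_of_nonneg_left hv hLh0)
    have h2 := (hθ (uζ r) 0 (vζ r) (hmem r hr).1 (hmem r hr).2).2
    rw [norm_zero, add_zero] at h2
    calc _ ≤ ‖F.YS.gen (vζ r)‖ + ‖F.YS.emb F.δY (θ (uζ r) 0 (vζ r))‖ := norm_add_le _ _
      _ ≤ ‖F.YS.gen‖ * ‖vζ r‖ + ‖F.YS.emb F.δY‖ * ‖θ (uζ r) 0 (vζ r)‖ :=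
        add_le_add (F.YS.gen.le_opNorm _) ((F.YS.emb F.δY).le_opNorm _)
      _ ≤ ‖F.YS.gen‖ * (Cv * ‖v₀‖) + ‖F.YS.emb F.δY‖ *
          (2 * F.Lg * (Lh * (Cv * ‖v₀‖) + Cv * ‖v₀‖)) := by
        gcongr
        exact h2.trans (by gcongr)
      _ = _ := by rw [hm₂]; ring

end Splitting.Admissible

end FastSlow

/-! ### Error estimates for arbitrary initial values -/

namespace FastSlow

namespace Splitting.Admissible

variable {X Y : Type u} [NormedAddCommGroup X] [NormedSpace ℝ X]
  [NormedAddCommGroup Y] [NormedSpace ℝ Y] {F : System X Y} {P : Splitting Y}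
variable (hP : P.Admissible F) (hF : F.Admissible)

include hP hF

/-- The error of the fast component in terms of an exponential bound for the error of the slow
component. -/
theorem exists_fast_error [CompleteSpace X] [CompleteSpace Y] {T : ℝ} (hT : 0 < T) :
    ∃ C : ℝ, 0 ≤ C ∧ ∀ ε ∈ Ioc (0 : ℝ) 1, ∀ ζ ∈ Ioo 0 P.ζ₀, ∀ (u₀ : F.X₁) (v₀ : F.Y₁)
      (u : ℝ → F.X₁) (v : ℝ → F.Y₁), F.IsStrictSolution ε T u₀ v₀ u v →
      ∀ (uζ : ℝ → F.X₁) (vζ : ℝ → F.Y₁), P.IsReducedSolution F ζ T v₀ uζ vζ →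
      ∀ N l : ℝ, 0 ≤ N → 0 ≤ l → (∀ s ∈ Icc 0 T, ‖v s - vζ s‖ ≤ N * Real.exp (l * s)) →
      ∀ t ∈ Icc 0 T, ‖u t - F.h₀ (vζ t)‖ ≤
        C * (‖u₀ - F.h₀ (vζ 0)‖ * Real.exp (ε⁻¹ * F.ωf * t) + ε * ‖v₀‖ +
          N * Real.exp (l * t)) := by
  obtain ⟨Cd, hCd0, hCd⟩ := hP.exists_reduced_deriv_bound hF hT
  obtain ⟨Φ, hΦ, -, hΦL⟩ := hF.exists_fγ
  obtain ⟨hAf, hq1⟩ := hF.exists_rate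
  have hLf := hF.Lf_pos
  have hCA := hF.CA_pos
  have hγ := hF.γX_mem
  have hωA := hF.ωA_neg
  have hωf := hF.ωf_neg
  have hΓγ := Real.Gamma_pos_of_pos hγ.1
  have hΓδ := Real.Gamma_pos_of_pos hF.δX_pos
  set κ := Real.Gamma F.γX / (F.ωf - F.ωA) ^ F.γX with hκ
  have hκ0 : 0 ≤ κ := div_nonneg hΓγ.le (Real.rpow_nonneg (by linarith) _)
  set q := F.CA * F.Lf * κ with hq
  have hq0 : 0 ≤ q := by positivity
  set G := Real.Gamma F.δX / (-F.ωA) ^ F.δX with hG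
  have hG0 : 0 ≤ G := div_nonneg hΓδ.le (Real.rpow_nonneg (by linarith) _)
  set M := max F.MA 1 with hM
  have hM0 : 0 ≤ M := zero_le_one.trans (le_max_right _ _)
  -- `M` comes from the initial layer, `q` from the slow error entering through `f`, and the last
  -- term from the derivative of `h⁰(v_ζ)`.
  set c := M + q + F.CA * G * Cd with hc
  have hc0 : 0 ≤ c := by positivity
  refine ⟨c / (1 - q), div_nonneg hc0 (by linarith), ?_⟩
  intro ε hε ζ hζ u₀ v₀ u v hs uζ vζ hr N l hN hl hle
  have hε0 := hε.1
  have hεi : 0 < ε⁻¹ := inv_pos.2 hε0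
  obtain ⟨d, hdc, hd1, hd2⟩ := hCd ζ hζ v₀ uζ vζ hr
  set a₀ := ‖u₀ - F.h₀ (vζ 0)‖ with ha₀
  have ha₀0 : 0 ≤ a₀ := norm_nonneg _
  have hhc : ContinuousOn (fun s => F.h₀ (vζ s)) (Icc 0 T) :=
    hr.u_continuousOn.congr fun s hs' => (hF.eq_h₀ (hr.u_eq s hs').symm).symm
  set x : ℝ → F.X₁ := fun s => u s - F.h₀ (vζ s) with hx
  have hxc : ContinuousOn x (Icc 0 T) := hs.u_continuousOn.sub hhc
  set w : ℝ → F.XS.space F.γX := fun s => Φ (u s) (v s) - Φ (F.h₀ (vζ s)) (vζ s) with hw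
  have hΦc : ∀ {x : ℝ → F.X₁} {y : ℝ → F.Y₁}, ContinuousOn x (Icc 0 T) →
      ContinuousOn y (Icc 0 T) → ContinuousOn (fun r => Φ (x r) (y r)) (Icc 0 T) :=
    fun {x y} hx hy => System.Admissible.continuousOn_of_lipschitz (G := fun x _ y => Φ x y)
      (p := fun _ _ _ => True) (L := F.Lf)
      (fun x z y x' z' y' _ _ => (hΦL x y x' y').trans (mul_le_mul_of_nonneg_left
        (by linarith [norm_nonneg (z - z')]) hLf.le)) (fun _ _ => trivial) hx hy hy
  have hwc : ContinuousOn w (Icc 0 T) :=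
    (hΦc hs.u_continuousOn hs.v_continuousOn).sub (hΦc hhc hr.v_continuousOn)
  have key : ∀ η > 0, ∀ t ∈ Icc 0 T, ‖x t‖ ≤ c / (1 - q) *
      (a₀ * Real.exp (ε⁻¹ * F.ωf * t) + (ε * ‖v₀‖ + η) * Real.exp (0 * t) +
        N * Real.exp (l * t)) := by
    intro η hη
    refine le_of_self_improving hT.le hxc.norm (by fun_prop) (fun s _ => by positivity) hc0 hq1 ?_
    intro N' hN' hle' t ht
    set D : ℝ → ℝ := fun t => a₀ * Real.exp (ε⁻¹ * F.ωf * t) +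
      (ε * ‖v₀‖ + η) * Real.exp (0 * t) + N * Real.exp (l * t) with hD
    have hsub : Icc 0 t ⊆ Icc 0 T := Icc_subset_Icc_right ht.2
    have hmild := BanachScale.mild_formula (Sc := F.XS) hF.generator_A (a := 0) (b := t)
      (c := ε⁻¹) ht.1 hεi (x := x) (h := fun s => ε⁻¹ • F.XS.emb F.γX (w s) - F.XS.emb F.δX (d s))
      (hxc.mono hsub) (fun s hs' => by
        have hs'' : s ∈ Ioo 0 T := ⟨hs'.1, hs'.2.trans_le ht.2⟩
        have h1 := hasDerivAt_of_contDiffOn_Icc hs.u_contDiffOn hs''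
        have h2 := hs.u_eq s (Ioo_subset_Icc_self hs'')
        rw [(eq_inv_smul_iff₀ hε0.ne').2 h2] at h1
        have h3 : HasDerivAt (fun s => F.XS.emb F.δX (F.XS.incl 1 F.δX (F.h₀ (vζ s))))
            (F.XS.emb F.δX (d s)) s :=
          (F.XS.emb F.δX).hasFDerivAt.comp_hasDerivAt s (hd1 s hs'')
        simp only [F.XS.emb_incl hF.δX_pos.le hF.δX_mem.2] at h3
        have h4 := h1.fun_sub h3
        have h5 := eq_neg_of_add_eq_zero_left (hF.h₀_spec (vζ s))
        simp only [hx, hw, map_sub, hΦ, h5]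
        convert h4 using 1
        simp only [smul_sub, smul_add, smul_neg]
        abel)
      (((((F.XS.emb F.γX).continuous.comp_continuousOn hwc).const_smul ε⁻¹).sub
        ((F.XS.emb F.δX).continuous.comp_continuousOn hdc)).mono hsub)
    have hest := hF.fast_estimate (a := 0) (b := t) (c := ε⁻¹) ht.1 hεi (d := x) (w := w) (e := d)
      (Bw := fun s => (F.Lf * (N' + 1)) * D s) (Be := fun s => (Cd * ‖v₀‖) * Real.exp (0 * s))
      (hwc.mono hsub) (hdc.mono hsub) (by fun_prop) (by fun_prop)
      (fun s hs' => by
        have hs'' := hsub (Ioo_subset_Icc_self hs')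
        refine (hΦL _ _ _ _).trans ?_
        rw [mul_assoc]
        refine mul_le_mul_of_nonneg_left ?_ hLf.le
        have h1 := hle' s hs''
        have h2 := hle s hs''
        have h3 : N * Real.exp (l * s) ≤ D s := le_add_of_nonneg_left (by positivity)
        have h4 : ‖u s - F.h₀ (vζ s)‖ ≤ N' * D s := h1
        linarith)
      (fun s hs' => by
        simp only [zero_mul, Real.exp_zero, mul_one]
        exact hd2 s (hsub (Ioo_subset_Icc_self hs')))
      hmild
    rw [integral_kern_mul_const_mul, integral_kern_mul_const_mul, inv_inv] at hest
    -- The exponents `ωf/ε`, `0` and `l` are all at least `ωf/ε`, since `ωf < 0 ≤ l`. The net rate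
    -- in fast time is therefore at least `ωf - ωA` for each, and one factor `κ` serves the three
    -- summands.
    have hk1 : ∫ s in (0 : ℝ)..t, kern ε⁻¹ F.γX F.ωA t s * D s ≤ κ * D t := by
      have hp : 0 < F.ωf - F.ωA := by linarith
      have h1 := integral_kern_mul_exp_le' (c := ε⁻¹) (ω := F.ωA) (μ := ε⁻¹ * F.ωf) hεi hγ.1 hp
        (by rw [mul_div_cancel_left₀ _ hεi.ne']; linarith) ht.1
      have h2 := integral_kern_mul_exp_le' (c := ε⁻¹) (ω := F.ωA) (μ := 0) hεi hγ.1 hp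
        (by rw [zero_div]; linarith) ht.1
      have h3 := integral_kern_mul_exp_le' (c := ε⁻¹) (ω := F.ωA) (μ := l) hεi hγ.1 hp
        (by have := div_nonneg hl hεi.le; linarith) ht.1
      rw [← hκ] at h1 h2 h3
      simp only [hD]
      rw [integral_kern_mul_add hγ.1 ht.1 (by fun_prop) (by fun_prop),
        integral_kern_mul_add hγ.1 ht.1 (by fun_prop) (by fun_prop),
        integral_kern_mul_const_mul, integral_kern_mul_const_mul, integral_kern_mul_const_mul]
      have h1' := mul_le_mul_of_nonneg_left h1 ha₀0
      have h2' := mul_le_mul_of_nonneg_left h2 (show 0 ≤ ε * ‖v₀‖ + η by positivity)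
      have h3' := mul_le_mul_of_nonneg_left h3 hN
      linarith
    have hk2 : ∫ s in (0 : ℝ)..t, kern ε⁻¹ F.δX F.ωA t s * Real.exp (0 * s) ≤ G := by
      have := integral_kern_mul_exp_le' (c := ε⁻¹) (ω := F.ωA) (μ := 0) (p := -F.ωA) hεi
        hF.δX_pos (by linarith) (by simp) ht.1
      simpa only [zero_mul, Real.exp_zero, mul_one] using this
    have hx0 : ‖x 0‖ = a₀ := by simp only [hx, hs.u_zero, ha₀]
    have he : Real.exp (F.ωA * (ε⁻¹ * (t - 0))) ≤ Real.exp (ε⁻¹ * F.ωf * t) := by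
      apply Real.exp_le_exp.2
      have := mul_nonneg hεi.le ht.1
      rw [sub_zero]; nlinarith
    have hD1 : a₀ * Real.exp (ε⁻¹ * F.ωf * t) ≤ D t := by
      have : 0 ≤ (ε * ‖v₀‖ + η) * Real.exp (0 * t) := by positivity
      have : 0 ≤ N * Real.exp (l * t) := by positivity
      simp only [hD]; linarith
    have hD2 : ε * ‖v₀‖ ≤ D t := by
      have : 0 ≤ a₀ * Real.exp (ε⁻¹ * F.ωf * t) := by positivity
      have : 0 ≤ N * Real.exp (l * t) := by positivity
      simp only [hD, zero_mul, Real.exp_zero]; linarith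
    have e1 : M * Real.exp (F.ωA * (ε⁻¹ * (t - 0))) * ‖x 0‖ ≤ M * D t := by
      rw [hx0, mul_assoc]
      refine mul_le_mul_of_nonneg_left (le_trans ?_ hD1) hM0
      rw [mul_comm]
      exact mul_le_mul_of_nonneg_left he ha₀0
    have e2 : F.CA * (F.Lf * (N' + 1) * ∫ s in (0 : ℝ)..t, kern ε⁻¹ F.γX F.ωA t s * D s) ≤
        (q + q * N') * D t := by
      calc _ ≤ F.CA * (F.Lf * (N' + 1) * (κ * D t)) := by gcongr
        _ = _ := by rw [hq]; ring
    have e3 : ε * (F.CA * (Cd * ‖v₀‖ *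
        ∫ s in (0 : ℝ)..t, kern ε⁻¹ F.δX F.ωA t s * Real.exp (0 * s))) ≤
        F.CA * G * Cd * D t := by
      calc _ ≤ ε * (F.CA * (Cd * ‖v₀‖ * G)) := by gcongr
        _ = F.CA * G * Cd * (ε * ‖v₀‖) := by ring
        _ ≤ _ := by gcongr
    calc ‖x t‖ ≤ M * D t + (q + q * N') * D t + F.CA * G * Cd * D t :=
          hest.trans (add_le_add (add_le_add e1 e2) e3)
      _ = (c + q * N') * D t := by rw [hc]; ring
  intro t ht
  have hlim : Tendsto (fun η : ℝ => c / (1 - q) *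
      (a₀ * Real.exp (ε⁻¹ * F.ωf * t) + (ε * ‖v₀‖ + η) * Real.exp (0 * t) + N * Real.exp (l * t)))
      (𝓝[>] 0) (𝓝 (c / (1 - q) * (a₀ * Real.exp (ε⁻¹ * F.ωf * t) +
        (ε * ‖v₀‖ + 0) * Real.exp (0 * t) + N * Real.exp (l * t)))) := by
    have : Continuous fun η : ℝ => c / (1 - q) * (a₀ * Real.exp (ε⁻¹ * F.ωf * t) +
        (ε * ‖v₀‖ + η) * Real.exp (0 * t) + N * Real.exp (l * t)) := by
      fun_prop
    exact (this.tendsto 0).mono_left nhdsWithin_le_nhds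
  have h1 := ge_of_tendsto hlim (by
    filter_upwards [self_mem_nhdsWithin] with η hη using key η hη t ht)
  simpa only [add_zero, zero_mul, Real.exp_zero, mul_one] using h1

/-- The error of the slow component. -/
theorem exists_slow_error [CompleteSpace X] [CompleteSpace Y] {T : ℝ} (hT : 0 < T) :
    ∃ C l : ℝ, 0 ≤ C ∧ 0 ≤ l ∧ ∀ ε ∈ Ioc (0 : ℝ) 1, ∀ ζ ∈ Ioo 0 P.ζ₀,
      0 < F.ωB - ζ⁻¹ * F.ωA - P.NF ζ →
      ∀ (u₀ : F.X₁) (v₀ v₀F : F.Y₁), F.YS.emb 1 v₀F = P.prF ζ (F.YS.emb 1 v₀) →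
      ∀ (u : ℝ → F.X₁) (v : ℝ → F.Y₁), F.IsStrictSolution ε T u₀ v₀ u v →
      ∀ (uζ : ℝ → F.X₁) (vζ : ℝ → F.Y₁), P.IsReducedSolution F ζ T v₀ uζ vζ →
      ∀ t ∈ Icc 0 T, ‖v t - vζ t‖ ≤ C * (‖v₀F‖ +
        (ε + 1 / (F.ωB - ζ⁻¹ * F.ωA - P.NF ζ) ^ F.δY) * ‖v₀‖ +
        ε ^ F.δY * ‖u₀ - F.h₀ (vζ 0)‖) * Real.exp (l * t) := by
  obtain ⟨Lh, hLh0, hLh⟩ := hF.exists_h₀_lipschitz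
  obtain ⟨Cv, hCv0, hCv⟩ := hP.exists_reduced_bound hF hT
  obtain ⟨Cu, hCu0, hCu⟩ := hP.exists_fast_error hF hT
  have hLg := hF.Lg_pos
  have hCB := hF.CB_pos
  have hPCB := hP.CB_pos
  have hδ := hF.δY_mem
  have hωf := hF.ωf_neg
  have hΓ := Real.Gamma_pos_of_pos hδ.1
  -- A slow error acts back on itself directly with factor `1` and through the fast component with
  -- factor `Cu`.
  obtain ⟨l, hl0, hlω, hl⟩ := exists_weight hδ.1 F.ωB (F.CB * F.Lg * (Cu + 1))
  set κ := Real.Gamma F.δY / (l - F.ωB) ^ F.δY with hκ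
  have hκ0 : 0 ≤ κ := div_nonneg hΓ.le (Real.rpow_nonneg (by linarith) _)
  set Cl := Real.exp (l * T) * (Real.exp 1 * Real.Gamma F.δY + 1 / (-F.ωf)) with hCl
  have hCl0 : 0 ≤ Cl := mul_nonneg (Real.exp_pos _).le (add_nonneg (by positivity)
    (div_nonneg zero_le_one (by linarith)))
  set M := max F.MB 1 with hM
  have hM0 : 0 ≤ M := zero_le_one.trans (le_max_right _ _)
  set C := M + F.CB * F.Lg * Cu * Cl + F.CB * F.Lg * Cu * κ +
    P.CB * (F.Lg * (Lh * Cv + Cv)) * Real.Gamma F.δY with hC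
  have hC0 : 0 ≤ C := by positivity
  refine ⟨C / (1 - 1 / 2), l, by positivity, hl0.le, ?_⟩
  intro ε hε ζ hζ hm u₀ v₀ v₀F hv₀F u v hs uζ vζ hr
  set m := F.ωB - ζ⁻¹ * F.ωA - P.NF ζ with hmdef
  have hε0 := hε.1
  set a₀ := ‖u₀ - F.h₀ (vζ 0)‖ with ha₀
  have ha₀0 : 0 ≤ a₀ := norm_nonneg _
  have hmδ : 0 < m ^ F.δY := Real.rpow_pos_of_pos hm _
  set R := ‖v₀F‖ + (ε + 1 / m ^ F.δY) * ‖v₀‖ + ε ^ F.δY * a₀ with hR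
  have hεδ : 0 < ε ^ F.δY := Real.rpow_pos_of_pos hε0 _
  have r1 : ‖v₀F‖ ≤ R := by
    have : 0 ≤ (ε + 1 / m ^ F.δY) * ‖v₀‖ + ε ^ F.δY * a₀ := by positivity
    rw [hR]; linarith
  have r2 : ε * ‖v₀‖ ≤ R := by
    have : 0 ≤ ‖v₀F‖ + 1 / m ^ F.δY * ‖v₀‖ + ε ^ F.δY * a₀ := by positivity
    rw [hR]; linarith
  have r3 : 1 / m ^ F.δY * ‖v₀‖ ≤ R := by
    have : 0 ≤ ‖v₀F‖ + ε * ‖v₀‖ + ε ^ F.δY * a₀ := by positivity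
    rw [hR]; linarith
  have r4 : ε ^ F.δY * a₀ ≤ R := by
    have : 0 ≤ ‖v₀F‖ + (ε + 1 / m ^ F.δY) * ‖v₀‖ := by positivity
    rw [hR]; linarith
  have hR0 : 0 ≤ R := (norm_nonneg _).trans r1
  clear_value R
  obtain ⟨ψ, hψ, hψL⟩ := hP.exists_prF_g_lift hζ hF
  have huh : ∀ s ∈ Icc 0 T, uζ s = F.h₀ (vζ s) := fun s hs' => hF.eq_h₀ (hr.u_eq s hs').symm
  have hu_le : ∀ s ∈ Icc 0 T, ‖uζ s‖ ≤ Lh * ‖vζ s‖ := fun s hs' => by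
    have := hLh (vζ s) 0
    rwa [hF.h₀_zero, sub_zero, sub_zero, ← huh s hs'] at this
  have hmem : ∀ s ∈ Icc 0 T, P.prS ζ (F.YS.emb 1 0) = 0 ∧ P.prF ζ (F.YS.emb 1 (vζ s)) = 0 :=
    fun s hs' => ⟨by simp, (hr.prF_eq s hs').symm⟩
  have hψc : ContinuousOn (fun s => ψ (uζ s) 0 (vζ s)) (Icc 0 T) :=
    System.Admissible.continuousOn_of_lipschitz hψL hmem hr.u_continuousOn continuousOn_const
      hr.v_continuousOn
  have hψe : ∀ s ∈ Icc 0 T, F.YS.emb F.δY (ψ (uζ s) 0 (vζ s)) = P.prF ζ (F.g₁ (uζ s) (vζ s)) ∧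
      ‖ψ (uζ s) 0 (vζ s)‖ ≤ F.Lg * (Lh * Cv + Cv) * ‖v₀‖ := by
    intro s hs'
    obtain ⟨h1, h2⟩ := hψ (uζ s) 0 (vζ s) (hmem s hs').1 (hmem s hs').2
    rw [zero_add] at h1
    rw [norm_zero, add_zero] at h2
    refine ⟨h1, h2.trans ?_⟩
    have h3 := hCv ζ hζ v₀ uζ vζ hr s hs'
    have h4 := (hu_le s hs').trans (mul_le_mul_of_nonneg_left h3 hLh0)
    rw [mul_assoc]
    refine mul_le_mul_of_nonneg_left ?_ hLg.le
    linarith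
  set x : ℝ → F.Y₁ := fun s => v s - vζ s with hx
  have hxc : ContinuousOn x (Icc 0 T) := hs.v_continuousOn.sub hr.v_continuousOn
  have hx0 : x 0 = v₀F := by
    apply F.YS.emb_injective zero_le_one
    simp only [hx, map_sub, hs.v_zero, hr.v_zero, hv₀F]
    rw [sub_eq_iff_eq_add, hP.prF_add_prS_apply hζ]
  -- The forcing `g(u,v) - pr_S g(u_ζ,v_ζ)` is the Lipschitz difference `w` plus the neglected `pr_F
  -- g(u_ζ,v_ζ)`, lifted by `ψ`. The latter lies in `Y_F` and profits from the decay there.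
  set w : ℝ → F.YS.space F.δY := fun s => F.g (u s) (v s) - F.g (F.h₀ (vζ s)) (vζ s) with hw
  have hhc : ContinuousOn (fun s => F.h₀ (vζ s)) (Icc 0 T) :=
    hr.u_continuousOn.congr fun s hs' => (huh s hs').symm
  have hwc : ContinuousOn w (Icc 0 T) :=
    (hF.continuousOn_g hs.u_continuousOn hs.v_continuousOn).sub
      (hF.continuousOn_g hhc hr.v_continuousOn)
  have key : ∀ η > 0, ∀ t ∈ Icc 0 T, ‖x t‖ ≤ C / (1 - 1 / 2) * ((R + η) * Real.exp (l * t)) := by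
    intro η hη
    refine le_of_self_improving hT.le hxc.norm (by fun_prop) (fun s _ => by positivity) hC0
      (by norm_num) ?_
    intro N hN hle t ht
    have hRη : 0 < R + η := by positivity
    have hsub : Icc 0 t ⊆ Icc 0 T := Icc_subset_Icc_right ht.2
    have hu := hCu ε hε ζ hζ u₀ v₀ u v hs uζ vζ hr (N * (R + η)) l (by positivity) hl0.le
      (fun s hs' => by have := hle s hs'; rwa [← mul_assoc] at this)
    have hmild := BanachScale.mild_formula (Sc := F.YS) hF.generator_B (a := 0) (b := t) (c := 1)
      ht.1 one_pos (x := x)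
      (h := fun s => F.YS.emb F.δY (w s) + F.YS.emb F.δY (ψ (uζ s) 0 (vζ s)))
      (hxc.mono hsub) (fun s hs' => by
        have hs'' : s ∈ Ioo 0 T := ⟨hs'.1, hs'.2.trans_le ht.2⟩
        have h1 := hasDerivAt_of_contDiffOn_Icc hs.v_contDiffOn hs''
        have h2 := hasDerivAt_of_contDiffOn_Icc hr.v_contDiffOn hs''
        rw [hs.v_eq s (Ioo_subset_Icc_self hs'')] at h1
        rw [hr.v_eq s (Ioo_subset_Icc_self hs'')] at h2
        have h3 := h1.fun_sub h2
        simp only [hx, map_sub]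
        convert h3 using 1
        rw [one_smul, (hψe s (Ioo_subset_Icc_self hs'')).1,
          eq_sub_of_add_eq (hP.prF_add_prS_apply hζ (F.g₁ (uζ s) (vζ s)))]
        simp only [hw, map_sub, ← huh s (Ioo_subset_Icc_self hs''), System.g₁]
        abel)
      (((F.YS.emb F.δY).continuous.comp_continuousOn (hwc.mono hsub)).add
        ((F.YS.emb F.δY).continuous.comp_continuousOn (hψc.mono hsub)))
    have hrt : ContinuousOn (fun s => 1 * (t - s)) (Icc 0 t) := by fun_prop
    have hrt0 : ∀ s ∈ Icc 0 t, 0 ≤ 1 * (t - s) := fun s hs' => by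
      rw [one_mul]; exact sub_nonneg.2 hs'.2
    have hi : ∀ {y : ℝ → F.YS.space F.δY}, ContinuousOn y (Icc 0 T) → IntervalIntegrable
        (fun s => F.expB.toFun (1 * (t - s)) (F.YS.emb F.δY (y s))) volume 0 t := by
      intro y hy
      apply ContinuousOn.intervalIntegrable
      rw [uIcc_of_le ht.1]
      exact F.expB.continuousOn_apply hrt hrt0
        ((F.YS.emb F.δY).continuous.comp_continuousOn (hy.mono hsub))
    simp only [map_add] at hmild
    rw [intervalIntegral.integral_add (hi hwc) (hi hψc), ← add_assoc] at hmild
    have hF2 := BanachScale.normLE_convolution_kern hF.generator_B ht.1 one_pos hδ.1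
      hPCB.le hF.expB_smoothing (V := {y | P.prS ζ (F.YS.emb F.δY y) = 0})
      (ω := P.NF ζ + ζ⁻¹ * F.ωA)
      (fun r hr' y hy => hP.decay_F ζ hζ r hr' y hy)
      (w := fun s => ψ (uζ s) 0 (vζ s))
      (B := fun s => (F.Lg * (Lh * Cv + Cv) * ‖v₀‖) * Real.exp (l * s)) (hψc.mono hsub)
      (by fun_prop)
      (fun s hs' => by
        have := (hψe s (hsub (Ioo_subset_Icc_self hs'))).1
        change P.prS ζ _ = 0
        rw [this, hP.prS_prF hζ])
      (fun s hs' => by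
        rw [one_mul]
        refine ((hψe s (hsub (Ioo_subset_Icc_self hs'))).2).trans ?_
        refine le_mul_of_one_le_right (by positivity) (Real.one_le_exp ?_)
        exact mul_nonneg hl0.le hs'.1.le)
    have hest := hF.slow_estimate (a := 0) (b := t) ht.1 (d := x) (w := w)
      (Bw := fun s => (F.Lg * (Cu * a₀)) * Real.exp (ε⁻¹ * F.ωf * s) +
        (F.Lg * (Cu * R + (Cu + 1) * (N * (R + η)))) * Real.exp (l * s))
      (hwc.mono hsub) (by fun_prop)
      (fun s hs' => by
        have hs'' := hsub (Ioo_subset_Icc_self hs')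
        refine (hF.g_lipschitz _ _ _ _).trans ?_
        have h1 := hu s hs''
        have h2 := hle s hs''
        have h3 : ‖v s - vζ s‖ ≤ N * ((R + η) * Real.exp (l * s)) := h2
        have h4 : 1 ≤ Real.exp (l * s) := Real.one_le_exp (mul_nonneg hl0.le hs'.1.le)
        have h5 : ε * ‖v₀‖ ≤ R * Real.exp (l * s) :=
          r2.trans (le_mul_of_one_le_right hR0 h4)
        have h6 : Cu * (a₀ * Real.exp (ε⁻¹ * F.ωf * s) + ε * ‖v₀‖ +
            N * (R + η) * Real.exp (l * s)) ≤ Cu * (a₀ * Real.exp (ε⁻¹ * F.ωf * s) +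
            R * Real.exp (l * s) + N * (R + η) * Real.exp (l * s)) := by gcongr
        calc F.Lg * (‖u s - F.h₀ (vζ s)‖ + ‖v s - vζ s‖) ≤
            F.Lg * (Cu * (a₀ * Real.exp (ε⁻¹ * F.ωf * s) +
            R * Real.exp (l * s) + N * (R + η) * Real.exp (l * s)) +
              N * ((R + η) * Real.exp (l * s))) := by
              gcongr
              exact h1.trans h6
          _ = _ := by ring)
      hF2 (by simpa only [one_mul] using hmild)
    rw [integral_kern_mul_add hδ.1 ht.1 (by fun_prop) (by fun_prop),
      integral_kern_mul_const_mul, integral_kern_mul_const_mul,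
      integral_kern_mul_const_mul] at hest
    have hk1 := integral_kern_layer_le (δ := F.δY) (ω := F.ωB) (lam := l) (ωf := F.ωf) (ε := ε)
      (T := T) hδ hlω.le hl0.le hωf hε0 ht.1 ht.2
    rw [← hCl] at hk1
    have hk2 := integral_kern_mul_exp_le' (c := 1) (ω := F.ωB) (μ := l) (p := l - F.ωB) one_pos
      hδ.1 (by linarith) (by simp [sub_eq_neg_add]) ht.1
    rw [← hκ] at hk2
    -- As `l > ω_B`, the net rate `l - (N_F + ζ⁻¹ω_A)` is at least `m`. This is the origin of
    -- `m^(-δ_Y)`.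
    have hk3 := integral_kern_mul_exp_le' (c := 1) (ω := P.NF ζ + ζ⁻¹ * F.ωA) (μ := l) (p := m)
      one_pos hδ.1 hm (by rw [div_one, hmdef]; linarith) ht.1
    have hE : 1 ≤ Real.exp (l * t) := Real.one_le_exp (mul_nonneg hl0.le ht.1)
    have he : Real.exp (F.ωB * (t - 0)) ≤ Real.exp (l * t) := by
      apply Real.exp_le_exp.2
      rw [sub_zero]
      exact mul_le_mul_of_nonneg_right hlω.le ht.1
    rw [hx0] at hest
    have e1 : M * Real.exp (F.ωB * (t - 0)) * ‖v₀F‖ ≤ M * (R * Real.exp (l * t)) := by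
      calc _ ≤ M * Real.exp (l * t) * R := by gcongr
        _ = _ := by ring
    have e2 : F.Lg * (Cu * a₀) *
        (∫ s in (0 : ℝ)..t, kern 1 F.δY F.ωB t s * Real.exp (ε⁻¹ * F.ωf * s)) ≤
        F.Lg * Cu * Cl * (R * Real.exp (l * t)) := by
      calc _ ≤ F.Lg * (Cu * a₀) * (Cl * ε ^ F.δY) := by gcongr
        _ = F.Lg * Cu * Cl * (ε ^ F.δY * a₀) := by ring
        _ ≤ F.Lg * Cu * Cl * (R * Real.exp (l * t)) :=
          mul_le_mul_of_nonneg_left (r4.trans (le_mul_of_one_le_right hR0 hE)) (by positivity)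
    have e3 : F.Lg * (Cu * R + (Cu + 1) * (N * (R + η))) *
        (∫ s in (0 : ℝ)..t, kern 1 F.δY F.ωB t s * Real.exp (l * s)) ≤
        F.Lg * (Cu * R + (Cu + 1) * (N * (R + η))) * (κ * Real.exp (l * t)) := by gcongr
    have e4 : F.Lg * (Lh * Cv + Cv) * ‖v₀‖ *
        (∫ s in (0 : ℝ)..t, kern 1 F.δY (P.NF ζ + ζ⁻¹ * F.ωA) t s * Real.exp (l * s)) ≤
        F.Lg * (Lh * Cv + Cv) * Real.Gamma F.δY * (R * Real.exp (l * t)) := by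
      calc _ ≤ F.Lg * (Lh * Cv + Cv) * ‖v₀‖ *
            (Real.Gamma F.δY / m ^ F.δY * Real.exp (l * t)) := by gcongr
        _ = F.Lg * (Lh * Cv + Cv) * Real.Gamma F.δY *
            ((1 / m ^ F.δY * ‖v₀‖) * Real.exp (l * t)) := by ring
        _ ≤ _ := by gcongr
    have e5 : F.CB * F.Lg * (Cu + 1) * κ * (N * (R + η) * Real.exp (l * t)) ≤
        1 / 2 * (N * (R + η) * Real.exp (l * t)) := by gcongr
    have e6 : C * (R * Real.exp (l * t)) ≤ C * ((R + η) * Real.exp (l * t)) := by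
      gcongr; linarith
    calc ‖x t‖ ≤ M * (R * Real.exp (l * t)) + F.CB * (F.Lg * Cu * Cl * (R * Real.exp (l * t)) +
            F.Lg * (Cu * R + (Cu + 1) * (N * (R + η))) * (κ * Real.exp (l * t))) +
            P.CB * (F.Lg * (Lh * Cv + Cv) * Real.Gamma F.δY * (R * Real.exp (l * t))) := by
          refine hest.trans (add_le_add (add_le_add e1 ?_) ?_)
          · exact mul_le_mul_of_nonneg_left (add_le_add e2 e3) hCB.le
          · exact mul_le_mul_of_nonneg_left e4 hPCB.le
      _ = C * (R * Real.exp (l * t)) +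
            F.CB * F.Lg * (Cu + 1) * κ * (N * (R + η) * Real.exp (l * t)) := by rw [hC]; ring
      _ ≤ C * ((R + η) * Real.exp (l * t)) + 1 / 2 * (N * (R + η) * Real.exp (l * t)) :=
          add_le_add e6 e5
      _ = _ := by ring
  intro t ht
  have hlim : Tendsto (fun η : ℝ => C / (1 - 1 / 2) * ((R + η) * Real.exp (l * t)))
      (𝓝[>] 0) (𝓝 (C / (1 - 1 / 2) * ((R + 0) * Real.exp (l * t)))) := by
    have : Continuous fun η : ℝ => C / (1 - 1 / 2) * ((R + η) * Real.exp (l * t)) := by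
      fun_prop
    exact (this.tendsto 0).mono_left nhdsWithin_le_nhds
  have h1 := ge_of_tendsto hlim (by
    filter_upwards [self_mem_nhdsWithin] with η hη using key η hη t ht)
  rwa [add_zero, ← mul_assoc] at h1

/-- The error of the reduced slow subsystem for arbitrary initial values. -/
theorem exists_error_bound [CompleteSpace X] [CompleteSpace Y] {T : ℝ} (hT : 0 < T) :
    ∃ C : ℝ, 0 < C ∧
      ∀ ε ∈ Ioc (0 : ℝ) 1, ∀ ζ ∈ Ioo 0 P.ζ₀, 0 < F.ωB - ζ⁻¹ * F.ωA - P.NF ζ →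
      ∀ (u₀ : F.X₁) (v₀ v₀F : F.Y₁), F.YS.emb 1 v₀F = P.prF ζ (F.YS.emb 1 v₀) →
      ∀ (u : ℝ → F.X₁) (v : ℝ → F.Y₁), F.IsStrictSolution ε T u₀ v₀ u v →
      ∀ (uζ : ℝ → F.X₁) (vζ : ℝ → F.Y₁), P.IsReducedSolution F ζ T v₀ uζ vζ →
      ∀ t ∈ Icc 0 T,
        ‖u t - F.h₀ (vζ t)‖ + ‖v t - vζ t‖ ≤
          C * (‖v₀F‖ +
            (ε + 1 / (F.ωB - ζ⁻¹ * F.ωA - P.NF ζ) ^ F.δY) * ‖v₀‖ +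
            (ε ^ F.δY + Real.exp (ε⁻¹ * F.ωf * t)) * ‖u₀ - F.h₀ v₀‖) := by
  obtain ⟨Lh, hLh0, hLh⟩ := hF.exists_h₀_lipschitz
  obtain ⟨Cu, hCu0, hCu⟩ := hP.exists_fast_error hF hT
  obtain ⟨Cs, l, hCs0, hl0, hCs⟩ := hP.exists_slow_error hF hT
  have hδ := hF.δY_mem
  refine ⟨Cu * (1 + Lh + 1) + (Cu + 1) * (Cs * (1 + Lh) * Real.exp (l * T)) + 1,
    by positivity, ?_⟩
  intro ε hε ζ hζ hm u₀ v₀ v₀F hv₀F u v hs uζ vζ hr t ht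
  set m := F.ωB - ζ⁻¹ * F.ωA - P.NF ζ with hmdef
  have hε0 := hε.1
  have hεδ : 0 < ε ^ F.δY := Real.rpow_pos_of_pos hε0 _
  have hεδ1 : ε ^ F.δY ≤ 1 := Real.rpow_le_one hε0.le hε.2 hδ.1.le
  have hmδ : 0 < m ^ F.δY := Real.rpow_pos_of_pos hm _
  set E := Real.exp (ε⁻¹ * F.ωf * t) with hE
  have hE0 : 0 < E := Real.exp_pos _
  have hE1 : E ≤ 1 := by
    apply Real.exp_le_one_iff.2
    have := mul_nonneg (inv_pos.2 hε0).le ht.1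
    nlinarith [hF.ωf_neg]
  set U := ‖u₀ - F.h₀ v₀‖ with hU
  have hU0 : 0 ≤ U := norm_nonneg _
  -- The reduced solution starts at `pr_S v₀`, so passing from `h⁰(v_ζ(0))` to `h⁰(v₀)` costs only
  -- `Lh ‖pr_F v₀‖`, which the final bound already contains.
  have ha₀ : ‖u₀ - F.h₀ (vζ 0)‖ ≤ U + Lh * ‖v₀F‖ := by
    have h1 : v₀ - vζ 0 = v₀F := by
      apply F.YS.emb_injective zero_le_one
      rw [map_sub, hr.v_zero, hv₀F, sub_eq_iff_eq_add, hP.prF_add_prS_apply hζ]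
    have h2 := hLh v₀ (vζ 0)
    rw [h1] at h2
    calc _ = ‖(u₀ - F.h₀ v₀) + (F.h₀ v₀ - F.h₀ (vζ 0))‖ := by congr 1; abel
      _ ≤ _ := (norm_add_le _ _).trans (by gcongr)
  set a₀ := ‖u₀ - F.h₀ (vζ 0)‖ with ha₀def
  have ha₀0 : 0 ≤ a₀ := norm_nonneg _
  set Q := (ε + 1 / m ^ F.δY) * ‖v₀‖ with hQ
  have hQ0 : 0 ≤ Q := by positivity
  have hεQ : ε * ‖v₀‖ ≤ Q := by
    have : 0 ≤ 1 / m ^ F.δY * ‖v₀‖ := by positivity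
    rw [hQ]; linarith
  set R := ‖v₀F‖ + Q + (ε ^ F.δY + E) * U with hR
  have hn := norm_nonneg v₀F
  have hR0 : 0 ≤ R := by positivity
  have hεU : 0 ≤ ε ^ F.δY * U := by positivity
  have hEU : 0 ≤ E * U := by positivity
  have r1 : a₀ * E ≤ (1 + Lh) * R := by
    have h1 : a₀ * E ≤ (U + Lh * ‖v₀F‖) * E := by gcongr
    have h2 : Lh * ‖v₀F‖ * E ≤ Lh * ‖v₀F‖ * 1 := by gcongr
    have h3 : ‖v₀F‖ ≤ R := by rw [hR]; linarith
    have h4 : U * E ≤ R := by rw [hR]; linarith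
    have h5 := mul_le_mul_of_nonneg_left h3 hLh0
    linarith
  have r2 : ‖v₀F‖ + Q + ε ^ F.δY * a₀ ≤ (1 + Lh) * R := by
    have h1 : ε ^ F.δY * a₀ ≤ ε ^ F.δY * (U + Lh * ‖v₀F‖) := by gcongr
    have h2 : ε ^ F.δY * (Lh * ‖v₀F‖) ≤ 1 * (Lh * ‖v₀F‖) := by gcongr
    have h3 : ‖v₀F‖ ≤ R := by rw [hR]; linarith
    have h4 : ‖v₀F‖ + Q + ε ^ F.δY * U ≤ R := by rw [hR]; linarith
    have h5 := mul_le_mul_of_nonneg_left h3 hLh0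
    linarith
  have r3 : ε * ‖v₀‖ ≤ R := by rw [hR]; linarith
  have hslow := hCs ε hε ζ hζ hm u₀ v₀ v₀F hv₀F u v hs uζ vζ hr
  have hfast := hCu ε hε ζ hζ u₀ v₀ u v hs uζ vζ hr
    (Cs * (‖v₀F‖ + Q + ε ^ F.δY * a₀)) l (by positivity) hl0 hslow t ht
  have hs2 := hslow t ht
  have hs3 : Cs * (‖v₀F‖ + Q + ε ^ F.δY * a₀) * Real.exp (l * t) ≤
      Cs * (1 + Lh) * Real.exp (l * T) * R := by
    calc _ ≤ Cs * ((1 + Lh) * R) * Real.exp (l * T) := by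
          have : l * t ≤ l * T := mul_le_mul_of_nonneg_left ht.2 hl0
          gcongr
      _ = _ := by ring
  have hf2 : ‖u t - F.h₀ (vζ t)‖ ≤ Cu * ((1 + Lh) * R + R +
      Cs * (1 + Lh) * Real.exp (l * T) * R) := hfast.trans (by gcongr)
  have hs4 := hs2.trans hs3
  nlinarith

end Splitting.Admissible

end FastSlow

/-! ### Fixed points of the Lyapunov-Perron operator -/

namespace FastSlow

/-- Letting `r → -∞` removes the contribution of the starting point from an estimate on `[r,t]`. -/
theorem le_of_forall_le_exp {x y K p t : ℝ} (hp : 0 < p)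
    (h : ∀ r ≤ t, x ≤ K * Real.exp (p * r) + y) : x ≤ y := by
  have h1 : Tendsto (fun r : ℝ => K * Real.exp (p * r) + y) atBot (𝓝 (K * 0 + y)) :=
    ((Real.tendsto_exp_atBot.comp (tendsto_id.const_mul_atBot hp)).const_mul K).add_const y
  rw [mul_zero, zero_add] at h1
  exact ge_of_tendsto h1 (by filter_upwards [Iic_mem_atBot t] with r hr using h r hr)

/-- Restarting a semigroup convolution over `(-∞, t]` at the time `r`. -/
theorem C0Semigroup.integral_Iic_restart {X : Type u} [NormedAddCommGroup X] [NormedSpace ℝ X]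
    [CompleteSpace X] (S : C0Semigroup X) {G : ℝ → X} {c r t : ℝ} (hc : 0 ≤ c) (hrt : r ≤ t)
    (hr : IntegrableOn (fun s => S.toFun (c * (r - s)) (G s)) (Iic r))
    (ht : IntegrableOn (fun s => S.toFun (c * (t - s)) (G s)) (Iic t)) :
    ∫ s in Iic t, S.toFun (c * (t - s)) (G s) =
      S.toFun (c * (t - r)) (∫ s in Iic r, S.toFun (c * (r - s)) (G s)) +
        ∫ s in r..t, S.toFun (c * (t - s)) (G s) := by
  rw [← intervalIntegral.integral_Iic_sub_Iic (ht.mono_set (Iic_subset_Iic.2 hrt)) ht,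
    ← ContinuousLinearMap.integral_comp_comm _ hr]
  have h1 : ∫ s in Iic r, S.toFun (c * (t - s)) (G s) =
      ∫ s in Iic r, S.toFun (c * (t - r)) (S.toFun (c * (r - s)) (G s)) := by
    refine setIntegral_congr_fun measurableSet_Iic fun s hs => ?_
    have hs : s ≤ r := hs
    rw [← S.apply_add (mul_nonneg hc (sub_nonneg.2 hrt)) (mul_nonneg hc (sub_nonneg.2 hs))]
    congr 2; ring
  rw [h1]; abel

namespace Splitting

variable {X Y : Type u} [NormedAddCommGroup X] [NormedSpace ℝ X]
  [NormedAddCommGroup Y] [NormedSpace ℝ Y] {F : System X Y} {P : Splitting Y}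

/-- The exponent of the weighted space in which the Lyapunov-Perron operator acts. -/
noncomputable def rate (P : Splitting Y) (F : System X Y) (ζ : ℝ) : ℝ :=
  ζ⁻¹ * F.ωA + (P.NS ζ + P.NF ζ) / 2

/-- Half of the spectral gap. -/
noncomputable def halfGap (P : Splitting Y) (ζ : ℝ) : ℝ := (P.NS ζ - P.NF ζ) / 2

namespace Admissible

variable (hP : P.Admissible F) {ζ : ℝ} (hζ : ζ ∈ Ioo 0 P.ζ₀)

include hP hζ

theorem halfGap_pos : 0 < P.halfGap ζ := by
  have := hP.NF_lt_NS ζ hζ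
  unfold halfGap; linarith

theorem prS_eq_self {y : Y} (h : P.prF ζ y = 0) : P.prS ζ y = y := by
  have := hP.prF_add_prS_apply hζ y
  rwa [h, zero_add] at this

theorem prF_eq_self {y : Y} (h : P.prS ζ y = 0) : P.prF ζ y = y := by
  have := hP.prF_add_prS_apply hζ y
  rwa [h, add_zero] at this

theorem group_zero (y : Y) : P.group ζ 0 y = P.prS ζ y := by
  rw [hP.group_of_nonneg ζ hζ 0 le_rfl, F.expB.map_zero]; rfl

theorem group_add_apply (s t : ℝ) (y : Y) : P.group ζ (s + t) y = P.group ζ s (P.group ζ t y) := by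
  rw [hP.group_add ζ hζ]; rfl

theorem group_nonneg_apply {t : ℝ} (ht : 0 ≤ t) {y : Y} (hy : P.prF ζ y = 0) :
    P.group ζ t y = F.expB.toFun t y := by
  rw [hP.group_of_nonneg ζ hζ t ht, ContinuousLinearMap.comp_apply, hP.prS_eq_self hζ hy]

theorem prF_group (t : ℝ) (y : Y) : P.prF ζ (P.group ζ t y) = 0 := by
  have h := hP.group_add_apply hζ 0 t y
  rw [zero_add, hP.group_zero hζ] at h
  rw [h, hP.prF_prS hζ]

/-- Joint strong continuity of the group. -/
theorem group_tendsto_apply [CompleteSpace Y] {ι : Type*} {l : Filter ι} {r : ι → ℝ} {y : ι → Y}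
    {r₀ : ℝ} {y₀ : Y} (hr : Tendsto r l (𝓝 r₀)) (hy : Tendsto y l (𝓝 y₀)) :
    Tendsto (fun a => P.group ζ (r a) (y a)) l (𝓝 (P.group ζ r₀ y₀)) := by
  -- Pulling out the group at time `r₀ - 1` leaves nonnegative times near `r₀`, where the group is
  -- the semigroup and its joint continuity applies.
  have heq : ∀ r' z, 0 ≤ r' - (r₀ - 1) →
      P.group ζ r' z = P.group ζ (r₀ - 1) (F.expB.toFun (r' - (r₀ - 1)) (P.prS ζ z)) := by
    intro r' z h
    rw [← ContinuousLinearMap.comp_apply (F.expB.toFun _), ← hP.group_of_nonneg ζ hζ _ h,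
      ← hP.group_add_apply hζ, add_sub_cancel]
  have hr' := hr.sub_const (r₀ - 1)
  have hev : ∀ᶠ a in l, 0 ≤ r a - (r₀ - 1) :=
    (hr'.eventually (lt_mem_nhds (by linarith))).mono fun _ h => le_of_lt h
  have h1 := ((P.group ζ (r₀ - 1)).continuous.tendsto _).comp
    (F.expB.tendsto_apply hr' hev (by linarith) (((P.prS ζ).continuous.tendsto _).comp hy))
  rw [← heq r₀ y₀ (by linarith)] at h1
  refine h1.congr' ?_
  filter_upwards [hev] with a ha
  exact (heq _ _ ha).symm

theorem group_continuousOn_apply [CompleteSpace Y] {s : Set ℝ} {r : ℝ → ℝ} {y : ℝ → Y}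
    (hr : ContinuousOn r s) (hy : ContinuousOn y s) :
    ContinuousOn (fun a => P.group ζ (r a) (y a)) s :=
  fun a ha => hP.group_tendsto_apply hζ (hr a ha) (hy a ha)

/-- The element of `Y_1` that represents `pr_F y` is `0`, hence so is its image under `B`, which is
`pr_F B y`. -/
theorem prF_gen {y : F.Y₁} (hy : P.prF ζ (F.YS.emb 1 y) = 0) : P.prF ζ (F.YS.gen y) = 0 := by
  obtain ⟨y', h1, h2⟩ := hP.commute ζ hζ y
  rw [hy] at h1
  have : y' = 0 := F.YS.emb_injective zero_le_one (by rw [h1, map_zero])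
  rw [← h2, this, map_zero]

theorem hasDerivAt_group [CompleteSpace Y] (hF : F.Admissible) {y : F.Y₁}
    (hy : P.prF ζ (F.YS.emb 1 y) = 0) (t : ℝ) :
    HasDerivAt (fun t => P.group ζ t (F.YS.emb 1 y)) (P.group ζ t (F.YS.gen y)) t := by
  have heq : ∀ t' z, P.prF ζ z = 0 → 0 ≤ t' - (t - 1) →
      P.group ζ t' z = P.group ζ (t - 1) (F.expB.toFun (t' - (t - 1)) z) := by
    intro t' z hz h
    rw [← hP.group_nonneg_apply hζ h hz, ← hP.group_add_apply hζ, add_sub_cancel]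
  have h1 : HasDerivAt (fun t' : ℝ => t' - (t - 1)) 1 t := (hasDerivAt_id t).sub_const _
  have h2 := (BanachScale.hasDerivAt_semigroup hF.generator_B y
    (show 0 < t - (t - 1) by linarith)).scomp t h1
  have h3 := (P.group ζ (t - 1)).hasFDerivAt.comp_hasDerivAt t h2
  rw [one_smul, ← heq t _ (hP.prF_gen hζ hy) (by linarith)] at h3
  refine h3.congr_of_eventuallyEq ?_
  filter_upwards [Ioi_mem_nhds (show t - 1 < t by linarith)] with t' ht'
  exact heq t' _ hy (sub_nonneg.2 (le_of_lt ht'))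

/-- The inverse semigroup on `Y_S` leaves `Y_1` invariant and commutes with `B`. -/
theorem exists_group_emb (hF : F.Admissible) {y : F.Y₁} (hy : P.prF ζ (F.YS.emb 1 y) = 0)
    {t : ℝ} (ht : 0 ≤ t) :
    ∃ z : F.Y₁, F.YS.emb 1 z = P.group ζ (-t) (F.YS.emb 1 y) ∧
      F.YS.gen z = P.group ζ (-t) (F.YS.gen y) ∧
      ‖z‖ ≤ P.MB * Real.exp (-(P.NS ζ + ζ⁻¹ * F.ωA) * t) * ‖y‖ := by
  obtain ⟨z, hz, hzn⟩ := hP.growth_S ζ hζ t ht y hy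
  refine ⟨z, hz, ?_, hzn⟩
  have hzF : P.prF ζ (F.YS.emb 1 z) = 0 := by rw [hz, hP.prF_group hζ]
  -- Flowing `z` forward returns `y`. The commutation of `e^{tB}` with `B` at `z` is then inverted
  -- by the group.
  obtain ⟨y', h1, h2⟩ := BanachScale.exists_semigroup_emb (Sc := F.YS) hF.generator_B z ht
  have hyy : y' = y := by
    apply F.YS.emb_injective zero_le_one
    rw [h1, ← hP.group_nonneg_apply hζ ht hzF, hz, ← hP.group_add_apply hζ, add_neg_cancel,
      hP.group_zero hζ, hP.prS_eq_self hζ hy]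
  rw [← hyy, h2, ← hP.group_nonneg_apply hζ ht (hP.prF_gen hζ hzF), ← hP.group_add_apply hζ,
    neg_add_cancel, hP.group_zero hζ, hP.prS_eq_self hζ (hP.prF_gen hζ hzF)]

/-- `pr_S g` lifted to a Lipschitz map into `Y_1`. -/
theorem exists_prS_g_lift_one (hF : F.Admissible) :
    ∃ χ : F.X₁ → F.Y₁ → F.Y₁ → F.Y₁,
    (∀ x yF yS, P.prS ζ (F.YS.emb 1 yF) = 0 → P.prF ζ (F.YS.emb 1 yS) = 0 →
      F.YS.emb 1 (χ x yF yS) = P.prS ζ (F.g₁ x (yF + yS)) ∧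
      ‖χ x yF yS‖ ≤ F.Lg * ζ ^ (F.δY - 1) * (‖x‖ + ‖yF‖ + ‖yS‖)) ∧
    ∀ x yF yS x' yF' yS', (P.prS ζ (F.YS.emb 1 yF) = 0 ∧ P.prF ζ (F.YS.emb 1 yS) = 0) →
      (P.prS ζ (F.YS.emb 1 yF') = 0 ∧ P.prF ζ (F.YS.emb 1 yS') = 0) →
      ‖χ x yF yS - χ x' yF' yS'‖ ≤
        F.Lg * ζ ^ (F.δY - 1) * (‖x - x'‖ + ‖yF - yF'‖ + ‖yS - yS'‖) := by
  have h : ∀ x yF yS, ∃ w : F.Y₁, P.prS ζ (F.YS.emb 1 yF) = 0 →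
      P.prF ζ (F.YS.emb 1 yS) = 0 → F.YS.emb 1 w = P.prS ζ (F.g₁ x (yF + yS)) ∧
      ‖w‖ ≤ F.Lg * ζ ^ (F.δY - 1) * (‖x‖ + ‖yF‖ + ‖yS‖) := by
    intro x yF yS
    by_cases h1 : P.prS ζ (F.YS.emb 1 yF) = 0
    · by_cases h2 : P.prF ζ (F.YS.emb 1 yS) = 0
      · obtain ⟨w, hw, hw'⟩ := hP.prS_g ζ hζ x 0 yF 0 yS 0 h1 (by simp) h2 (by simp)
        simp only [add_zero, hF.g₁_zero, sub_zero] at hw hw'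
        exact ⟨w, fun _ _ => ⟨hw, hw'⟩⟩
      · exact ⟨0, fun _ h => absurd h h2⟩
    · exact ⟨0, fun h => absurd h h1⟩
  choose χ hχ using h
  refine ⟨χ, hχ, fun x yF yS x' yF' yS' h1 h2 => ?_⟩
  have := hP.prS_g ζ hζ x x' yF yF' yS yS' h1.1 h2.1 h1.2 h2.2
  rwa [map_sub, ← (hχ x yF yS h1.1 h1.2).1, ← (hχ x' yF' yS' h2.1 h2.2).1, ← map_sub,
    F.YS.normLE_emb_iff zero_le_one] at this

end Admissible

namespace IsLyapunovPerron

variable {ε ζ : ℝ} {w : F.Y₁} {u : ℝ → F.X₁} {vF vS : ℝ → F.Y₁}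
  (hL : P.IsLyapunovPerron F ε ζ w u vF vS) (hP : P.Admissible F) (hF : F.Admissible)
  (hζ : ζ ∈ Ioo 0 P.ζ₀)

include hL

theorem mem {t : ℝ} (ht : t ≤ 0) :
    P.prS ζ (F.YS.emb 1 (vF t)) = 0 ∧ P.prF ζ (F.YS.emb 1 (vS t)) = 0 :=
  ⟨hL.vF_mem t ht, hL.vS_mem t ht⟩

/-- The integral over `(-∞,t]` becomes a starting value plus a finite integral, the form required by
`fast_estimate`. -/
theorem u_restart [CompleteSpace X] (hε : 0 < ε) {r t : ℝ} (hrt : r ≤ t) (ht : t ≤ 0) :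
    F.XS.emb 1 (u t) = F.expA.toFun (ε⁻¹ * (t - r)) (F.XS.emb 1 (u r)) +
      ∫ s in r..t, F.expA.toFun (ε⁻¹ * (t - s)) (ε⁻¹ • F.f₁ (u s) (vF s + vS s)) := by
  rw [hL.u_eq t ht, F.expA.integral_Iic_restart (inv_pos.2 hε).le hrt
    (hL.u_integrable r (hrt.trans ht)) (hL.u_integrable t ht), smul_add, ← map_smul,
    ← hL.u_eq r (hrt.trans ht), ← intervalIntegral.integral_smul]
  simp only [map_smul]

theorem vF_restart [CompleteSpace Y] {r t : ℝ} (hrt : r ≤ t) (ht : t ≤ 0) :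
    F.YS.emb 1 (vF t) = F.expB.toFun (1 * (t - r)) (F.YS.emb 1 (vF r)) +
      ∫ s in r..t, F.expB.toFun (1 * (t - s)) (P.prF ζ (F.g₁ (u s) (vF s + vS s))) := by
  have h1 := hL.vF_integrable r (hrt.trans ht)
  have h2 := hL.vF_integrable t ht
  have h3 := F.expB.integral_Iic_restart (c := 1) zero_le_one hrt (by simpa only [one_mul] using h1)
    (by simpa only [one_mul] using h2)
  simp only [one_mul] at h3 ⊢
  rw [hL.vF_eq t ht, h3, ← hL.vF_eq r (hrt.trans ht)]

include hF in
-- On `[r,t]` the starting term is of order `e^(p r/ε)` with `p = -ω_A + ε η`, and it vanishes as `r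
-- → -∞`. The convolution has net rate `p` in fast time. The resulting factor is the first term of
-- the gap condition.
theorem norm_u_le [CompleteSpace X] (hε : 0 < ε) (hp : 0 < -F.ωA + ε * P.rate F ζ) {N : ℝ}
    (hN : ∀ t ≤ 0, ‖u t‖ + ‖vF t‖ + ‖vS t‖ ≤ N * Real.exp (P.rate F ζ * t)) {t : ℝ}
    (ht : t ≤ 0) :
    ‖u t‖ ≤ F.Lf * F.CA * Real.Gamma F.γX / (-F.ωA + ε * P.rate F ζ) ^ F.γX * N *
      Real.exp (P.rate F ζ * t) := by
  obtain ⟨Φ, hΦ, hΦ0, hΦL⟩ := hF.exists_fγ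
  have hLf := hF.Lf_pos
  have hCA := hF.CA_pos
  set η := P.rate F ζ with hη
  set p := -F.ωA + ε * η with hpdef
  have hεi := inv_pos.2 hε
  have hN0 : 0 ≤ N := by
    have := hN 0 le_rfl
    simp only [mul_zero, Real.exp_zero, mul_one] at this
    linarith [norm_nonneg (u 0), norm_nonneg (vF 0), norm_nonneg (vS 0)]
  have hM0 : 0 ≤ max F.MA 1 := zero_le_one.trans (le_max_right _ _)
  refine le_of_forall_le_exp (K := max F.MA 1 * Real.exp (ε⁻¹ * F.ωA * t) * N) (p := ε⁻¹ * p)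
    (t := t) (by positivity) fun r hr => ?_
  have hsub : Icc r t ⊆ Iic 0 := fun s hs => hs.2.trans ht
  have hwc : ContinuousOn (fun s => Φ (u s) (vF s + vS s)) (Icc r t) := by
    refine System.Admissible.continuousOn_of_lipschitz (G := fun x y z => Φ x (y + z))
      (p := fun _ _ _ => True) (L := F.Lf)
      (fun x y z x' y' z' _ _ => (hΦL _ _ _ _).trans (mul_le_mul_of_nonneg_left ?_ hLf.le))
      (fun _ _ => trivial) (hL.u_continuousOn.mono hsub) (hL.vF_continuousOn.mono hsub)
      (hL.vS_continuousOn.mono hsub)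
    have := norm_add_le (y - y') (z - z')
    rw [show y - y' + (z - z') = y + z - (y' + z') by abel] at this
    linarith
  have hest := hF.fast_estimate (a := r) (b := t) (c := ε⁻¹) hr hεi (d := u)
    (w := fun s => Φ (u s) (vF s + vS s)) (e := fun _ => 0)
    (Bw := fun s => (F.Lf * N) * Real.exp (η * s)) (Be := fun _ => 0) hwc continuousOn_const
    (by fun_prop) continuousOn_const (fun s hs => by
      have h1 := hΦL (u s) (vF s + vS s) 0 0
      rw [hΦ0, sub_zero, sub_zero, sub_zero] at h1
      refine h1.trans ?_
      rw [mul_assoc]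
      refine mul_le_mul_of_nonneg_left ?_ hLf.le
      have := hN s (hsub (Ioo_subset_Icc_self hs))
      linarith [norm_add_le (vF s) (vS s)]) (fun _ _ => by simp)
    (by simpa only [hΦ, map_zero, sub_zero] using hL.u_restart hε hr ht)
  rw [integral_kern_mul_const_mul] at hest
  simp only [mul_zero, intervalIntegral.integral_zero, add_zero] at hest
  have hk := integral_kern_mul_exp_le' (c := ε⁻¹) (ω := F.ωA) (μ := η) (p := p) hεi
    hF.γX_mem.1 hp (by rw [div_inv_eq_mul, mul_comm η]) hr
  have hur : ‖u r‖ ≤ N * Real.exp (η * r) := by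
    linarith [hN r (hr.trans ht), norm_nonneg (vF r), norm_nonneg (vS r)]
  have hexp : Real.exp (F.ωA * (ε⁻¹ * (t - r))) * Real.exp (η * r) =
      Real.exp (ε⁻¹ * F.ωA * t) * Real.exp (ε⁻¹ * p * r) := by
    rw [← Real.exp_add, ← Real.exp_add]
    congr 1
    rw [hpdef]; field_simp; ring
  refine hest.trans (add_le_add ?_ ?_)
  · calc _ ≤ max F.MA 1 * Real.exp (F.ωA * (ε⁻¹ * (t - r))) * (N * Real.exp (η * r)) := by gcongr
      _ = max F.MA 1 * N * (Real.exp (F.ωA * (ε⁻¹ * (t - r))) * Real.exp (η * r)) := by ring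
      _ = _ := by rw [hexp]; ring
  · calc _ ≤ F.CA * (F.Lf * N * (Real.Gamma F.γX / p ^ F.γX * Real.exp (η * t))) := by gcongr
      _ = _ := by ring

include hP hF hζ in
-- The weight exponent exceeds the growth exponent on `Y_F` by exactly half the gap. The resulting
-- factor also shows that the slow manifold is close to `Y_S` in its `v_F` component when the gap is
-- large.
theorem norm_vF_le [CompleteSpace Y] {N : ℝ}
    (hN : ∀ t ≤ 0, ‖u t‖ + ‖vF t‖ + ‖vS t‖ ≤ N * Real.exp (P.rate F ζ * t)) {t : ℝ}
    (ht : t ≤ 0) :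
    ‖vF t‖ ≤ F.Lg * P.CB * Real.Gamma F.δY / P.halfGap ζ ^ F.δY * N *
      Real.exp (P.rate F ζ * t) := by
  obtain ⟨ψ, hψ, hψL⟩ := hP.exists_prF_g_lift hζ hF
  have hLg := hF.Lg_pos
  have hCB := hP.CB_pos
  have hδ := hF.δY_mem
  have hh := hP.halfGap_pos hζ
  set h := P.halfGap ζ with hhdef
  set η := P.rate F ζ with hη
  set ν := P.NF ζ + ζ⁻¹ * F.ωA with hν
  have hην : η = ν + h := by rw [hη, hν, hhdef, rate, halfGap]; ring
  have hN0 : 0 ≤ N := by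
    have := hN 0 le_rfl
    simp only [mul_zero, Real.exp_zero, mul_one] at this
    linarith [norm_nonneg (u 0), norm_nonneg (vF 0), norm_nonneg (vS 0)]
  set J := ‖F.YS.incl 1 F.δY‖ with hJ
  -- The decay on `Y_F` carries the singular factor `(t-r)^(δ_Y-1)`; for `r ≤ t - 1` it is at most
  -- 1.
  refine le_of_forall_le_exp (K := P.CB * Real.exp (ν * t) * (J * N)) (p := h)
    (t := t - 1) hh fun r hr => ?_
  have hrt : r ≤ t := by linarith
  have hsub : Icc r t ⊆ Iic 0 := fun s hs => hs.2.trans ht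
  have hwc : ContinuousOn (fun s => ψ (u s) (vF s) (vS s)) (Icc r t) :=
    System.Admissible.continuousOn_of_lipschitz hψL (fun s hs => hL.mem (hsub hs))
      (hL.u_continuousOn.mono hsub) (hL.vF_continuousOn.mono hsub) (hL.vS_continuousOn.mono hsub)
  have hψe := fun s (hs : s ≤ 0) => hψ (u s) (vF s) (vS s) (hL.mem hs).1 (hL.mem hs).2
  have h1 := hP.decay_F ζ hζ (t - r) (by linarith) (F.YS.incl 1 F.δY (vF r))
    (by rw [F.YS.emb_incl hδ.1.le hδ.2]; exact hL.vF_mem r (hrt.trans ht))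
  rw [F.YS.emb_incl hδ.1.le hδ.2, ← hν] at h1
  have h2 := BanachScale.normLE_convolution_kern hF.generator_B hrt one_pos hδ.1
    hCB.le hF.expB_smoothing (V := {y | P.prS ζ (F.YS.emb F.δY y) = 0}) (ω := ν)
    (fun r hr' y hy => hP.decay_F ζ hζ r hr' y hy)
    (w := fun s => ψ (u s) (vF s) (vS s)) (B := fun s => (F.Lg * N) * Real.exp (η * s)) hwc
    (by fun_prop)
    (fun s hs => by
      change P.prS ζ _ = 0
      rw [(hψe s (hsub (Ioo_subset_Icc_self hs))).1, hP.prS_prF hζ])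
    (fun s hs => by
      have hs' := hsub (Ioo_subset_Icc_self hs)
      rw [one_mul, mul_assoc]
      exact (hψe s hs').2.trans (mul_le_mul_of_nonneg_left (hN s hs') hLg.le))
  have hint : ∫ s in r..t, F.expB.toFun (1 * (t - s)) (F.YS.emb F.δY (ψ (u s) (vF s) (vS s))) =
      ∫ s in r..t, F.expB.toFun (1 * (t - s)) (P.prF ζ (F.g₁ (u s) (vF s + vS s))) := by
    refine intervalIntegral.integral_congr fun s hs => ?_
    rw [uIcc_of_le hrt] at hs
    simp only [(hψe s (hsub hs)).1]
  have h3 := h1.add h2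
  have h4 := hL.vF_restart hrt ht
  rw [one_mul (t - r)] at h4
  rw [hint, ← h4, F.YS.normLE_emb_iff zero_le_one, integral_kern_mul_const_mul] at h3
  have hk := integral_kern_mul_exp_le' (c := 1) (ω := ν) (μ := η) (p := h) one_pos hδ.1 hh
    (by rw [div_one, hην]; linarith) hrt
  have hvr : ‖vF r‖ ≤ N * Real.exp (η * r) := by
    linarith [hN r (hrt.trans ht), norm_nonneg (u r), norm_nonneg (vS r)]
  have hpow : (t - r) ^ (F.δY - 1) ≤ 1 :=
    Real.rpow_le_one_of_one_le_of_nonpos (by linarith) (by linarith [hδ.2])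
  have hexp : Real.exp (ν * (t - r)) * Real.exp (η * r) = Real.exp (ν * t) * Real.exp (h * r) := by
    rw [← Real.exp_add, ← Real.exp_add]
    congr 1
    rw [hην]; ring
  refine h3.trans (add_le_add ?_ ?_)
  · have hi : ‖F.YS.incl 1 F.δY (vF r)‖ ≤ J * (N * Real.exp (η * r)) :=
      ((F.YS.incl 1 F.δY).le_opNorm _).trans (mul_le_mul_of_nonneg_left hvr (norm_nonneg _))
    have hpow0 : 0 ≤ (t - r) ^ (F.δY - 1) := Real.rpow_nonneg (by linarith) _
    calc _ ≤ P.CB * 1 * Real.exp (ν * (t - r)) * (J * (N * Real.exp (η * r))) := by gcongr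
      _ = P.CB * J * N * (Real.exp (ν * (t - r)) * Real.exp (η * r)) := by ring
      _ = _ := by rw [hexp]; ring
  · calc _ ≤ P.CB * (F.Lg * N * (Real.Gamma F.δY / h ^ F.δY * Real.exp (η * t))) := by gcongr
      _ = _ := by ring

include hP hF hζ in
-- Backwards from `0` the group decays faster than the weight, by half the gap `h`. The factor `1 -
-- e^(ht)` is not estimated by 1: with it, the bracket is a convex combination of the contribution
-- of `w` and that of `g`, which `exists_trajectory_bound` exploits.
theorem norm_vS_le [CompleteSpace Y] {N : ℝ} (hw : P.prF ζ (F.YS.emb 1 w) = 0)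
    (hN : ∀ t ≤ 0, ‖u t‖ + ‖vF t‖ + ‖vS t‖ ≤ N * Real.exp (P.rate F ζ * t)) {t : ℝ}
    (ht : t ≤ 0) :
    ‖vS t‖ ≤ (P.MB * ‖w‖ * Real.exp (P.halfGap ζ * t) +
      P.MB * F.Lg * ζ ^ (F.δY - 1) / P.halfGap ζ * N * (1 - Real.exp (P.halfGap ζ * t))) *
      Real.exp (P.rate F ζ * t) := by
  obtain ⟨χ, hχ, hχL⟩ := hP.exists_prS_g_lift_one hζ hF
  have hLg := hF.Lg_pos
  have hMB := hP.MB_pos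
  have hh := hP.halfGap_pos hζ
  set h := P.halfGap ζ with hhdef
  set η := P.rate F ζ with hη
  have hηh : P.NS ζ + ζ⁻¹ * F.ωA = η + h := by rw [hη, hhdef, rate, halfGap]; ring
  have hζ0 : 0 < ζ ^ (F.δY - 1) := Real.rpow_pos_of_pos hζ.1 _
  have hsub : Icc t 0 ⊆ Iic 0 := fun s hs => hs.2
  have hχe := fun s (hs : s ≤ 0) => hχ (u s) (vF s) (vS s) (hL.mem hs).1 (hL.mem hs).2
  set y : ℝ → F.Y₁ := fun s => χ (u s) (vF s) (vS s) with hy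
  have hyc : ContinuousOn y (Icc t 0) :=
    System.Admissible.continuousOn_of_lipschitz hχL (fun s hs => hL.mem (hsub hs))
      (hL.u_continuousOn.mono hsub) (hL.vF_continuousOn.mono hsub) (hL.vS_continuousOn.mono hsub)
  have hyS : ∀ s ≤ 0, P.prF ζ (F.YS.emb 1 (y s)) = 0 := fun s hs => by
    rw [(hχe s hs).1, hP.prF_prS hζ]
  have hφ : ∀ s ∈ Icc t 0, ∃ z : F.Y₁, F.YS.emb 1 z = P.group ζ (t - s) (F.YS.emb 1 (y s)) ∧
      F.YS.gen z = P.group ζ (t - s) (F.YS.gen (y s)) ∧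
      ‖z‖ ≤ P.MB * Real.exp (-(η + h) * (s - t)) * ‖y s‖ := by
    intro s hs
    have := hP.exists_group_emb hζ hF (hyS s hs.2) (sub_nonneg.2 hs.1)
    rwa [neg_sub, hηh] at this
  choose! φ hφ1 hφ2 hφ3 using hφ
  have hrc : ContinuousOn (fun s => t - s) (Icc t 0) := by fun_prop
  have hφc : ContinuousOn φ (Icc t 0) := by
    intro s hs
    apply F.YS.tendsto_of_emb_gen
    · rw [hφ1 s hs]
      refine (hP.group_continuousOn_apply hζ hrc
        ((F.YS.emb 1).continuous.comp_continuousOn hyc) s hs).tendsto.congr' ?_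
      filter_upwards [self_mem_nhdsWithin] with s hs using (hφ1 s hs).symm
    · rw [hφ2 s hs]
      refine (hP.group_continuousOn_apply hζ hrc
        (F.YS.gen.continuous.comp_continuousOn hyc) s hs).tendsto.congr' ?_
      filter_upwards [self_mem_nhdsWithin] with s hs using (hφ2 s hs).symm
  have hint := BanachScale.normLE_intervalIntegral (Sc := F.YS) ht
    (F := fun s => P.group ζ (t - s) (P.prS ζ (F.g₁ (u s) (vF s + vS s))))
    (B := fun s => P.MB * F.Lg * ζ ^ (F.δY - 1) * N * Real.exp (η * t) * Real.exp (-h * (s - t)))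
    (hφc.mono Ioo_subset_Icc_self)
    (fun s hs => by
      rw [hφ1 s (Ioo_subset_Icc_self hs), (hχe s hs.2.le).1])
    (by apply Continuous.intervalIntegrable; fun_prop)
    (fun s hs => by
      have hs' := Ioo_subset_Icc_self hs
      have hexp : Real.exp (-(η + h) * (s - t)) * Real.exp (η * s) =
          Real.exp (η * t) * Real.exp (-h * (s - t)) := by
        rw [← Real.exp_add, ← Real.exp_add]
        congr 1; ring
      have h1 : ‖y s‖ ≤ F.Lg * ζ ^ (F.δY - 1) * (N * Real.exp (η * s)) :=
        (hχe s hs.2.le).2.trans (mul_le_mul_of_nonneg_left (hN s hs.2.le) (by positivity))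
      calc ‖φ s‖ ≤ P.MB * Real.exp (-(η + h) * (s - t)) *
            (F.Lg * ζ ^ (F.δY - 1) * (N * Real.exp (η * s))) := (hφ3 s hs').trans (by gcongr)
        _ = P.MB * F.Lg * ζ ^ (F.δY - 1) * N *
            (Real.exp (-(η + h) * (s - t)) * Real.exp (η * s)) := by ring
        _ = _ := by rw [hexp]; ring)
  have hI : ∫ s in t..0, Real.exp (-h * (s - t)) = (1 - Real.exp (h * t)) / h := by
    rw [intervalIntegral.integral_comp_sub_right (fun s => Real.exp (-h * s)),
      intervalIntegral.integral_comp_mul_left _ (neg_ne_zero.2 hh.ne'), integral_exp, sub_self,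
      mul_zero, Real.exp_zero, smul_eq_mul, zero_sub, neg_mul_neg]
    have := hh.ne'
    field_simp; ring
  rw [intervalIntegral.integral_const_mul, hI] at hint
  have h0 := hP.growth_S ζ hζ (-t) (neg_nonneg.2 ht) w hw
  rw [neg_neg, hηh] at h0
  have h1 := h0.add hint.neg
  rw [← intervalIntegral.integral_symm, ← hL.vS_eq t ht, F.YS.normLE_emb_iff zero_le_one] at h1
  refine h1.trans (le_of_eq ?_)
  have hexp : Real.exp (-(η + h) * -t) = Real.exp (h * t) * Real.exp (η * t) := by
    rw [← Real.exp_add]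
    congr 1; ring
  rw [hexp]; ring

end IsLyapunovPerron

end Splitting

end FastSlow

/-! ### Uniform bounds on the slow manifold and its distance to the critical manifold -/

namespace FastSlow

variable {X Y : Type u} [NormedAddCommGroup X] [NormedSpace ℝ X]
  [NormedAddCommGroup Y] [NormedSpace ℝ Y] {F : System X Y} {P : Splitting Y}

namespace Splitting

/-- The rate of the fast semigroup in the weighted space is uniformly large enough for a uniform
contraction. -/
theorem Admissible.exists_contraction (hP : P.Admissible F) (hF : F.Admissible) {c : ℝ}
    (hc : c ∈ Ioo (0 : ℝ) 1) : ∃ p₀ : ℝ, 0 < p₀ ∧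
      F.Lf * F.CA * Real.Gamma F.γX / p₀ ^ F.γX < 1 ∧
      ∀ ε > 0, ∀ ζ ∈ Ioo 0 P.ζ₀,
        ε < c * ζ * (((F.Lf * F.CA * Real.Gamma F.γX) ^ (1 / F.γX) + F.ωA) / F.ωA) →
        p₀ ≤ -F.ωA + ε * P.rate F ζ := by
  have hLf := hF.Lf_pos
  have hCA := hF.CA_pos
  have hγ := hF.γX_mem
  have hΓ := Real.Gamma_pos_of_pos hγ.1
  have hωA := hF.ωA_neg
  have hωf := hF.ωf_neg
  obtain ⟨hAf, hq⟩ := hF.exists_rate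
  set L := F.Lf * F.CA * Real.Gamma F.γX with hL
  have hL0 : 0 < L := by positivity
  set a := L ^ (1 / F.γX) with ha
  have ha0 : 0 < a := Real.rpow_pos_of_pos hL0 _
  have haγ : a ^ F.γX = L := by
    rw [ha, ← Real.rpow_mul hL0.le, one_div_mul_cancel hγ.1.ne', Real.rpow_one]
  have hd : 0 < F.ωf - F.ωA := by linarith
  have h1 : L < (F.ωf - F.ωA) ^ F.γX := by
    rw [← mul_div_assoc, div_lt_one (Real.rpow_pos_of_pos hd _)] at hq
    rw [hL]; linarith
  have h2 : a < F.ωf - F.ωA := by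
    rw [← haγ] at h1
    exact (Real.rpow_lt_rpow_iff ha0.le hd.le hγ.1).1 h1
  have ha1 : a < -F.ωA := by linarith
  have hc0 := hc.1
  have hc1 : 0 < 1 - c := by linarith [hc.2]
  have hlt : a < (1 - c) * -F.ωA + c * a := by nlinarith
  have hp0 : 0 < (1 - c) * -F.ωA + c * a := ha0.trans hlt
  -- At rate `a` the fast factor is exactly 1, and `a < -ω_A` because `ωf < 0`. The condition on `ε`
  -- says `ε ζ⁻¹ ω_A > c (a + ω_A)`, so `-ω_A + ε η` is at least this convex combination. It exceeds
  -- `a` since `c < 1`.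
  refine ⟨(1 - c) * -F.ωA + c * a, hp0, ?_, fun ε hε ζ hζ hlt' => ?_⟩
  · rw [div_lt_one (Real.rpow_pos_of_pos hp0 _), ← haγ]
    exact Real.rpow_lt_rpow ha0.le hlt hγ.1
  · have h3 : ε * ζ⁻¹ < c * ((a + F.ωA) / F.ωA) := by
      rw [← div_eq_mul_inv, div_lt_iff₀ hζ.1]
      linarith
    have h4 := mul_lt_mul_of_neg_right h3 hωA
    rw [mul_assoc c, div_mul_cancel₀ _ hωA.ne] at h4
    have h5 : 0 ≤ ε * ((P.NS ζ + P.NF ζ) / 2) := by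
      have := hP.NF_nonneg ζ hζ
      have := hP.NF_lt_NS ζ hζ
      exact mul_nonneg hε.le (by linarith)
    have h6 : ε * P.rate F ζ = ε * ζ⁻¹ * F.ωA + ε * ((P.NS ζ + P.NF ζ) / 2) := by
      rw [rate]; ring
    rw [h6]; linarith

/-- In terms of `p` and the half gap the powers of 2 cancel, and `Γ(δ_Y) ≥ 1` is dropped from the
last term. The summands are then the factors of `norm_u_le`, `norm_vF_le` and `norm_vS_le`. -/
theorem GapCondition.sum_lt_one (hP : P.Admissible F) (hF : F.Admissible) {ε ζ : ℝ}
    (hζ : ζ ∈ Ioo 0 P.ζ₀) (hp : 0 < -F.ωA + ε * P.rate F ζ) (h : P.GapCondition F ε ζ) :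
    F.Lf * F.CA * Real.Gamma F.γX / (-F.ωA + ε * P.rate F ζ) ^ F.γX +
      F.Lg * P.CB * Real.Gamma F.δY / P.halfGap ζ ^ F.δY +
      P.MB * F.Lg * ζ ^ (F.δY - 1) / P.halfGap ζ < 1 := by
  have hh := hP.halfGap_pos hζ
  have hMB := hP.MB_pos
  have hLg := hF.Lg_pos
  have hζ0 : 0 < ζ ^ (F.δY - 1) := Real.rpow_pos_of_pos hζ.1 _
  unfold GapCondition at h
  set p := -F.ωA + ε * P.rate F ζ with hpdef
  have e1 : 2 * (ε * ζ⁻¹ - 1) * F.ωA + ε * (P.NS ζ + P.NF ζ) = 2 * p := by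
    rw [hpdef, rate]; ring
  have e2 : P.NS ζ - P.NF ζ = 2 * P.halfGap ζ := by rw [halfGap]; ring
  rw [e1, e2, Real.mul_rpow zero_le_two hp.le, Real.mul_rpow zero_le_two hh.le] at h
  have t1 : 2 ^ F.γX * F.Lf * F.CA * Real.Gamma F.γX / (2 ^ F.γX * p ^ F.γX) =
      F.Lf * F.CA * Real.Gamma F.γX / p ^ F.γX := by
    have : (2 : ℝ) ^ F.γX ≠ 0 := (Real.rpow_pos_of_pos two_pos _).ne'
    rw [mul_assoc, mul_assoc, mul_div_mul_left _ _ this, mul_assoc]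
  have t2 : 2 ^ F.δY * F.Lg * P.CB * Real.Gamma F.δY / (2 ^ F.δY * P.halfGap ζ ^ F.δY) =
      F.Lg * P.CB * Real.Gamma F.δY / P.halfGap ζ ^ F.δY := by
    have : (2 : ℝ) ^ F.δY ≠ 0 := (Real.rpow_pos_of_pos two_pos _).ne'
    rw [mul_assoc, mul_assoc, mul_div_mul_left _ _ this, mul_assoc]
  have t3 : P.MB * F.Lg * ζ ^ (F.δY - 1) / P.halfGap ζ ≤
      2 * ζ ^ (F.δY - 1) * F.Lg * P.MB * Real.Gamma F.δY / (2 * P.halfGap ζ) := by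
    have : 2 * ζ ^ (F.δY - 1) * F.Lg * P.MB * Real.Gamma F.δY / (2 * P.halfGap ζ) =
        P.MB * F.Lg * ζ ^ (F.δY - 1) / P.halfGap ζ * Real.Gamma F.δY := by
      have := hh.ne'
      field_simp
    rw [this]
    exact le_mul_of_one_le_right (by positivity) (one_le_Gamma hF.δY_mem)
  rw [t1, t2] at h
  linarith

namespace Admissible

variable (hP : P.Admissible F) (hF : F.Admissible)

include hP hF

/-- The fixed points of the Lyapunov-Perron operator are bounded in the weighted space by a
uniform multiple of `w`. -/
theorem exists_trajectory_bound [CompleteSpace X] [CompleteSpace Y] {p₀ : ℝ} (hp₀ : 0 < p₀)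
    (hq : F.Lf * F.CA * Real.Gamma F.γX / p₀ ^ F.γX < 1) : ∃ C : ℝ, 0 ≤ C ∧
      ∀ ε > 0, ∀ ζ ∈ Ioo 0 P.ζ₀, p₀ ≤ -F.ωA + ε * P.rate F ζ → P.GapCondition F ε ζ →
      ∀ (w : F.Y₁) (u : ℝ → F.X₁) (vF vS : ℝ → F.Y₁), P.prF ζ (F.YS.emb 1 w) = 0 →
      P.IsLyapunovPerron F ε ζ w u vF vS → ∀ t ≤ 0,
        ‖u t‖ + ‖vF t‖ + ‖vS t‖ ≤ C * ‖w‖ * Real.exp (P.rate F ζ * t) := by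
  have hLf := hF.Lf_pos
  have hLg := hF.Lg_pos
  have hCA := hF.CA_pos
  have hCB := hP.CB_pos
  have hMB := hP.MB_pos
  have hγ := hF.γX_mem
  have hδ := hF.δY_mem
  have hΓ := Real.Gamma_pos_of_pos hγ.1
  have hΓ' := Real.Gamma_pos_of_pos hδ.1
  set qb := F.Lf * F.CA * Real.Gamma F.γX / p₀ ^ F.γX with hqb
  set e := 1 - qb with he
  have he0 : 0 < e := by linarith
  obtain ⟨H, hH0, hH⟩ : ∃ H : ℝ, 0 < H ∧ ∀ h, H ≤ h →
      F.Lg * P.CB * Real.Gamma F.δY / h ^ F.δY ≤ e / 4 := by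
    have h1 : Tendsto (fun h : ℝ => F.Lg * P.CB * Real.Gamma F.δY / h ^ F.δY) atTop (𝓝 0) :=
      tendsto_const_nhds.div_atTop (tendsto_rpow_atTop hδ.1)
    obtain ⟨H, hH⟩ := eventually_atTop.1 (h1.eventually (gt_mem_nhds (show 0 < e / 4 by linarith)))
    exact ⟨max H 1, lt_max_of_lt_right one_pos, fun h hh => (hH h ((le_max_left _ _).trans hh)).le⟩
  have hζ₀ := Real.rpow_pos_of_pos hP.ζ₀_pos (F.δY - 1)
  -- A threshold for the factor `q₃` of `v_S`. If `q₃ < k`, then `q₃ ≤ e/4`, and since `ζ^(δ_Y-1) ≥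
  -- ζ₀^(δ_Y-1)` the half gap is at least `H`, so that the factor of `v_F` is at most `e/4` too.
  set k := min (e / 4) (P.MB * F.Lg * P.ζ₀ ^ (F.δY - 1) / H) with hk
  have hk0 : 0 < k := lt_min (by linarith) (by positivity)
  refine ⟨P.MB / k + P.MB / (e / 2), by positivity, ?_⟩
  intro ε hε ζ hζ hp hgap w u vF vS hw hL
  have hp0 := hp₀.trans_le hp
  have hsum := hgap.sum_lt_one hP hF hζ hp0
  have hh := hP.halfGap_pos hζ
  have hζp : 0 < ζ ^ (F.δY - 1) := Real.rpow_pos_of_pos hζ.1 _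
  set p := -F.ωA + ε * P.rate F ζ with hpdef
  set η := P.rate F ζ with hη
  set h := P.halfGap ζ with hhdef
  set q₁ := F.Lf * F.CA * Real.Gamma F.γX / p ^ F.γX with hq₁
  set q₂ := F.Lg * P.CB * Real.Gamma F.δY / h ^ F.δY with hq₂
  set q₃ := P.MB * F.Lg * ζ ^ (F.δY - 1) / h with hq₃
  have hq₁0 : 0 ≤ q₁ := by positivity
  have hq₂0 : 0 ≤ q₂ := by positivity
  have hq₃0 : 0 < q₃ := by positivity
  have hq₁b : q₁ ≤ qb := by
    have : p₀ ^ F.γX ≤ p ^ F.γX := Real.rpow_le_rpow hp₀.le hp hγ.1.le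
    rw [hq₁, hqb]; gcongr
  set σ : ℝ → ℝ := fun t => (‖u t‖ + ‖vF t‖ + ‖vS t‖) * Real.exp (-(η * t)) with hσ
  have hσiff : ∀ t N, σ t ≤ N ↔ ‖u t‖ + ‖vF t‖ + ‖vS t‖ ≤ N * Real.exp (η * t) := by
    intro t N
    simp only [hσ]
    rw [Real.exp_neg, ← div_eq_mul_inv, div_le_iff₀ (Real.exp_pos _)]
  have hbdd : BddAbove (σ '' Iic 0) := by
    obtain ⟨M, hM⟩ := hL.bounded
    exact ⟨M, by rintro _ ⟨t, ht, rfl⟩; exact (hσiff t M).2 (hM t ht)⟩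
  set S := sSup (σ '' Iic 0) with hS
  have hσS : ∀ t ≤ 0, σ t ≤ S := fun t ht => le_csSup hbdd ⟨t, ht, rfl⟩
  have hS0 : 0 ≤ S := le_trans (by positivity) (hσS 0 le_rfl)
  have hSle : ∀ M, (∀ t ≤ 0, σ t ≤ M) → S ≤ M := fun M hM =>
    csSup_le ⟨_, mem_image_of_mem σ (mem_Iic.2 le_rfl)⟩ (by rintro _ ⟨t, ht, rfl⟩; exact hM t ht)
  have hN : ∀ t ≤ 0, ‖u t‖ + ‖vF t‖ + ‖vS t‖ ≤ S * Real.exp (η * t) := fun t ht =>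
    (hσiff t S).1 (hσS t ht)
  have hmain : ∀ t ≤ 0, σ t ≤ (q₁ + q₂) * S +
      (P.MB * ‖w‖ * Real.exp (h * t) + q₃ * S * (1 - Real.exp (h * t))) := by
    intro t ht
    rw [hσiff]
    have h1 := hL.norm_u_le hF hε hp0 hN ht
    have h2 := hL.norm_vF_le hP hF hζ hN ht
    have h3 := hL.norm_vS_le hP hF hζ hw hN ht
    linarith
  have hex : ∀ t ≤ 0, 0 < Real.exp (h * t) ∧ Real.exp (h * t) ≤ 1 := fun t ht =>
    ⟨Real.exp_pos _, Real.exp_le_one_iff.2 (mul_nonpos_of_nonneg_of_nonpos hh.le ht)⟩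
  have hw0 : 0 ≤ P.MB * ‖w‖ := by positivity
  -- Otherwise the convex combination in `hmain` is at most `q₃ S`, so `S ≤ (q₁ + q₂ + q₃) S` with a
  -- factor below 1 and `S ≤ 0`, a contradiction. No margin in the gap condition is used.
  have hA : q₃ * S ≤ P.MB * ‖w‖ := by
    by_contra! hcon
    have h1 : S ≤ (q₁ + q₂ + q₃) * S := hSle _ fun t ht => by
      have h2 := hmain t ht
      have h3 := mul_nonneg (hex t ht).1.le (sub_nonneg.2 hcon.le)
      linarith
    have h2 : S ≤ 0 := by nlinarith
    have h3 : q₃ * S ≤ 0 := mul_nonpos_of_nonneg_of_nonpos hq₃0.le h2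
    linarith
  have hB : S ≤ (q₁ + q₂ + q₃) * S + P.MB * ‖w‖ := hSle _ fun t ht => by
    have h2 := hmain t ht
    have h3 := mul_nonneg hw0 (sub_nonneg.2 (hex t ht).2)
    have h4 := mul_nonneg (mul_nonneg hq₃0.le hS0) (hex t ht).1.le
    linarith
  have hfin : S ≤ (P.MB / k + P.MB / (e / 2)) * ‖w‖ := by
    have k1 : 0 ≤ P.MB / k * ‖w‖ := by positivity
    have k2 : 0 ≤ P.MB / (e / 2) * ‖w‖ := by positivity
    -- For `q₃ ≥ k`, `hA` bounds `S` directly. For `q₃ < k` the three factors sum to at most `1 -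
    -- e/2`, and `hB` closes with a uniform margin.
    rcases le_or_gt k q₃ with hk3 | hk3
    · have : S ≤ P.MB / k * ‖w‖ := by
        rw [div_mul_eq_mul_div, le_div_iff₀ hk0]
        have := mul_le_mul_of_nonneg_right hk3 hS0
        linarith
      linarith
    · have h1 : q₃ ≤ e / 4 := hk3.le.trans (min_le_left _ _)
      have h2 : H ≤ h := by
        have h3 : q₃ ≤ P.MB * F.Lg * P.ζ₀ ^ (F.δY - 1) / H := hk3.le.trans (min_le_right _ _)
        have h4 : P.ζ₀ ^ (F.δY - 1) ≤ ζ ^ (F.δY - 1) :=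
          Real.rpow_le_rpow_of_nonpos hζ.1 hζ.2.le (by linarith [hδ.2])
        have h5 : P.MB * F.Lg * ζ ^ (F.δY - 1) / h ≤ P.MB * F.Lg * ζ ^ (F.δY - 1) / H :=
          h3.trans (by gcongr)
        exact (div_le_div_iff_of_pos_left (by positivity) hh hH0).1 h5
      have h3 : q₂ ≤ e / 4 := hH h h2
      have h4 : (q₁ + q₂ + q₃) * S ≤ (1 - e / 2) * S :=
        mul_le_mul_of_nonneg_right (by rw [he]; linarith) hS0
      have : S ≤ P.MB / (e / 2) * ‖w‖ := by
        rw [div_mul_eq_mul_div, le_div_iff₀ (by linarith)]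
        linarith
      linarith
  intro t ht
  exact (hN t ht).trans (mul_le_mul_of_nonneg_right hfin (Real.exp_pos _).le)

end Admissible

namespace IsLyapunovPerron

variable {ε ζ : ℝ} {w : F.Y₁} {u : ℝ → F.X₁} {vF vS : ℝ → F.Y₁}
  (hL : P.IsLyapunovPerron F ε ζ w u vF vS) (hP : P.Admissible F) (hF : F.Admissible)
  (hζ : ζ ∈ Ioo 0 P.ζ₀)

include hL hP hF hζ

/-- The component `v_S` of the fixed point is a strict solution of its differential equation. -/
theorem hasDerivWithinAt_vS [CompleteSpace Y] {s : ℝ} (hs : s ≤ 0) :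
    HasDerivWithinAt (fun t => F.YS.emb 1 (vS t))
      (F.YS.gen (vS s) + P.prS ζ (F.g₁ (u s) (vF s + vS s))) (Iic 0) s := by
  obtain ⟨θ, hθ, hθL⟩ := hP.exists_prS_g_lift hζ hF
  set G : ℝ → Y := fun s => P.prS ζ (F.g₁ (u s) (vF s + vS s)) with hG
  have hGc : ContinuousOn G (Iic 0) := by
    have h1 : ContinuousOn (fun s => F.YS.emb F.δY (θ (u s) (vF s) (vS s))) (Iic 0) :=
      (F.YS.emb F.δY).continuous.comp_continuousOn
        (System.Admissible.continuousOn_of_lipschitz hθL (fun s hs => hL.mem hs)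
          hL.u_continuousOn hL.vF_continuousOn hL.vS_continuousOn)
    exact h1.congr fun s hs => ((hθ _ _ _ (hL.mem hs).1 (hL.mem hs).2).1).symm
  -- Freezing the forcing at its value at `0` for positive times makes it continuous on the line, so
  -- two-sided derivatives exist even at `s = 0`.
  set G' : ℝ → Y := fun s => G (min s 0) with hG'
  have hG'c : Continuous G' := by
    rw [← continuousOn_univ]
    exact hGc.comp (by fun_prop) fun s _ => mem_Iic.2 (min_le_right s 0)
  have hG'e : ∀ s ≤ 0, G' s = G s := fun s hs => by simp only [hG', min_eq_left hs]
  have hGS : ∀ s, P.prS ζ (G' s) = G' s := fun s => by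
    apply hP.prS_eq_self hζ
    simp only [hG', hG, hP.prF_prS hζ]
  have hIc : Continuous fun σ => P.group ζ (-σ) (G' σ) := by
    rw [← continuousOn_univ]
    exact hP.group_continuousOn_apply hζ (by fun_prop) hG'c.continuousOn
  set y : ℝ → Y := fun t => P.group ζ 0 (F.YS.emb 1 w) + ∫ σ in (0 : ℝ)..t, P.group ζ (-σ) (G' σ)
    with hy
  have hyd : HasDerivAt y (P.group ζ (-s) (G' s)) s :=
    (intervalIntegral.integral_hasDerivAt_right (hIc.intervalIntegrable _ _)
      hIc.aestronglyMeasurable.stronglyMeasurableAtFilter hIc.continuousAt).const_add _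
  have hVy : ∀ t ≤ 0, P.group ζ t (y t) = F.YS.emb 1 (vS t) := by
    intro t ht
    rw [hL.vS_eq t ht]
    simp only [hy, map_add]
    rw [← hP.group_add_apply hζ, add_zero,
      ← ContinuousLinearMap.intervalIntegral_comp_comm _ (hIc.intervalIntegrable _ _)]
    congr 1
    refine intervalIntegral.integral_congr fun σ hσ => ?_
    rw [uIcc_of_ge ht] at hσ
    rw [← hP.group_add_apply hζ, ← sub_eq_add_neg, hG'e σ hσ.2]
  -- The product rule for `v_S(t) = e^{tB} y(t)`, again on difference quotients because the group is
  -- only strongly continuous.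
  have hd : HasDerivAt (fun t => P.group ζ t (y t)) (F.YS.gen (vS s) + G' s) s := by
    have hvS := (hL.mem hs).2
    have h1 := hasDerivAt_iff_tendsto_slope.1 hyd
    have hid : Tendsto (fun t : ℝ => t) (𝓝[≠] s) (𝓝 s) := tendsto_id.mono_left nhdsWithin_le_nhds
    have h2 := hP.group_tendsto_apply hζ hid h1
    rw [← hP.group_add_apply hζ, add_neg_cancel, hP.group_zero hζ, hGS] at h2
    have h3 : HasDerivAt (fun t => P.group ζ (t - s) (F.YS.emb 1 (vS s))) (F.YS.gen (vS s)) s := by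
      have h4 : HasDerivAt (fun t : ℝ => t - s) 1 s := (hasDerivAt_id s).sub_const s
      have h5 := HasDerivAt.scomp (h := fun t : ℝ => t - s) s
        (hP.hasDerivAt_group hζ hF hvS (s - s)) h4
      rwa [one_smul, sub_self, hP.group_zero hζ, hP.prS_eq_self hζ (hP.prF_gen hζ hvS)] at h5
    have h4 := hasDerivAt_iff_tendsto_slope.1 h3
    rw [hasDerivAt_iff_tendsto_slope]
    refine ((h4.add h2).congr fun t => ?_)
    simp only [slope, vsub_eq_sub, map_smul, map_sub]
    rw [← smul_add]
    congr 1
    rw [← hVy s hs, ← hP.group_add_apply hζ, ← hP.group_add_apply hζ, sub_add_cancel, sub_self,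
      zero_add]
    abel
  rw [hG'e s hs] at hd
  exact hd.hasDerivWithinAt.congr (fun t ht => (hVy t ht).symm) (hVy s hs).symm

end IsLyapunovPerron

namespace Admissible

variable (hP : P.Admissible F) (hF : F.Admissible)

include hP hF

/-- Along a fixed point of the Lyapunov-Perron operator, `h⁰(v_S)` is continuously differentiable
in `X_{δ_X}`, with a uniform bound in the weighted space. -/
theorem exists_deriv_h₀_vS [CompleteSpace X] [CompleteSpace Y] : ∃ C : ℝ, 0 ≤ C ∧
    ∀ (ε : ℝ), ∀ ζ ∈ Ioo 0 P.ζ₀, ∀ (w : F.Y₁) (u : ℝ → F.X₁) (vF vS : ℝ → F.Y₁),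
    P.IsLyapunovPerron F ε ζ w u vF vS → ∀ N : ℝ, 0 ≤ N →
    (∀ t ≤ 0, ‖u t‖ + ‖vF t‖ + ‖vS t‖ ≤ N * Real.exp (P.rate F ζ * t)) →
    ∀ r t : ℝ, r < t → t ≤ 0 → ∃ d : ℝ → F.XS.space F.δX, ContinuousOn d (Icc r t) ∧
      (∀ s ∈ Ioo r t, HasDerivAt (fun s => F.XS.incl 1 F.δX (F.h₀ (vS s))) (d s) s) ∧
      ∀ s ∈ Ioo r t, ‖d s‖ ≤ C * N * Real.exp (P.rate F ζ * s) := by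
  obtain ⟨Ch, hCh0, hCh⟩ := hF.exists_deriv_h₀
  have hLg := hF.Lg_pos
  set m := ‖F.YS.gen‖ + ‖F.YS.emb F.δY‖ * (2 * F.Lg) with hm
  refine ⟨Ch * (‖F.YS.emb 1‖ + m) * Real.exp 1, by positivity, ?_⟩
  intro ε ζ hζ w u vF vS hL N hN0 hN r t hrt ht
  obtain ⟨θ, hθ, hθL⟩ := hP.exists_prS_g_lift hζ hF
  set η := P.rate F ζ with hη
  have hθe := fun s (hs : s ≤ 0) => hθ (u s) (vF s) (vS s) (hL.mem hs).1 (hL.mem hs).2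
  set z' : ℝ → Y := fun s => F.YS.gen (vS s) + F.YS.emb F.δY (θ (u s) (vF s) (vS s)) with hz'
  have hz'c : ContinuousOn z' (Iic 0) :=
    (F.YS.gen.continuous.comp_continuousOn hL.vS_continuousOn).add
      ((F.YS.emb F.δY).continuous.comp_continuousOn
        (System.Admissible.continuousOn_of_lipschitz hθL (fun s hs => hL.mem hs)
          hL.u_continuousOn hL.vF_continuousOn hL.vS_continuousOn))
  have hz'd : ∀ s ≤ 0, HasDerivWithinAt (fun t => F.YS.emb 1 (vS t)) (z' s) (Iic 0) s := by
    intro s hs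
    have := hL.hasDerivWithinAt_vS hP hF hζ hs
    rwa [← (hθe s hs).1] at this
  have hIc : ∀ a b : ℝ, b ≤ 0 → Icc a b ⊆ Iic 0 := fun a b hb s hs => hs.2.trans hb
  have happ : ∀ a b : ℝ, a < b → b ≤ 0 → _ := fun a b hab hb =>
    hCh a b hab vS z' (hL.vS_continuousOn.mono (hIc a b hb))
      (fun s hs => (hz'd s (hIc a b hb hs)).mono (hIc a b hb)) (hz'c.mono (hIc a b hb))
  have hvS : ∀ s ≤ 0, ‖F.YS.emb 1 (vS s)‖ ≤ ‖F.YS.emb 1‖ * (N * Real.exp (η * s)) := fun s hs =>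
    ((F.YS.emb 1).le_opNorm _).trans (mul_le_mul_of_nonneg_left
      (by linarith [hN s hs, norm_nonneg (u s), norm_nonneg (vF s)]) (norm_nonneg _))
  have hz'n : ∀ s ≤ 0, ‖z' s‖ ≤ m * (N * Real.exp (η * s)) := by
    intro s hs
    have h1 : ‖vS s‖ ≤ N * Real.exp (η * s) := by
      linarith [hN s hs, norm_nonneg (u s), norm_nonneg (vF s)]
    have h2 : ‖θ (u s) (vF s) (vS s)‖ ≤ 2 * F.Lg * (N * Real.exp (η * s)) :=
      (hθe s hs).2.trans (mul_le_mul_of_nonneg_left (hN s hs) (by positivity))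
    calc ‖z' s‖ ≤ ‖F.YS.gen‖ * ‖vS s‖ + ‖F.YS.emb F.δY‖ * ‖θ (u s) (vF s) (vS s)‖ :=
          (norm_add_le _ _).trans
            (add_le_add (F.YS.gen.le_opNorm _) ((F.YS.emb F.δY).le_opNorm _))
      _ ≤ ‖F.YS.gen‖ * (N * Real.exp (η * s)) +
          ‖F.YS.emb F.δY‖ * (2 * F.Lg * (N * Real.exp (η * s))) := by gcongr
      _ = _ := by rw [hm]; ring
  obtain ⟨d, hdc, hd, -⟩ := happ r t hrt ht
  refine ⟨d, hdc, hd, fun s hs => ?_⟩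
  -- The available bound on `d` involves suprema over the whole interval and would lose the weight
  -- on `[r,t]`. It is applied on a window of radius `τ` around `s` with `|η| τ ≤ 1`, where the
  -- weight changes by a factor of at most `e`. Uniqueness of derivatives identifies the two values.
  obtain ⟨τ, hτ0, hτ1, hτ2, hτ3⟩ : ∃ τ > 0, r ≤ s - τ ∧ s + τ ≤ t ∧ |η| * τ ≤ 1 := by
    refine ⟨min (min (s - r) (t - s)) (1 / (|η| + 1)), ?_, ?_, ?_, ?_⟩
    · have h1 := sub_pos.2 hs.1
      have h2 := sub_pos.2 hs.2
      exact lt_min (lt_min h1 h2) (by positivity)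
    · have := (min_le_left (min (s - r) (t - s)) (1 / (|η| + 1))).trans (min_le_left _ _)
      linarith
    · have := (min_le_left (min (s - r) (t - s)) (1 / (|η| + 1))).trans (min_le_right _ _)
      linarith
    · have h1 := min_le_right (min (s - r) (t - s)) (1 / (|η| + 1))
      refine (mul_le_mul_of_nonneg_left h1 (abs_nonneg _)).trans ?_
      rw [mul_one_div, div_le_one (by positivity)]
      linarith
  have hst : s + τ ≤ 0 := hτ2.trans ht
  obtain ⟨d', -, hd', hd'n⟩ := happ (s - τ) (s + τ) (by linarith) hst
  have hmem : s ∈ Ioo (s - τ) (s + τ) := ⟨by linarith, by linarith⟩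
  have hdd : d s = d' s := (hd s hs).unique (hd' s hmem)
  have hexp : ∀ s' ∈ Icc (s - τ) (s + τ), Real.exp (η * s') ≤ Real.exp 1 * Real.exp (η * s) := by
    intro s' hs'
    rw [← Real.exp_add]
    apply Real.exp_le_exp.2
    have h1 : |s' - s| ≤ τ := abs_le.2 ⟨by linarith [hs'.1], by linarith [hs'.2]⟩
    have h2 : η * (s' - s) ≤ |η| * τ := (le_abs_self _).trans (by rw [abs_mul]; gcongr)
    linarith
  rw [hdd]
  refine (hd'n (‖F.YS.emb 1‖ * (N * (Real.exp 1 * Real.exp (η * s))))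
    (m * (N * (Real.exp 1 * Real.exp (η * s))))
    (fun s' hs' => (hvS s' (hs'.2.trans hst)).trans ?_)
    (fun s' hs' => (hz'n s' (hs'.2.trans hst)).trans ?_) s
    (Ioo_subset_Icc_self hmem)).trans (le_of_eq (by ring))
  · have := hexp s' hs'; gcongr
  · have := hexp s' hs'
    have hm0 : 0 ≤ m := by positivity
    gcongr

/-- On the slow manifold the fast component is close to the critical manifold. -/
theorem exists_distance_bound [CompleteSpace X] [CompleteSpace Y] {p₀ : ℝ} (hp₀ : 0 < p₀)
    (hq : F.Lf * F.CA * Real.Gamma F.γX / p₀ ^ F.γX < 1) : ∃ C : ℝ, 0 ≤ C ∧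
      ∀ ε > 0, ∀ ζ ∈ Ioo 0 P.ζ₀, p₀ ≤ -F.ωA + ε * P.rate F ζ →
      ∀ (w : F.Y₁) (u : ℝ → F.X₁) (vF vS : ℝ → F.Y₁),
      P.IsLyapunovPerron F ε ζ w u vF vS → ∀ N : ℝ, 0 ≤ N →
      (∀ t ≤ 0, ‖u t‖ + ‖vF t‖ + ‖vS t‖ ≤ N * Real.exp (P.rate F ζ * t)) →
        ‖u 0 - F.h₀ (vS 0)‖ ≤ C * (ε + 1 / P.halfGap ζ ^ F.δY) * N := by
  obtain ⟨Lh, hLh0, hLh⟩ := hF.exists_h₀_lipschitz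
  obtain ⟨Cd, hCd0, hCd⟩ := hP.exists_deriv_h₀_vS hF
  obtain ⟨Φ, hΦ, -, hΦL⟩ := hF.exists_fγ
  have hLf := hF.Lf_pos
  have hLg := hF.Lg_pos
  have hCA := hF.CA_pos
  have hCB := hP.CB_pos
  have hγ := hF.γX_mem
  have hδ := hF.δY_mem
  have hΓ := Real.Gamma_pos_of_pos hγ.1
  have hΓ' := Real.Gamma_pos_of_pos hδ.1
  have hΓ'' := Real.Gamma_pos_of_pos hF.δX_pos
  set q := F.Lf * F.CA * Real.Gamma F.γX / p₀ ^ F.γX with hqdef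
  have hq0 : 0 ≤ q := by positivity
  set k₂ := F.Lg * P.CB * Real.Gamma F.δY with hk₂
  have hk₂0 : 0 ≤ k₂ := by positivity
  set k₁ := F.CA * Cd * (Real.Gamma F.δX / p₀ ^ F.δX) with hk₁
  have hk₁0 : 0 ≤ k₁ := by positivity
  refine ⟨(k₁ + q * k₂) / (1 - q), div_nonneg (by positivity) (by linarith), ?_⟩
  intro ε hε ζ hζ hp w u vF vS hL N hN0 hN
  have hεi := inv_pos.2 hε
  have hh := hP.halfGap_pos hζ
  have hM0 : 0 ≤ max F.MA 1 := zero_le_one.trans (le_max_right _ _)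
  set η := P.rate F ζ with hη
  set H := P.halfGap ζ ^ F.δY with hH
  have hH0 : 0 < H := Real.rpow_pos_of_pos hh _
  have hvF : ∀ t ≤ 0, ‖vF t‖ ≤ k₂ / H * N * Real.exp (η * t) := fun t ht =>
    hL.norm_vF_le hP hF hζ hN ht
  set x : ℝ → F.X₁ := fun s => u s - F.h₀ (vS s) with hx
  have hh₀n : ∀ y, ‖F.h₀ y‖ ≤ Lh * ‖y‖ := fun y => by
    have := hLh y 0
    rwa [hF.h₀_zero, sub_zero, sub_zero] at this
  have hh₀c : ContinuousOn (fun s => F.h₀ (vS s)) (Iic 0) := by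
    have : LipschitzWith ⟨Lh, hLh0⟩ F.h₀ := LipschitzWith.of_dist_le_mul fun y y' => by
      rw [dist_eq_norm, dist_eq_norm]; exact hLh y y'
    exact this.continuous.comp_continuousOn hL.vS_continuousOn
  have hxb : ∀ t ≤ 0, ‖x t‖ ≤ (1 + Lh) * N * Real.exp (η * t) := by
    intro t ht
    have h1 := norm_sub_le (u t) (F.h₀ (vS t))
    have h2 : ‖u t‖ ≤ N * Real.exp (η * t) := by
      linarith [hN t ht, norm_nonneg (vF t), norm_nonneg (vS t)]
    have h3 : ‖vS t‖ ≤ N * Real.exp (η * t) := by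
      linarith [hN t ht, norm_nonneg (vF t), norm_nonneg (u t)]
    have h4 := (hh₀n (vS t)).trans (mul_le_mul_of_nonneg_left h3 hLh0)
    have h5 : ‖x t‖ ≤ ‖u t‖ + ‖F.h₀ (vS t)‖ := h1
    linarith
  -- `u` is compared with `h⁰(v_S)` rather than `h⁰(v_F + v_S)`. Then only `v_S` has to be
  -- differentiated, and `v_F` enters as a perturbation in `f` of size `k₂/H * N`.
  have hstep : ∀ D, 0 ≤ D → (∀ t ≤ 0, ‖x t‖ ≤ D * Real.exp (η * t)) → ∀ t ≤ 0,
      ‖x t‖ ≤ (q * D + (ε * k₁ + q * (k₂ / H)) * N) * Real.exp (η * t) := by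
    intro D hD0 hD t ht
    refine le_of_forall_le_exp (K := max F.MA 1 * Real.exp (ε⁻¹ * F.ωA * t) * D)
      (p := ε⁻¹ * (-F.ωA + ε * η)) (t := t - 1) (mul_pos hεi (hp₀.trans_le hp)) fun r hr => ?_
    have hrt : r < t := by linarith
    have hsub : Icc r t ⊆ Iic 0 := fun s hs => hs.2.trans ht
    obtain ⟨d, hdc, hd, hdn⟩ := hCd ε ζ hζ w u vF vS hL N hN0 hN r t hrt ht
    have hΦL' : ∀ (a : F.X₁) (b c : F.Y₁) (a' : F.X₁) (b' c' : F.Y₁), True → True →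
        ‖Φ a (b + c) - Φ a' (b' + c')‖ ≤ F.Lf * (‖a - a'‖ + ‖b - b'‖ + ‖c - c'‖) := by
      intro a b c a' b' c' _ _
      refine (hΦL _ _ _ _).trans (mul_le_mul_of_nonneg_left ?_ hLf.le)
      have := norm_add_le (b - b') (c - c')
      rw [show b - b' + (c - c') = b + c - (b' + c') by abel] at this
      linarith
    have hΦ1 : ContinuousOn (fun s => Φ (u s) (vF s + vS s)) (Icc r t) :=
      System.Admissible.continuousOn_of_lipschitz (G := fun x y z => Φ x (y + z))
        (p := fun _ _ _ => True) hΦL' (fun _ _ => trivial) (hL.u_continuousOn.mono hsub)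
        (hL.vF_continuousOn.mono hsub) (hL.vS_continuousOn.mono hsub)
    have hΦ2 : ContinuousOn (fun s => Φ (F.h₀ (vS s)) (vS s)) (Icc r t) := by
      have := System.Admissible.continuousOn_of_lipschitz (G := fun x y z => Φ x (y + z))
        (p := fun _ _ _ => True) hΦL' (s := Icc r t) (y := fun _ => 0) (fun _ _ => trivial)
        (hh₀c.mono hsub) continuousOn_const (hL.vS_continuousOn.mono hsub)
      simpa only [zero_add] using this
    have hm := BanachScale.mild_formula (Sc := F.XS) hF.generator_A (a := r) (b := t)
      (c := ε⁻¹) hrt.le hεi (x := fun s => F.h₀ (vS s))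
      (h := fun s => ε⁻¹ • F.XS.emb F.γX (Φ (F.h₀ (vS s)) (vS s)) + F.XS.emb F.δX (d s))
      (hh₀c.mono hsub) (fun s hs => by
        have h3 : HasDerivAt (fun s => F.XS.emb F.δX (F.XS.incl 1 F.δX (F.h₀ (vS s))))
            (F.XS.emb F.δX (d s)) s :=
          (F.XS.emb F.δX).hasFDerivAt.comp_hasDerivAt s (hd s hs)
        simp only [F.XS.emb_incl hF.δX_pos.le hF.δX_mem.2] at h3
        rw [hΦ, ← add_assoc, ← smul_add, hF.h₀_spec, smul_zero, zero_add]
        exact h3)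
      ((((F.XS.emb F.γX).continuous.comp_continuousOn hΦ2).const_smul ε⁻¹).add
        ((F.XS.emb F.δX).continuous.comp_continuousOn hdc))
    have hrc : ContinuousOn (fun s => ε⁻¹ * (t - s)) (Icc r t) := by fun_prop
    have hr0 : ∀ s ∈ Icc r t, 0 ≤ ε⁻¹ * (t - s) := fun s hs =>
      mul_nonneg hεi.le (sub_nonneg.2 hs.2)
    have hrep : F.XS.emb 1 (x t) = F.expA.toFun (ε⁻¹ * (t - r)) (F.XS.emb 1 (x r)) +
        ∫ s in r..t, F.expA.toFun (ε⁻¹ * (t - s))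
          (ε⁻¹ • F.XS.emb F.γX (Φ (u s) (vF s + vS s) - Φ (F.h₀ (vS s)) (vS s)) -
            F.XS.emb F.δX (d s)) := by
      have hu := hL.u_restart hε hrt.le ht
      have hi1 : IntervalIntegrable (fun s => F.expA.toFun (ε⁻¹ * (t - s))
          (ε⁻¹ • F.XS.emb F.γX (Φ (u s) (vF s + vS s)))) volume r t := by
        apply ContinuousOn.intervalIntegrable
        rw [uIcc_of_le hrt.le]
        exact F.expA.continuousOn_apply hrc hr0
          (((F.XS.emb F.γX).continuous.comp_continuousOn hΦ1).const_smul ε⁻¹)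
      have hi2 : IntervalIntegrable (fun s => F.expA.toFun (ε⁻¹ * (t - s))
          (ε⁻¹ • F.XS.emb F.γX (Φ (F.h₀ (vS s)) (vS s)) + F.XS.emb F.δX (d s))) volume r t := by
        apply ContinuousOn.intervalIntegrable
        rw [uIcc_of_le hrt.le]
        exact F.expA.continuousOn_apply hrc hr0
          ((((F.XS.emb F.γX).continuous.comp_continuousOn hΦ2).const_smul ε⁻¹).add
            ((F.XS.emb F.δX).continuous.comp_continuousOn hdc))
      simp only [← hΦ] at hu
      simp only [hx]
      rw [map_sub, hu, hm, add_sub_add_comm, ← map_sub, ← map_sub,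
        ← intervalIntegral.integral_sub hi1 hi2]
      congr 1
      refine intervalIntegral.integral_congr fun s _ => ?_
      simp only [← map_sub]
      congr 1
      rw [map_sub, smul_sub]
      abel
    have hest := hF.fast_estimate (a := r) (b := t) (c := ε⁻¹) hrt.le hεi (d := x)
      (w := fun s => Φ (u s) (vF s + vS s) - Φ (F.h₀ (vS s)) (vS s)) (e := d)
      (Bw := fun s => (F.Lf * (D + k₂ / H * N)) * Real.exp (η * s))
      (Be := fun s => (Cd * N) * Real.exp (η * s)) (hΦ1.sub hΦ2) hdc (by fun_prop) (by fun_prop)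
      (fun s hs => by
        have hs' := hsub (Ioo_subset_Icc_self hs)
        refine (hΦL _ _ _ _).trans ?_
        rw [add_sub_cancel_right, mul_assoc]
        refine mul_le_mul_of_nonneg_left ?_ hLf.le
        have h1 : ‖u s - F.h₀ (vS s)‖ ≤ D * Real.exp (η * s) := hD s hs'
        linarith [hvF s hs'])
      (fun s hs => hdn s hs) hrep
    rw [integral_kern_mul_const_mul, integral_kern_mul_const_mul, inv_inv] at hest
    have hpμ : p₀ ≤ -F.ωA + η / ε⁻¹ := by rw [div_inv_eq_mul, mul_comm η]; exact hp
    have hk := integral_kern_mul_exp_le' (c := ε⁻¹) (ω := F.ωA) (μ := η) hεi hγ.1 hp₀ hpμ hrt.le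
    have hk' := integral_kern_mul_exp_le' (c := ε⁻¹) (ω := F.ωA) (μ := η) hεi hF.δX_pos hp₀ hpμ
      hrt.le
    have hexp : Real.exp (F.ωA * (ε⁻¹ * (t - r))) * Real.exp (η * r) =
        Real.exp (ε⁻¹ * F.ωA * t) * Real.exp (ε⁻¹ * (-F.ωA + ε * η) * r) := by
      rw [← Real.exp_add, ← Real.exp_add]
      congr 1
      field_simp; ring
    have hxr := hD r (hrt.le.trans ht)
    have e1 : max F.MA 1 * Real.exp (F.ωA * (ε⁻¹ * (t - r))) * ‖x r‖ ≤
        max F.MA 1 * Real.exp (ε⁻¹ * F.ωA * t) * D *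
          Real.exp (ε⁻¹ * (-F.ωA + ε * η) * r) := by
      calc _ ≤ max F.MA 1 * Real.exp (F.ωA * (ε⁻¹ * (t - r))) * (D * Real.exp (η * r)) := by
            gcongr
        _ = max F.MA 1 * D * (Real.exp (F.ωA * (ε⁻¹ * (t - r))) * Real.exp (η * r)) := by ring
        _ = _ := by rw [hexp]; ring
    have hkH : 0 ≤ k₂ / H * N := by positivity
    have e2 : F.CA * (F.Lf * (D + k₂ / H * N) *
        ∫ s in r..t, kern ε⁻¹ F.γX F.ωA t s * Real.exp (η * s)) ≤
        q * (D + k₂ / H * N) * Real.exp (η * t) := by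
      calc _ ≤ F.CA * (F.Lf * (D + k₂ / H * N) *
            (Real.Gamma F.γX / p₀ ^ F.γX * Real.exp (η * t))) := by gcongr
        _ = _ := by rw [hqdef]; ring
    have e3 : ε * (F.CA * (Cd * N *
        ∫ s in r..t, kern ε⁻¹ F.δX F.ωA t s * Real.exp (η * s))) ≤
        ε * k₁ * N * Real.exp (η * t) := by
      calc _ ≤ ε * (F.CA * (Cd * N *
            (Real.Gamma F.δX / p₀ ^ F.δX * Real.exp (η * t)))) := by gcongr
        _ = _ := by rw [hk₁]; ring
    linarith
  set σ : ℝ → ℝ := fun t => ‖x t‖ * Real.exp (-(η * t)) with hσ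
  have hσiff : ∀ t M, σ t ≤ M ↔ ‖x t‖ ≤ M * Real.exp (η * t) := by
    intro t M
    simp only [hσ]
    rw [Real.exp_neg, ← div_eq_mul_inv, div_le_iff₀ (Real.exp_pos _)]
  have hbdd : BddAbove (σ '' Iic 0) :=
    ⟨_, by rintro _ ⟨t, ht, rfl⟩; exact (hσiff t _).2 (hxb t ht)⟩
  set S := sSup (σ '' Iic 0) with hS
  have hσS : ∀ t ≤ 0, σ t ≤ S := fun t ht => le_csSup hbdd ⟨t, ht, rfl⟩
  have hS0 : 0 ≤ S := le_trans (by positivity) (hσS 0 le_rfl)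
  -- The crude bound `hxb` makes the supremum finite, so it may be inserted into its own
  -- improvement.
  have hSle : S ≤ q * S + (ε * k₁ + q * (k₂ / H)) * N :=
    csSup_le ⟨_, mem_image_of_mem σ (mem_Iic.2 le_rfl)⟩ (by
      rintro _ ⟨t, ht, rfl⟩
      exact (hσiff t _).2 (hstep S hS0 (fun s hs => (hσiff s S).1 (hσS s hs)) t ht))
  have h0 := (hσiff 0 S).1 (hσS 0 le_rfl)
  rw [mul_zero, Real.exp_zero, mul_one] at h0
  refine h0.trans ?_
  rw [div_mul_eq_mul_div, div_mul_eq_mul_div, le_div_iff₀ (by linarith)]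
  have h1 : (ε * k₁ + q * (k₂ / H)) * N ≤ (k₁ + q * k₂) * (ε + 1 / H) * N := by
    have : (k₁ + q * k₂) * (ε + 1 / H) =
        ε * k₁ + q * (k₂ / H) + (k₁ * (1 / H) + q * k₂ * ε) := by ring
    rw [this]
    refine mul_le_mul_of_nonneg_right (le_add_of_nonneg_right ?_) hN0
    positivity
  linarith

/-- The error of the reduced slow subsystem for initial values on the slow manifold. -/
theorem exists_error_bound_slowManifold [CompleteSpace X] [CompleteSpace Y] {T : ℝ} (hT : 0 < T)
    {c : ℝ} (hc : c ∈ Ioo (0 : ℝ) 1) : ∃ C : ℝ, 0 < C ∧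
      ∀ ε ∈ Ioc (0 : ℝ) 1, ∀ ζ ∈ Ioo 0 P.ζ₀, 0 < F.ωB - ζ⁻¹ * F.ωA - P.NF ζ →
      ε < c * ζ * (((F.Lf * F.CA * Real.Gamma F.γX) ^ (1 / F.γX) + F.ωA) / F.ωA) →
      P.GapCondition F ε ζ →
      ∀ (u₀ : F.X₁) (v₀ : F.Y₁), (u₀, v₀) ∈ P.slowManifold F ε ζ →
      ∀ (u : ℝ → F.X₁) (v : ℝ → F.Y₁), F.IsStrictSolution ε T u₀ v₀ u v →
      ∀ (uζ : ℝ → F.X₁) (vζ : ℝ → F.Y₁), P.IsReducedSolution F ζ T v₀ uζ vζ →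
      ∀ t ∈ Icc 0 T,
        ‖u t - F.h₀ (vζ t)‖ + ‖v t - vζ t‖ ≤
          C * (ε + 1 / (F.ωB - ζ⁻¹ * F.ωA - P.NF ζ) ^ F.δY +
            1 / (P.NS ζ - P.NF ζ) ^ F.δY) * ‖v₀‖ := by
  obtain ⟨C₁, hC₁0, hC₁⟩ := hP.exists_error_bound hF hT
  obtain ⟨p₀, hp₀, hq, hp⟩ := hP.exists_contraction hF hc
  obtain ⟨C₂, hC₂0, hC₂⟩ := hP.exists_trajectory_bound hF hp₀ hq
  obtain ⟨C₃, hC₃0, hC₃⟩ := hP.exists_distance_bound hF hp₀ hq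
  obtain ⟨Lh, hLh0, hLh⟩ := hF.exists_h₀_lipschitz
  have hLg := hF.Lg_pos
  have hCB := hP.CB_pos
  have hδ := hF.δY_mem
  have hΓ := Real.Gamma_pos_of_pos hδ.1
  set k := F.Lg * P.CB * Real.Gamma F.δY * 2 ^ F.δY * (C₂ * |P.K|) with hk
  have hk0 : 0 ≤ k := by positivity
  set k' := C₃ * (1 + 2 ^ F.δY) * (C₂ * |P.K|) with hk'
  have hk'0 : 0 ≤ k' := by positivity
  refine ⟨C₁ * (k + 1 + 2 * (k' + Lh * k)), by positivity, ?_⟩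
  intro ε hε ζ hζ hm hεζ hgap u₀ v₀ hmem u v hs uζ vζ hr t ht
  obtain ⟨w, U, VF, VS, hw, hL, heq⟩ := hmem
  obtain ⟨rfl, rfl⟩ := Prod.mk.inj heq
  set v₀ := VF 0 + w with hv₀
  have hVF0 := hL.vF_mem 0 le_rfl
  have hVS : VS 0 = w := by
    apply F.YS.emb_injective zero_le_one
    rw [hL.vS_eq 0 le_rfl, intervalIntegral.integral_same, add_zero, hP.group_zero hζ,
      hP.prS_eq_self hζ hw]
  have hwS : F.YS.emb 1 w = P.prS ζ (F.YS.emb 1 v₀) := by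
    rw [hv₀, map_add, map_add, hVF0, zero_add, hP.prS_eq_self hζ hw]
  have hFF : F.YS.emb 1 (VF 0) = P.prF ζ (F.YS.emb 1 v₀) := by
    rw [hv₀, map_add, map_add, hw, add_zero, hP.prF_eq_self hζ hVF0]
  have hwn : ‖w‖ ≤ |P.K| * ‖v₀‖ := by
    have := hP.prS_bound ζ hζ v₀
    rw [← hwS, F.YS.normLE_emb_iff zero_le_one] at this
    exact this.trans (mul_le_mul_of_nonneg_right (le_abs_self _) (norm_nonneg _))
  have hpe := hp ε hε.1 ζ hζ hεζ
  have htr := hC₂ ε hε.1 ζ hζ hpe hgap w U VF VS hw hL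
  have hh := hP.halfGap_pos hζ
  have hgp : 0 < P.NS ζ - P.NF ζ := sub_pos.2 (hP.NF_lt_NS ζ hζ)
  set G := 1 / (P.NS ζ - P.NF ζ) ^ F.δY with hG
  have hG0 : 0 ≤ G := by positivity
  have hHG : 1 / P.halfGap ζ ^ F.δY = 2 ^ F.δY * G := by
    rw [halfGap, Real.div_rpow hgp.le zero_le_two, hG]
    field_simp
  have hN0 : 0 ≤ C₂ * ‖w‖ := by positivity
  have hNv : C₂ * ‖w‖ ≤ C₂ * |P.K| * ‖v₀‖ := by
    rw [mul_assoc]; exact mul_le_mul_of_nonneg_left hwn hC₂0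
  set m := 1 / (F.ωB - ζ⁻¹ * F.ωA - P.NF ζ) ^ F.δY with hmdef
  have hm0 : 0 ≤ m := by
    have := Real.rpow_pos_of_pos hm F.δY
    positivity
  have hε0 := hε.1.le
  set R := (ε + m + G) * ‖v₀‖ with hR
  have hR0 : 0 ≤ R := by positivity
  have hGR : G * ‖v₀‖ ≤ R := by
    rw [hR]; exact mul_le_mul_of_nonneg_right (by linarith) (norm_nonneg _)
  have hεmR : (ε + m) * ‖v₀‖ ≤ R := by
    rw [hR]; exact mul_le_mul_of_nonneg_right (by linarith) (norm_nonneg _)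
  have h2δ : (0 : ℝ) < 2 ^ F.δY := Real.rpow_pos_of_pos two_pos _
  have hVFn : ‖VF 0‖ ≤ k * R := by
    have h1 := hL.norm_vF_le hP hF hζ htr le_rfl
    rw [mul_zero, Real.exp_zero, mul_one, div_eq_mul_one_div, hHG] at h1
    calc ‖VF 0‖ ≤ F.Lg * P.CB * Real.Gamma F.δY * (2 ^ F.δY * G) * (C₂ * |P.K| * ‖v₀‖) :=
          h1.trans (by gcongr)
      _ = k * (G * ‖v₀‖) := by rw [hk]; ring
      _ ≤ k * R := by gcongr
  have hdist : ‖U 0 - F.h₀ v₀‖ ≤ (k' + Lh * k) * R := by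
    have h1 := hC₃ ε hε.1 ζ hζ hpe w U VF VS hL (C₂ * ‖w‖) hN0 htr
    rw [hVS, hHG] at h1
    have h2 : C₃ * (ε + 2 ^ F.δY * G) * (C₂ * ‖w‖) ≤ k' * R := by
      have h3 : ε + 2 ^ F.δY * G ≤ (1 + 2 ^ F.δY) * (ε + m + G) := by
        have : (1 + 2 ^ F.δY) * (ε + m + G) =
            ε + 2 ^ F.δY * G + (m + G + 2 ^ F.δY * (ε + m)) := by ring
        rw [this]
        exact le_add_of_nonneg_right (by positivity)
      calc _ ≤ C₃ * ((1 + 2 ^ F.δY) * (ε + m + G)) * (C₂ * |P.K| * ‖v₀‖) := by gcongr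
        _ = _ := by rw [hk', hR]; ring
    have h3 := hLh w v₀
    have h4 : ‖w - v₀‖ = ‖VF 0‖ := by rw [hv₀, sub_add_cancel_right, norm_neg]
    rw [h4] at h3
    have h5 := mul_le_mul_of_nonneg_left hVFn hLh0
    calc ‖U 0 - F.h₀ v₀‖ = ‖(U 0 - F.h₀ w) + (F.h₀ w - F.h₀ v₀)‖ := by congr 1; abel
      _ ≤ ‖U 0 - F.h₀ w‖ + ‖F.h₀ w - F.h₀ v₀‖ := norm_add_le _ _
      _ ≤ k' * R + Lh * (k * R) := add_le_add (h1.trans h2) (h3.trans h5)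
      _ = _ := by ring
  -- On the slow manifold both initial quantities are already of order `R`, so the coefficient
  -- `ε^δ_Y + e^(ωf t/ε)` need only be bounded by 2.
  have hfin := hC₁ ε hε ζ hζ hm (U 0) v₀ (VF 0) hFF u v hs uζ vζ hr t ht
  have hε1 : ε ^ F.δY ≤ 1 := Real.rpow_le_one hε0 hε.2 hδ.1.le
  have hE1 : Real.exp (ε⁻¹ * F.ωf * t) ≤ 1 := by
    apply Real.exp_le_one_iff.2
    exact mul_nonpos_of_nonpos_of_nonneg (mul_nonpos_of_nonneg_of_nonpos
      (inv_nonneg.2 hε0) hF.ωf_neg.le) ht.1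
  have h2 : (ε ^ F.δY + Real.exp (ε⁻¹ * F.ωf * t)) * ‖U 0 - F.h₀ v₀‖ ≤
      2 * ((k' + Lh * k) * R) := by
    have := norm_nonneg (U 0 - F.h₀ v₀)
    have : 0 ≤ ε ^ F.δY + Real.exp (ε⁻¹ * F.ωf * t) := by
      have := Real.rpow_nonneg hε0 F.δY
      positivity
    exact mul_le_mul (by linarith) hdist (norm_nonneg _) zero_le_two
  refine hfin.trans ?_
  calc _ ≤ C₁ * (k * R + R + 2 * ((k' + Lh * k) * R)) :=
        mul_le_mul_of_nonneg_left (add_le_add (add_le_add hVFn hεmR) h2) hC₁0.le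
    _ = _ := by rw [hR]; ring

end Admissible

end Splitting

end FastSlow

theorem mainTheorem7 {X Y : Type u}
    [NormedAddCommGroup X] [NormedSpace ℝ X] [CompleteSpace X]
    [NormedAddCommGroup Y] [NormedSpace ℝ Y] [CompleteSpace Y]
    (F : FastSlow.System X Y) (hF : F.Admissible)
    (P : FastSlow.Splitting Y) (hP : P.Admissible F) :
    -- the estimate for arbitrary initial values
    (∀ T : ℝ, 0 < T → ∃ C : ℝ, 0 < C ∧
      ∀ ε ∈ Ioc (0 : ℝ) 1, ∀ ζ ∈ Ioo 0 P.ζ₀, 0 < F.ωB - ζ⁻¹ * F.ωA - P.NF ζ →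
      ∀ (u₀ : F.X₁) (v₀ v₀F : F.Y₁), F.YS.emb 1 v₀F = P.prF ζ (F.YS.emb 1 v₀) →
      ∀ (u : ℝ → F.X₁) (v : ℝ → F.Y₁), F.IsStrictSolution ε T u₀ v₀ u v →
      ∀ (uζ : ℝ → F.X₁) (vζ : ℝ → F.Y₁), P.IsReducedSolution F ζ T v₀ uζ vζ →
      ∀ t ∈ Icc 0 T,
        ‖u t - F.h₀ (vζ t)‖ + ‖v t - vζ t‖ ≤
          C * (‖v₀F‖ +
            (ε + 1 / (F.ωB - ζ⁻¹ * F.ωA - P.NF ζ) ^ F.δY) * ‖v₀‖ +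
            (ε ^ F.δY + Real.exp (ε⁻¹ * F.ωf * t)) * ‖u₀ - F.h₀ v₀‖)) ∧
    -- the estimate for initial values on the slow manifold
    (∀ T : ℝ, 0 < T → ∀ c ∈ Ioo (0 : ℝ) 1, ∃ C : ℝ, 0 < C ∧
      ∀ ε ∈ Ioc (0 : ℝ) 1, ∀ ζ ∈ Ioo 0 P.ζ₀, 0 < F.ωB - ζ⁻¹ * F.ωA - P.NF ζ →
      ε < c * ζ * (((F.Lf * F.CA * Real.Gamma F.γX) ^ (1 / F.γX) + F.ωA) / F.ωA) →
      P.GapCondition F ε ζ →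
      ∀ (u₀ : F.X₁) (v₀ : F.Y₁), (u₀, v₀) ∈ P.slowManifold F ε ζ →
      ∀ (u : ℝ → F.X₁) (v : ℝ → F.Y₁), F.IsStrictSolution ε T u₀ v₀ u v →
      ∀ (uζ : ℝ → F.X₁) (vζ : ℝ → F.Y₁), P.IsReducedSolution F ζ T v₀ uζ vζ →
      ∀ t ∈ Icc 0 T,
        ‖u t - F.h₀ (vζ t)‖ + ‖v t - vζ t‖ ≤
          C * (ε + 1 / (F.ωB - ζ⁻¹ * F.ωA - P.NF ζ) ^ F.δY +
            1 / (P.NS ζ - P.NF ζ) ^ F.δY) * ‖v₀‖) :=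
  ⟨fun _ hT => hP.exists_error_bound hF hT,
    fun _ hT _ hc => hP.exists_error_bound_slowManifold hF hT hc⟩
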